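/- **Setting.** Let $n,l,r$ be non-negative integers with $l+r\le n$, and let $\mathbf s=(s_1,\dots,s_l)$ be a weakly decreasing and $\mathbf t=(t_{n-r+1},\dots,t_n)$ a weakly increasing sequence of non-negative integers. Consider the triangular shape with cells $(i,j)$, $1\le j\le i\le n$ (row $i$ from the top, position $j$ in the row). The cell $(i,j)$ lies on the $j$-th NE-diagonal and on the $(n-i+j)$-th SE-diagonal; $(i+1,j)$ and $(i+1,j+1)$ are its SW and SE neighbours. Delete the bottom $s_i$ cells of the $i$-th NE-diagonal for $1\le i\le l$ and the bottom $t_i$ cells of the $i$-th SE-diagonal for $n-r+1\le i\le n$. Assume that the two kinds of deletions do not interfere, i.e. every one of the $n$ rows keeps at least one cell. A remaining cell is *regular* if both its SW and its SE neighbour remain. An $(\mathbf s,\mathbf t)$-tree of order $n$ is a filling $M=(m_{i,j})$ of the remaining cells with integers such that $m_{i+1,j}\le m_{i,j}\le m_{i+1,j+1}$ for every regular cell $(i,j)$, and $m_{i,j}\ne m_{i,j+1}$ whenever $(i,j)$ and $(i,j+1)$ are both regular. The bottom entry of a diagonal is its lowest remaining entry. Let $\operatorname{inv}(M)=\#\{(i,j)\text{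 regular}: m_{i,j}=m_{i+1,j+1}\}$ and $\operatorname{inv}'(M)=\#\{(i,j)\text{ regular}: m_{i,j}=m_{i+1,j}\}$. For a set $J\subseteq\{j: n-r+1\le j\le n-1,\ t_j<t_{j+1}\}\cup\{n\}$ of exceptional SE-diagonals, $\operatorname{inv}_J$ is defined like $\operatorname{inv}$, but only counting those $(i,j)$ for which $m_{i+1,j+1}$ is not the bottom entry of an exceptional SE-diagonal. For a set $I\subseteq\{1\}\cup\{i: 2\le i\le l,\ s_{i-1}>s_i\}$ of exceptional NE-diagonals, $\operatorname{inv}'_I$ is defined like $\operatorname{inv}'$, but only counting those $(i,j)$ for which $m_{i+1,j}$ is not the bottom entry of an exceptional NE-diagonal. (Here $I,J\subseteq\{1,\dots,n\}$.) Let $u,v$ be elements of a commutative ring (for instance indeterminates), let $b_1<b_2<\dots<b_n$ be integers, and let $\mathcal T$ be the set of $(\mathbf s,\mathbf t)$-trees of order $n$ such that the bottom entry of the $i$-th NE-diagonal is $b_i$ for $1\le i\le n-r$ and the bottom entry of the $i$-th SE-diagonal is $b_i$ for $n-r+1\le i\le n$. Rational functions are expanded into Laurent series by expanding powers of $1+cx_i$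 in non-negative powers of $x_i$. Put $$F(\mathbf x)=\prod_{i=1}^{l}\left(\frac{x_i}{(v-1)x_i-1}\right)^{s_i}\prod_{i=n-r+1}^{n}\left(\frac{x_i}{ux_i+1}\right)^{t_i}\prod_{i=1}^{n}(1+x_i)^{b_i}x_i^{-n+1}\prod_{1\le i<j\le n}(x_i-x_j)\bigl(1+(1-v)x_i+u(x_j+x_ix_j)\bigr),$$ $$E_{I,J}(\mathbf x)=\prod_{i\in I}\frac{1}{1+(1-v)x_i}\prod_{j\in J}\frac{1+x_j}{1+ux_j},$$ $$P_{n,a,\min,\max}(\mathbf x)=\sum_{k=0}^{\max-\min}(-1)^{a+\min+k}\binom{k}{a-\min}\prod_{i=1}^n(1+x_i)^{-\min}\,\langle z^k\rangle\prod_{i=1}^n\frac{1}{1-x_i^{-1}z},$$ where $\frac1{1-x_i^{-1}z}=\sum_{m\ge0}z^mx_i^{-m}$ and $\langle z^k\rangle$ takes the coefficient of $z^k$. **Statement.** The set $\mathcal T$ is finite, and the following hold. 1. $\sum_{M\in\mathcal T}u^{\operatorname{inv}(M)}v^{\operatorname{inv}'(M)}$ is the constant term of $F(\mathbf x)$ in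 $x_1,\dots,x_n$. 2. For all $I,J$ as above, $\sum_{M\in\mathcal T}u^{\operatorname{inv}_J(M)}v^{\operatorname{inv}'_I(M)}$ is the constant term of $F(\mathbf x)E_{I,J}(\mathbf x)$. 3. Let $n\ge1$ and let $\min\le a\le\max$ be integers with $\min\le b_1$ and $b_n\le\max$. If the sum in 1 is restricted to the trees with top entry $m_{1,1}=a$, it is the constant term of $F(\mathbf x)P_{n,a,\min,\max}(\mathbf x)$. If the sum in 2 is restricted to the trees with top entry $m_{1,1}=a$, it is the constant term of $F(\mathbf x)E_{I,J}(\mathbf x)P_{n,a,\min,\max}(\mathbf x)$, provided that $m_{1,1}$ is not itself the bottom entry of an exceptional diagonal (an NE-diagonal in $I$ or an SE-diagonal in $J$). In the special case $u=v=1$, all this remains true if $b_1\le b_2\le\dots\le b_n$ is only weakly increasing. -/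

import Mathlib

open scoped BigOperators

/-! ### Truncated monotone triangles

A cell `(i, j)` is the position of the entry `m_{i,j}`, the `j`-th entry of the `i`-th row from the
top, `1 ≤ j ≤ i ≤ n`. The cell `(i, j)` lies on the `j`-th NE-diagonal and on the
`(n - i + j)`-th SE-diagonal (both counted from the left). -/

namespace STTree

/-- `(i, j)` is one of the bottom `s_j` positions of the `j`-th NE-diagonal, for some
`1 ≤ j ≤ l`. -/
def DeletedNE (n l : ℕ) (s : ℕ → ℕ) (c : ℕ × ℕ) : Prop :=
  1 ≤ c.2 ∧ c.2 ≤ l ∧ n < c.1 + s c.2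

/-- `(i, j)` is one of the bottom `t_e` positions of the `e`-th SE-diagonal, for some
`n - r + 1 ≤ e ≤ n`. -/
def DeletedSE (n r : ℕ) (t : ℕ → ℕ) (c : ℕ × ℕ) : Prop :=
  ∃ e ∈ Finset.Icc (n - r + 1) n, c.2 + n = c.1 + e ∧ n < c.1 + t e

open Classical in
/-- The shape of an `(s, t)`-tree of order `n`, with `s = (s_1, …, s_l)` and
`t = (t_{n-r+1}, …, t_n)`. The values of `s` and `t` at other indices are not used. -/
noncomputable def shape (n l r : ℕ) (s t : ℕ → ℕ) : Finset (ℕ × ℕ) :=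
  (Finset.Icc 1 n ×ˢ Finset.Icc 1 n).filter fun c =>
    c.2 ≤ c.1 ∧ ¬ DeletedNE n l s c ∧ ¬ DeletedSE n r t c

/-- No interference between the two kinds of deletions: they never use up a whole row. -/
def NoInterference (n l r : ℕ) (s t : ℕ → ℕ) : Prop :=
  ∀ i ∈ Finset.Icc 1 n, ∃ j, (i, j) ∈ shape n l r s t

/-- An array of integers of shape `S`. -/
abbrev Filling (S : Finset (ℕ × ℕ)) : Type := S → ℤ

/-- The cell `(i, j)` is regular: it has a SW neighbour and a SE neighbour. -/
def RegularCell (S : Finset (ℕ × ℕ)) (i j : ℕ) : Prop :=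
  (i, j) ∈ S ∧ (i + 1, j) ∈ S ∧ (i + 1, j + 1) ∈ S

/-- `c` is the bottom cell of the `j`-th NE-diagonal of the shape `S`. -/
def IsBottomNE (S : Finset (ℕ × ℕ)) (j : ℕ) (c : ℕ × ℕ) : Prop :=
  c ∈ S ∧ c.2 = j ∧ ∀ d ∈ S, d.2 = j → d.1 ≤ c.1

/-- `c` is the bottom cell of the `e`-th SE-diagonal of the shape `S` (of order `n`). -/
def IsBottomSE (n : ℕ) (S : Finset (ℕ × ℕ)) (e : ℕ) (c : ℕ × ℕ) : Prop :=
  c ∈ S ∧ c.2 + n = c.1 + e ∧ ∀ d ∈ S, d.2 + n = d.1 + e → d.1 ≤ c.1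

/-- The monotonicity conditions of an `(s, t)`-tree. -/
structure IsTree {S : Finset (ℕ × ℕ)} (M : Filling S) : Prop where
  le_of_regular : ∀ (i j : ℕ) (h : (i, j) ∈ S) (hl : (i + 1, j) ∈ S) (hr : (i + 1, j + 1) ∈ S),
    M ⟨(i + 1, j), hl⟩ ≤ M ⟨(i, j), h⟩ ∧ M ⟨(i, j), h⟩ ≤ M ⟨(i + 1, j + 1), hr⟩
  ne_of_regular : ∀ (i j : ℕ) (h : RegularCell S i j) (h' : RegularCell S i (j + 1)),
    M ⟨(i, j), h.1⟩ ≠ M ⟨(i, j + 1), h'.1⟩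

/-- The `(s, t)`-trees of order `n` in which the bottom entry of the `i`-th NE-diagonal is `b_i`
for `1 ≤ i ≤ n - r` and the bottom entry of the `i`-th SE-diagonal is `b_i` for
`n - r + 1 ≤ i ≤ n`. -/
def trees (n l r : ℕ) (s t : ℕ → ℕ) (b : ℕ → ℤ) : Set (Filling (shape n l r s t)) :=
  {M | IsTree M ∧
    (∀ i ∈ Finset.Icc 1 (n - r), ∀ (c : ℕ × ℕ) (h : IsBottomNE (shape n l r s t) i c),
      M ⟨c, h.1⟩ = b i) ∧
    (∀ i ∈ Finset.Icc (n - r + 1) n, ∀ (c : ℕ × ℕ) (h : IsBottomSE n (shape n l r s t) i c),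
      M ⟨c, h.1⟩ = b i)}

/-- Those of these trees whose top row is `a`. -/
def treesTop (n l r : ℕ) (s t : ℕ → ℕ) (b : ℕ → ℤ) (a : ℤ) : Set (Filling (shape n l r s t)) :=
  {M | M ∈ trees n l r s t b ∧ ∃ h : (1, 1) ∈ shape n l r s t, M ⟨(1, 1), h⟩ = a}

/-- `inv(M) = #{m_{i,j} regular : m_{i,j} = m_{i+1,j+1}}`. -/
noncomputable def inv {S : Finset (ℕ × ℕ)} (M : Filling S) : ℕ :=
  Set.ncard {c : ℕ × ℕ | ∃ h : RegularCell S c.1 c.2,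
    M ⟨(c.1, c.2), h.1⟩ = M ⟨(c.1 + 1, c.2 + 1), h.2.2⟩}

/-- `inv'(M) = #{m_{i,j} regular : m_{i,j} = m_{i+1,j}}`. -/
noncomputable def inv' {S : Finset (ℕ × ℕ)} (M : Filling S) : ℕ :=
  Set.ncard {c : ℕ × ℕ | ∃ h : RegularCell S c.1 c.2,
    M ⟨(c.1, c.2), h.1⟩ = M ⟨(c.1 + 1, c.2), h.2.1⟩}

/-- `inv_J(M)`: as `inv(M)`, but `m_{i+1,j+1}` must not be the bottom entry of an exceptional
SE-diagonal (one whose number lies in `J`). -/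
noncomputable def invEx (n : ℕ) (J : Finset ℕ) {S : Finset (ℕ × ℕ)} (M : Filling S) : ℕ :=
  Set.ncard {c : ℕ × ℕ | (∃ h : RegularCell S c.1 c.2,
    M ⟨(c.1, c.2), h.1⟩ = M ⟨(c.1 + 1, c.2 + 1), h.2.2⟩) ∧
    ¬ ∃ e ∈ J, IsBottomSE n S e (c.1 + 1, c.2 + 1)}

/-- `inv'_I(M)`: as `inv'(M)`, but `m_{i+1,j}` must not be the bottom entry of an exceptional
NE-diagonal (one whose number lies in `I`). -/
noncomputable def invEx' (I : Finset ℕ) {S : Finset (ℕ × ℕ)} (M : Filling S) : ℕ :=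
  Set.ncard {c : ℕ × ℕ | (∃ h : RegularCell S c.1 c.2,
    M ⟨(c.1, c.2), h.1⟩ = M ⟨(c.1 + 1, c.2), h.2.1⟩) ∧
    ¬ ∃ e ∈ I, IsBottomNE S e (c.1 + 1, c.2)}

/-- `I ⊆ {1} ∪ {i | s_{i-1} > s_i}`, a set of NE-diagonals. -/
def ExceptionalNE (n l : ℕ) (s : ℕ → ℕ) (I : Finset ℕ) : Prop :=
  ∀ i ∈ I, i ∈ Finset.Icc 1 n ∧ (i = 1 ∨ (i ∈ Finset.Icc 2 l ∧ s i < s (i - 1)))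

/-- `J ⊆ {j | t_j < t_{j+1}} ∪ {n}`, a set of SE-diagonals. -/
def ExceptionalSE (n r : ℕ) (t : ℕ → ℕ) (J : Finset ℕ) : Prop :=
  ∀ j ∈ J, j ∈ Finset.Icc 1 n ∧ (j = n ∨ (n - r + 1 ≤ j ∧ j + 1 ≤ n ∧ t j < t (j + 1)))

/-- The generating function `∑_M u^{inv(M)} v^{inv'(M)}` of a set `T` of fillings. -/
noncomputable def genFun {R : Type*} [CommRing R] (u v : R) {S : Finset (ℕ × ℕ)}
    (T : Set (Filling S)) : R :=
  ∑ᶠ M ∈ T, u ^ inv M * v ^ inv' M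

/-- The generating function `∑_M u^{inv_J(M)} v^{inv'_I(M)}` of a set `T` of fillings. -/
noncomputable def genFunEx {R : Type*} [CommRing R] (u v : R) (n : ℕ) (I J : Finset ℕ)
    {S : Finset (ℕ × ℕ)} (T : Set (Filling S)) : R :=
  ∑ᶠ M ∈ T, u ^ invEx n J M * v ^ invEx' I M

/-! ### Multivariate Laurent series -/

/-- Laurent series over `R` in variables `x_i` (`i : ℕ`): Hahn series whose exponents are the
finitely supported integer vectors, ordered coordinatewise. -/
abbrev Laurent (R : Type*) [CommRing R] : Type _ := HahnSeries (ℕ →₀ ℤ) R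

section Series

variable {R : Type*} [CommRing R]

/-- The constant term. -/
noncomputable def constTerm (f : Laurent R) : R := f.coeff 0

/-- The variable `x_i`, as a unit. -/
noncomputable def x (i : ℕ) : (Laurent R)ˣ where
  val := HahnSeries.single (Finsupp.single i 1) 1
  inv := HahnSeries.single (Finsupp.single i (-1)) 1
  val_inv := by
    rw [HahnSeries.single_mul_single, ← Finsupp.single_add]; simp
  inv_val := by
    rw [HahnSeries.single_mul_single, ← Finsupp.single_add]; simp

/-- The variable `x_i`, as a Laurent series. -/
noncomputable abbrev X (R : Type*) [CommRing R] (i : ℕ) : Laurent R :=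
  Units.val (x (R := R) i)

/-- The expansion of a one-variable power series in the variable `x_i`. -/
noncomputable def inVar (i : ℕ) : PowerSeries R →+* Laurent R :=
  (HahnSeries.embDomainRingHom
      ((Finsupp.singleAddHom i).comp (Nat.castAddMonoidHom ℤ))
      (fun a b h => Int.ofNat_injective (Finsupp.single_injective i h))
      (fun a b => by simp)).comp
    (RingEquiv.toRingHom HahnSeries.toPowerSeries.symm)

theorem inVar_C (i : ℕ) (c : R) : inVar i (PowerSeries.C c) = HahnSeries.C c := by
  have h : HahnSeries.toPowerSeries.symm (PowerSeries.C c) = HahnSeries.C c := by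
    rw [RingEquiv.symm_apply_eq]
    ext k
    rw [HahnSeries.coeff_toPowerSeries, PowerSeries.coeff_C]
    simp [HahnSeries.C_apply, HahnSeries.coeff_single]
  simp only [inVar, RingHom.comp_apply]
  erw [h]
  exact HahnSeries.embDomainRingHom_C

theorem inVar_X (i : ℕ) : inVar i (PowerSeries.X : PowerSeries R) = X R i := by
  have h : HahnSeries.toPowerSeries.symm (PowerSeries.X : PowerSeries R)
      = HahnSeries.single 1 1 := by
    rw [RingEquiv.symm_apply_eq]
    ext k
    rw [HahnSeries.coeff_toPowerSeries, PowerSeries.coeff_X]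
    simp [HahnSeries.coeff_single]
  simp only [inVar, RingHom.comp_apply]
  erw [h]
  refine HahnSeries.embDomain_single.trans ?_
  simp [X, x]

/-- The unit `1 + c x_i`. Its inverse is the geometric series in non-negative powers of `x_i`. -/
noncomputable def onePlus (c : R) (i : ℕ) : (Laurent R)ˣ where
  val := 1 + HahnSeries.C c * X R i
  inv := inVar i (PowerSeries.invOfUnit (1 + PowerSeries.C c * PowerSeries.X) 1)
  val_inv := by
    have h := congrArg (inVar i)
      (PowerSeries.mul_invOfUnit (1 + PowerSeries.C c * PowerSeries.X) 1 (by simp))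
    simpa only [map_mul, map_add, map_one, inVar_C, inVar_X] using h
  inv_val := by
    have h := congrArg (inVar i)
      (PowerSeries.mul_invOfUnit (1 + PowerSeries.C c * PowerSeries.X) 1 (by simp))
    rw [mul_comm]
    simpa only [map_mul, map_add, map_one, inVar_C, inVar_X] using h

/-- The unit `(v - 1) x_i - 1`. -/
noncomputable def vFactor (v : R) (i : ℕ) : (Laurent R)ˣ := -onePlus (1 - v) i

theorem val_vFactor (v : R) (i : ℕ) : (vFactor v i : Laurent R)
    = HahnSeries.C (v - 1) * X R i - 1 := by
  simp only [vFactor, Units.val_neg, onePlus, map_sub, map_one]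
  ring

/-- The expression whose constant term is the generating function of `(s, t)`-trees:
`∏_{i=1}^l (x_i / ((v-1) x_i - 1))^{s_i} ∏_{i=n-r+1}^n (x_i / (u x_i + 1))^{t_i}
 ∏_{i=1}^n (1 + x_i)^{b_i} x_i^{-n+1}
 ∏_{1 ≤ i < j ≤ n} (x_i - x_j) (1 + (1-v) x_i + u (x_j + x_i x_j))`. -/
noncomputable def integrand (n l r : ℕ) (s t : ℕ → ℕ) (b : ℕ → ℤ) (u v : R) : Laurent R :=
  (((∏ i ∈ Finset.Icc 1 l, (x i / vFactor v i) ^ s i) *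
      (∏ i ∈ Finset.Icc (n - r + 1) n, (x i / onePlus u i) ^ t i) *
      (∏ i ∈ Finset.Icc 1 n, onePlus 1 i ^ b i * x i ^ (-(n : ℤ) + 1)) : (Laurent R)ˣ) :
        Laurent R) *
    ∏ i ∈ Finset.Icc 1 n, ∏ j ∈ Finset.Ioc i n,
      ((X R i - X R j) *
        (1 + HahnSeries.C (1 - v) * X R i + HahnSeries.C u * (X R j + X R i * X R j)))

/-- `∏_{i ∈ I} 1 / (1 + (1-v) x_i) ∏_{j ∈ J} (1 + x_j) / (1 + u x_j)`. -/
noncomputable def exFactor (I J : Finset ℕ) (u v : R) : Laurent R :=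
  (((∏ i ∈ I, (onePlus (1 - v) i)⁻¹) * (∏ j ∈ J, onePlus 1 j / onePlus u j) : (Laurent R)ˣ) :
    Laurent R)

/-- `P_{n,a,min,max}(x) = ∑_{k=0}^{max-min} (-1)^{a+min+k} binom(k, a-min)
∏_{i=1}^n (1 + x_i)^{-min} ⟨z^k⟩ ∏_{i=1}^n 1 / (1 - x_i^{-1} z)`, where
`1 / (1 - x_i^{-1} z) = ∑_k z^k x_i^{-k}` and `⟨z^k⟩` takes the coefficient of `z^k`. -/
noncomputable def topFactor (R : Type*) [CommRing R] (n : ℕ) (a mn mx : ℤ) : Laurent R :=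
  ∑ k ∈ Finset.range ((mx - mn).toNat + 1),
    (((-1) ^ (a + mn + (k : ℤ)) * (∏ i ∈ Finset.Icc 1 n, onePlus 1 i ^ (-mn)) : (Laurent R)ˣ) :
        Laurent R) *
      (k.choose (a - mn).toNat : Laurent R) *
      PowerSeries.coeff k
        (∏ i ∈ Finset.Icc 1 n,
          PowerSeries.mk fun m => (((x i)⁻¹ ^ m : (Laurent R)ˣ) : Laurent R))

end Series

end STTree

namespace STTree

section LaurentTools

variable {R : Type*} [CommRing R]

/-! ### Constant terms and renaming of variables -/

/-! The proof is an induction on the order, deleting the bottom row. In order n + 1 let the bottom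
row occupy the positions p + 1, …, p + K + 1. The regular cells of row n are then (n, j) with p < j
≤ p + K. Let a be the row of their entries. Deleting the bottom row leaves a tree of order n whose
positive deletion lengths have dropped by one and whose new bottom entries are the a_j. By induction
its generating function is the constant term of Φ ∏ (1 + x_j)^{a_j}, where Φ does not depend on a.
It remains to compare the weighted sum over a with the constant term in order n + 1.

Sum over a: a single entry between b_j and b_{j+1} contributes r_j (1 + x_j)^{b_{j+1}} + l_j (1 +
x_j)^{b_j}, with r_j = (1 + u x_j)/x_j and l_j = -(1 + (1-v) x_j)/x_j (`sum_entryWeight`).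
Multiplying these out, a factor r_j directly followed by l_{j+1} carries the same exponent b_{j+1}
in both variables. Excluding a_j = a_{j+1} subtracts uv from r_j l_{j+1}. The difference is, up to
sign, the pair factor of (j+1, j) times a symmetric term (`rFac_mul_lFac_sub`). Since Φ contains x_j
- x_{j+1} and the pair factor of (j, j+1), the product is antisymmetric and has constant term 0.
Only the choices l … l r … r survive (`nullAt_rowSum_sub`).

Constant term in order n + 1: the powers x_i^{-n} turn ∏ (x_i - x_j) into a Vandermonde product in
the inverses y_i = 1/x_i. Expand it with respect to the index m whose y_m has degree zero. Then x_m
has no negative powers and may be set to 0. This kills the term if diagonal m is shortened, and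
otherwise turns the pair factors with m into l_j for j < m and r_j after m (`constTerm_term`). Hence
the same sum l … l r … r appears. On shortened diagonals, l and r cancel one deletion factor.

The factor for a prescribed top entry is built from complete homogeneous polynomials in the y_i, for
which the Vandermonde expansion stays valid (`pairProd_mul_homog`); in order 1 it is binomial
inversion. If b is only weakly increasing and u = v = 1, the inclusion-exclusion leaves terms with
three equal neighbours in a. Their constant terms vanish by the induction hypothesis, because no
tree has such a bottom row. -/

theorem constTerm_add (f g : Laurent R) : constTerm (f + g) = constTerm f + constTerm g := rfl

theorem constTerm_zero : constTerm (0 : Laurent R) = 0 := rfl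

theorem constTerm_sub (f g : Laurent R) : constTerm (f - g) = constTerm f - constTerm g := rfl

theorem constTerm_sum {ι : Type*} (s : Finset ι) (f : ι → Laurent R) :
    constTerm (∑ i ∈ s, f i) = ∑ i ∈ s, constTerm (f i) :=
  map_sum (AddMonoidHom.mk' (constTerm (R := R)) constTerm_add) f s

theorem constTerm_C_mul (c : R) (f : Laurent R) :
    constTerm (HahnSeries.C c * f) = c * constTerm f := by
  rw [HahnSeries.C_mul_eq_smul]; rfl

theorem constTerm_one : constTerm (1 : Laurent R) = 1 := by
  simp [constTerm]

theorem mapDomain_le_mapDomain_iff {f : ℕ → ℕ} (hf : Function.Injective f) (a b : ℕ →₀ ℤ) :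
    a.mapDomain f ≤ b.mapDomain f ↔ a ≤ b := by
  constructor
  · intro h i
    have := h (f i)
    rwa [Finsupp.mapDomain_apply hf, Finsupp.mapDomain_apply hf] at this
  · intro h i
    by_cases hi : i ∈ Set.range f
    · obtain ⟨j, rfl⟩ := hi
      rw [Finsupp.mapDomain_apply hf, Finsupp.mapDomain_apply hf]
      exact h j
    · rw [Finsupp.mapDomain_of_notMem_range _ _ hi, Finsupp.mapDomain_of_notMem_range _ _ hi]

/-- Renaming the variables along an injective map. -/
noncomputable def rename (f : ℕ → ℕ) (hf : Function.Injective f) : Laurent R →+* Laurent R :=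
  HahnSeries.embDomainRingHom (Finsupp.mapDomain.addMonoidHom f)
    (Finsupp.mapDomain_injective hf) (mapDomain_le_mapDomain_iff hf)

variable (f : ℕ → ℕ) (hf : Function.Injective f)

theorem rename_C (c : R) : rename f hf (HahnSeries.C c) = HahnSeries.C c :=
  HahnSeries.embDomainRingHom_C

theorem rename_single (e : ℕ →₀ ℤ) (c : R) :
    rename f hf (HahnSeries.single e c) = HahnSeries.single (e.mapDomain f) c :=
  HahnSeries.embDomain_single

theorem rename_X (i : ℕ) : rename f hf (X R i) = X R (f i) := by
  simp only [X, x, rename_single, Finsupp.mapDomain_single]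

theorem map_rename_x (i : ℕ) :
    Units.map (rename (R := R) f hf : Laurent R →* Laurent R) (x i) = x (f i) :=
  Units.ext (rename_X f hf i)

theorem map_rename_onePlus (c : R) (i : ℕ) :
    Units.map (rename (R := R) f hf : Laurent R →* Laurent R) (onePlus c i) = onePlus c (f i) := by
  apply Units.ext
  change rename f hf (1 + HahnSeries.C c * X R i) = 1 + HahnSeries.C c * X R (f i)
  rw [map_add, map_mul, map_one, rename_C, rename_X]

theorem map_rename_vFactor (c : R) (i : ℕ) :
    Units.map (rename (R := R) f hf : Laurent R →* Laurent R) (vFactor c i) = vFactor c (f i) := by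
  apply Units.ext
  have := congrArg Units.val (map_rename_onePlus f hf (1 - c) i)
  change rename f hf (-(onePlus (1 - c) i : Laurent R)) = -(onePlus (1 - c) (f i) : Laurent R)
  rw [map_neg]
  exact congrArg Neg.neg this

theorem constTerm_rename (h : Laurent R) : constTerm (rename f hf h) = constTerm h := by
  have h0 : (0 : ℕ →₀ ℤ) = Finsupp.mapDomain.addMonoidHom f 0 := by simp
  unfold constTerm
  conv_lhs => rw [h0]
  exact HahnSeries.embDomain_coeff
    (f := ⟨⟨_, Finsupp.mapDomain_injective hf⟩, mapDomain_le_mapDomain_iff hf _ _⟩)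

theorem rename_coeff_of_notMem (h : Laurent R) {e : ℕ →₀ ℤ} {k : ℕ} (hk : k ∉ Set.range f)
    (he : e k ≠ 0) : (rename f hf h).coeff e = 0 := by
  apply HahnSeries.embDomain_of_notMem_range
  rintro ⟨d, rfl⟩
  exact he (Finsupp.mapDomain_of_notMem_range d k hk)

/-! ### Series without negative powers of a variable -/

/-- The series without negative powers of `x_k`. -/
noncomputable def nonnegIn (R : Type*) [CommRing R] (k : ℕ) : Subring (Laurent R) where
  carrier := {h | ∀ e, h.coeff e ≠ 0 → 0 ≤ e k}
  mul_mem' := by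
    intro a b ha hb e he
    obtain ⟨i, hi, j, hj, rfl⟩ := HahnSeries.support_mul_subset ((HahnSeries.mem_support _ _).2 he)
    exact add_nonneg (ha i hi) (hb j hj)
  one_mem' := by
    intro e he
    by_cases h : e = 0
    · simp [h]
    · simp [HahnSeries.coeff_one, h] at he
  add_mem' := by
    intro a b ha hb e he
    by_cases h : a.coeff e = 0
    · exact hb e (by simpa [h] using he)
    · exact ha e h
  zero_mem' := by intro e he; simp at he
  neg_mem' := by intro a ha e he; exact ha e (by simpa using he)

theorem single_mem_nonnegIn {k : ℕ} {e : ℕ →₀ ℤ} (he : 0 ≤ e k) (c : R) :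
    HahnSeries.single e c ∈ nonnegIn R k := by
  intro d hd
  by_cases h : d = e
  · rwa [h]
  · simp [HahnSeries.coeff_single_of_ne h] at hd

theorem C_mem_nonnegIn (k : ℕ) (c : R) : HahnSeries.C c ∈ nonnegIn R k :=
  single_mem_nonnegIn (by simp) c

theorem X_mem_nonnegIn (k i : ℕ) : X R i ∈ nonnegIn R k :=
  single_mem_nonnegIn (by by_cases h : i = k <;> simp [h]) 1

theorem inVar_mem_nonnegIn (k i : ℕ) (f : PowerSeries R) : inVar i f ∈ nonnegIn R k := by
  intro e he
  by_contra hk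
  apply he
  apply HahnSeries.embDomain_of_notMem_range
  rintro ⟨d, rfl⟩
  apply hk
  change 0 ≤ (Finsupp.single i (d : ℤ)) k
  by_cases h : i = k <;> simp [h]

theorem onePlus_mem_nonnegIn (c : R) (k i : ℕ) : (onePlus c i : Laurent R) ∈ nonnegIn R k :=
  add_mem (one_mem _) (mul_mem (C_mem_nonnegIn k c) (X_mem_nonnegIn k i))

theorem onePlus_inv_mem_nonnegIn (c : R) (k i : ℕ) :
    (((onePlus c i)⁻¹ : (Laurent R)ˣ) : Laurent R) ∈ nonnegIn R k :=
  inVar_mem_nonnegIn k i _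

theorem rename_mem_nonnegIn {k : ℕ} (hk : k ∉ Set.range f) (h : Laurent R) :
    rename f hf h ∈ nonnegIn R k := by
  intro e he
  by_contra h0
  exact he (rename_coeff_of_notMem f hf h hk (by omega))

theorem constTerm_X_mul {k : ℕ} {h : Laurent R} (hh : h ∈ nonnegIn R k) :
    constTerm (X R k * h) = 0 := by
  have h0 : (0 : ℕ →₀ ℤ) = Finsupp.single k (-1) + Finsupp.single k 1 := by
    rw [← Finsupp.single_add]; simp
  unfold constTerm
  rw [h0]
  change (HahnSeries.single (Finsupp.single k 1) (1 : R) * h).coeff _ = 0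
  rw [HahnSeries.coeff_single_mul_add, one_mul]
  by_contra hc
  have := hh _ hc
  simp at this

/-- The pairs `(h, c)` of series without negative powers of `x_k` that agree at `x_k = 0`. -/
noncomputable def agreeAtZero (R : Type*) [CommRing R] (k : ℕ) :
    Subring (Laurent R × Laurent R) where
  carrier := {h | h.2 ∈ nonnegIn R k ∧ ∃ g ∈ nonnegIn R k, h.1 = h.2 + X R k * g}
  mul_mem' := by
    rintro ⟨a, a'⟩ ⟨b, b'⟩ ⟨ha, g, hg, h1⟩ ⟨hb, g', hg', h2⟩
    refine ⟨mul_mem ha hb, a' * g' + g * b' + X R k * g * g', ?_, ?_⟩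
    · exact add_mem (add_mem (mul_mem ha hg') (mul_mem hg hb))
        (mul_mem (mul_mem (X_mem_nonnegIn k k) hg) hg')
    · simp only [Prod.fst_mul, Prod.snd_mul] at *
      rw [h1, h2]; ring
  one_mem' := ⟨one_mem _, 0, zero_mem _, by simp⟩
  add_mem' := by
    rintro ⟨a, a'⟩ ⟨b, b'⟩ ⟨ha, g, hg, h1⟩ ⟨hb, g', hg', h2⟩
    refine ⟨add_mem ha hb, g + g', add_mem hg hg', ?_⟩
    simp only [Prod.fst_add, Prod.snd_add] at *
    rw [h1, h2]; ring
  zero_mem' := ⟨zero_mem _, 0, zero_mem _, by simp⟩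
  neg_mem' := by
    rintro ⟨a, a'⟩ ⟨ha, g, hg, h1⟩
    refine ⟨neg_mem ha, -g, neg_mem hg, ?_⟩
    simp only [Prod.fst_neg, Prod.snd_neg] at *
    rw [h1]; ring

theorem mem_agreeAtZero {k : ℕ} {h c : Laurent R} : (h, c) ∈ agreeAtZero R k ↔
    c ∈ nonnegIn R k ∧ ∃ g ∈ nonnegIn R k, h = c + X R k * g := Iff.rfl

theorem self_mem_agreeAtZero {k : ℕ} {h : Laurent R} (hh : h ∈ nonnegIn R k) :
    (h, h) ∈ agreeAtZero R k := ⟨hh, 0, zero_mem _, by simp⟩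

/-- This is the substitution x_k = 0. A subring of pairs takes the place of an evaluation map, so a
product can be treated factor by factor. -/
theorem constTerm_eq_of_agreeAtZero {k : ℕ} {h c : Laurent R} (hh : (h, c) ∈ agreeAtZero R k) :
    constTerm h = constTerm c := by
  obtain ⟨-, g, hg, rfl⟩ := mem_agreeAtZero.1 hh
  rw [constTerm_add, constTerm_X_mul hg, add_zero]

theorem X_agreeAtZero (k : ℕ) : (X R k, 0) ∈ agreeAtZero R k :=
  ⟨zero_mem _, 1, one_mem _, by simp⟩

theorem onePlus_agreeAtZero (c : R) (k : ℕ) :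
    ((onePlus c k : Laurent R), 1) ∈ agreeAtZero R k :=
  ⟨one_mem _, HahnSeries.C c, C_mem_nonnegIn k c, by
    change 1 + HahnSeries.C c * X R k = 1 + X R k * HahnSeries.C c; ring⟩

theorem onePlus_inv_agreeAtZero (c : R) (k : ℕ) :
    ((((onePlus c k)⁻¹ : (Laurent R)ˣ) : Laurent R), 1) ∈ agreeAtZero R k := by
  refine ⟨one_mem _, -HahnSeries.C c * (((onePlus c k)⁻¹ : (Laurent R)ˣ) : Laurent R),
    mul_mem (neg_mem (C_mem_nonnegIn k c)) (onePlus_inv_mem_nonnegIn c k k), ?_⟩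
  have h : (1 + HahnSeries.C c * X R k) * (((onePlus c k)⁻¹ : (Laurent R)ˣ) : Laurent R) = 1 :=
    (onePlus c k).mul_inv
  change (((onePlus c k)⁻¹ : (Laurent R)ˣ) : Laurent R) = _
  linear_combination h

theorem onePlus_zpow_agreeAtZero (c : R) (k : ℕ) (z : ℤ) :
    (((onePlus c k ^ z : (Laurent R)ˣ) : Laurent R), 1) ∈ agreeAtZero R k := by
  cases z with
  | ofNat m =>
    have := pow_mem (onePlus_agreeAtZero c k) m
    simpa using this
  | negSucc m =>
    have := pow_mem (onePlus_inv_agreeAtZero c k) (m + 1)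
    simpa [zpow_negSucc] using this

end LaurentTools

end STTree

namespace STTree

/-! ### Products over pairs of indices -/

/-- The increasing map that misses exactly `m`. -/
def skip (m j : ℕ) : ℕ := if j < m then j else j + 1

theorem skip_injective (m : ℕ) : Function.Injective (skip m) := by
  intro a b h
  simp only [skip] at h
  split_ifs at h <;> omega

theorem notMem_range_skip (m : ℕ) : m ∉ Set.range (skip m) := by
  rintro ⟨j, hj⟩
  simp only [skip] at hj
  split_ifs at hj <;> omega

theorem skip_lt_skip_iff (m i j : ℕ) : skip m i < skip m j ↔ i < j := by
  simp only [skip]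
  split_ifs <;> omega

theorem skip_ne (m j : ℕ) : skip m j ≠ m := fun h => notMem_range_skip m ⟨j, h⟩

theorem skip_lt_iff (m j : ℕ) : skip m j < m ↔ j < m := by
  simp only [skip]
  split_ifs <;> omega

theorem lt_skip_iff (m j : ℕ) : m < skip m j ↔ ¬ j < m := by
  simp only [skip]
  split_ifs <;> omega

section Products

variable {A : Type*} [CommRing A]

theorem prod_Icc_succ_skip {M : Type*} [CommMonoid M] (n m : ℕ) (hm : m ∈ Finset.Icc 1 (n + 1))
    (g : ℕ → M) :
    ∏ i ∈ Finset.Icc 1 (n + 1), g i = g m * ∏ j ∈ Finset.Icc 1 n, g (skip m j) := by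
  rw [← Finset.mul_prod_erase _ _ hm]
  congr 1
  rw [Finset.mem_Icc] at hm
  rw [← Finset.prod_image (s := Finset.Icc 1 n) (g := skip m) (f := g)
    (fun a _ b _ h => skip_injective m h)]
  apply Finset.prod_congr _ fun _ _ => rfl
  ext i
  simp only [Finset.mem_erase, Finset.mem_Icc, Finset.mem_image]
  constructor
  · rintro ⟨h1, h2, h3⟩
    by_cases h : i < m
    · exact ⟨i, by omega, by simp [skip, h]⟩
    · refine ⟨i - 1, by omega, ?_⟩
      rw [skip, if_neg (by omega)]; omega
  · rintro ⟨j, hj, rfl⟩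
    refine ⟨skip_ne m j, ?_⟩
    simp only [skip]
    split_ifs <;> omega

/-- The product of `G i j` over all `1 ≤ i < j ≤ n`. -/
def pairProd (n : ℕ) (G : ℕ → ℕ → A) : A :=
  ∏ i ∈ Finset.Icc 1 n, ∏ j ∈ Finset.Icc 1 n, if i < j then G i j else 1

theorem prod_Ioc_eq_pairProd (n : ℕ) (G : ℕ → ℕ → A) :
    ∏ i ∈ Finset.Icc 1 n, ∏ j ∈ Finset.Ioc i n, G i j = pairProd n G := by
  refine Finset.prod_congr rfl fun i hi => ?_
  rw [← Finset.prod_filter]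
  refine Finset.prod_congr ?_ fun _ _ => rfl
  ext j
  simp only [Finset.mem_Icc, Finset.mem_Ioc, Finset.mem_filter] at *
  omega

theorem pairProd_mul (n : ℕ) (G H : ℕ → ℕ → A) :
    pairProd n (fun i j => G i j * H i j) = pairProd n G * pairProd n H := by
  simp only [pairProd, ← Finset.prod_mul_distrib]
  refine Finset.prod_congr rfl fun i _ => Finset.prod_congr rfl fun j _ => ?_
  split_ifs <;> simp

theorem map_pairProd {B : Type*} [CommRing B] (φ : A →+* B) (n : ℕ) (G : ℕ → ℕ → A) :
    φ (pairProd n G) = pairProd n (fun i j => φ (G i j)) := by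
  simp only [pairProd, map_prod]
  refine Finset.prod_congr rfl fun i _ => Finset.prod_congr rfl fun j _ => ?_
  split_ifs <;> simp

theorem pairProd_congr {n : ℕ} {G H : ℕ → ℕ → A}
    (h : ∀ i j, 1 ≤ i → i < j → j ≤ n → G i j = H i j) : pairProd n G = pairProd n H := by
  refine Finset.prod_congr rfl fun i hi => Finset.prod_congr rfl fun j hj => ?_
  rw [Finset.mem_Icc] at hi hj
  split_ifs with hij
  · exact h i j hi.1 hij hj.2
  · rfl

/-- Isolates the pairs containing m. Whether j lies before or after m decides the order of the
arguments of G, which is the origin of the distinction between `lFac` and `rFac`. -/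
theorem pairProd_succ_skip (n m : ℕ) (hm : m ∈ Finset.Icc 1 (n + 1)) (G : ℕ → ℕ → A) :
    pairProd (n + 1) G =
      (∏ j ∈ Finset.Icc 1 n, if j < m then G (skip m j) m else G m (skip m j)) *
        pairProd n (fun i j => G (skip m i) (skip m j)) := by
  simp only [pairProd]
  rw [prod_Icc_succ_skip n m hm, prod_Icc_succ_skip n m hm, if_neg (lt_irrefl m), one_mul]
  simp only [prod_Icc_succ_skip n m hm]
  rw [Finset.prod_mul_distrib, ← mul_assoc, ← Finset.prod_mul_distrib]
  congr 1
  · refine Finset.prod_congr rfl fun j _ => ?_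
    simp only [lt_skip_iff, skip_lt_iff]
    split_ifs <;> simp
  · refine Finset.prod_congr rfl fun i _ => Finset.prod_congr rfl fun j _ => ?_
    simp only [skip_lt_skip_iff]

theorem pairProd_eq_filter (n : ℕ) (G : ℕ → ℕ → A) :
    pairProd n G = ∏ c ∈ (Finset.Icc 1 n ×ˢ Finset.Icc 1 n).filter (fun c => c.1 < c.2),
      G c.1 c.2 := by
  rw [Finset.prod_filter, Finset.prod_product]; rfl

/-- A product over pairs is the factor of two adjacent indices times a product that does not
change when these two indices are swapped. -/
theorem exists_pairProd_eq_mul (n k : ℕ) (hk : 1 ≤ k) (hkn : k + 1 ≤ n) :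
    ∃ P : Finset (ℕ × ℕ), (∀ G : ℕ → ℕ → A, pairProd n G = G k (k + 1) * ∏ c ∈ P, G c.1 c.2) ∧
      ∀ G : ℕ → ℕ → A, ∏ c ∈ P, G (Equiv.swap k (k + 1) c.1) (Equiv.swap k (k + 1) c.2) =
        ∏ c ∈ P, G c.1 c.2 := by
  refine ⟨((Finset.Icc 1 n ×ˢ Finset.Icc 1 n).filter (fun c => c.1 < c.2)).erase (k, k + 1),
    fun G => ?_, fun G => ?_⟩
  · rw [pairProd_eq_filter]
    refine (Finset.mul_prod_erase _ (fun c : ℕ × ℕ => G c.1 c.2) (a := (k, k + 1)) ?_).symm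
    simp only [Finset.mem_filter, Finset.mem_product, Finset.mem_Icc]
    omega
  · have key : ∀ c ∈ ((Finset.Icc 1 n ×ˢ Finset.Icc 1 n).filter
        (fun c : ℕ × ℕ => c.1 < c.2)).erase (k, k + 1),
        Prod.map (Equiv.swap k (k + 1)) (Equiv.swap k (k + 1)) c ∈
          ((Finset.Icc 1 n ×ˢ Finset.Icc 1 n).filter
            (fun c : ℕ × ℕ => c.1 < c.2)).erase (k, k + 1) := by
      rintro ⟨a, b⟩ h
      simp only [Finset.mem_erase, Finset.mem_filter, Finset.mem_product, Finset.mem_Icc,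
        Prod.map_apply, ne_eq, Prod.mk.injEq, Equiv.swap_apply_def] at h ⊢
      split_ifs <;> omega
    refine Finset.prod_nbij' (Prod.map (Equiv.swap k (k + 1)) (Equiv.swap k (k + 1)))
      (Prod.map (Equiv.swap k (k + 1)) (Equiv.swap k (k + 1))) key key ?_ ?_ ?_
    · rintro ⟨a, b⟩ _; simp only [Prod.map_apply, Equiv.swap_apply_self]
    · rintro ⟨a, b⟩ _; simp only [Prod.map_apply, Equiv.swap_apply_self]
    · intro c _; rfl

/-! ### Vandermonde products -/

theorem prod_Icc_eq_prod_fin {M : Type*} [CommMonoid M] (n : ℕ) (g : ℕ → M) :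
    ∏ i ∈ Finset.Icc 1 n, g i = ∏ i : Fin n, g (i + 1) := by
  rw [← Finset.prod_range (fun i => g (i + 1)), Finset.range_eq_Ico, Finset.prod_Ico_add' g 0 n 1]
  exact Finset.prod_congr (by ext; simp only [Finset.mem_Ico, Finset.mem_Icc]; omega) fun _ _ => rfl

theorem pairProd_sub_eq_det (n : ℕ) (f : ℕ → A) :
    pairProd n (fun i j => f j - f i) =
      (Matrix.vandermonde (fun i : Fin n => f (i + 1))).det := by
  rw [Matrix.det_vandermonde, pairProd, prod_Icc_eq_prod_fin]
  refine Finset.prod_congr rfl fun i _ => ?_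
  rw [prod_Icc_eq_prod_fin, ← Finset.prod_filter]
  refine Finset.prod_congr ?_ fun _ _ => rfl
  ext j
  simp

theorem skip_succAbove {n : ℕ} (i : Fin (n + 1)) (j : Fin n) :
    ((i.succAbove j : Fin (n + 1)) : ℕ) + 1 = skip (i + 1) (j + 1) := by
  simp only [Fin.succAbove, skip, Fin.lt_def, Fin.val_castSucc]
  split_ifs <;> first | omega | simp

theorem sum_Icc_eq_sum_fin (n : ℕ) (g : ℕ → A) :
    ∑ i ∈ Finset.Icc 1 n, g i = ∑ i : Fin n, g (i + 1) :=
  prod_Icc_eq_prod_fin (M := Multiplicative A) n g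

/-- Expansion of a Vandermonde product with respect to the index of degree zero. -/
theorem pairProd_sub_succ (n : ℕ) (f : ℕ → A) :
    pairProd (n + 1) (fun i j => f j - f i) =
      ∑ m ∈ Finset.Icc 1 (n + 1), (-1) ^ (m + 1) * ((∏ j ∈ Finset.Icc 1 n, f (skip m j)) *
        pairProd n (fun i j => f (skip m j) - f (skip m i))) := by
  rw [pairProd_sub_eq_det, Matrix.det_succ_column_zero, sum_Icc_eq_sum_fin]
  refine Finset.sum_congr rfl fun i _ => ?_
  -- The minor without the column of zeroth powers has powers 1, …, n. One factor f taken out of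
  -- each row leaves a Vandermonde determinant.
  rw [pairProd_sub_eq_det n (fun j => f (skip (i + 1) j)), prod_Icc_eq_prod_fin,
    ← Matrix.det_mul_column]
  simp only [Matrix.vandermonde_apply, Fin.val_zero, pow_zero, mul_one]
  congr 1
  · ring
  · congr 1
    ext a b
    simp only [Matrix.submatrix_apply, Matrix.vandermonde_apply, Matrix.of_apply,
      skip_succAbove, Fin.val_succ, pow_succ]
    ring

/-- The sum is the expansion, along the first column, of a determinant whose first two columns are
constant 1. For n = 0 there is no second column and the sum is 1. -/
theorem sum_pairProd_sub_skip (n : ℕ) (hn : 1 ≤ n) (f : ℕ → A) :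
    ∑ m ∈ Finset.Icc 1 (n + 1), (-1) ^ (m + 1) *
        pairProd n (fun i j => f (skip m j) - f (skip m i)) = 0 := by
  obtain ⟨n, rfl⟩ := Nat.exists_eq_add_of_le' hn
  have hdet : (Matrix.of fun (i j : Fin (n + 2)) =>
      (Fin.cons 1 (fun k : Fin (n + 1) => f (i + 1) ^ (k : ℕ)) : Fin (n + 2) → A) j).det = 0 := by
    apply Matrix.det_zero_of_column_eq (i := 0) (j := 1) (by simp)
    intro k
    simp only [Matrix.of_apply, Fin.cons_zero]
    rw [← Fin.succ_zero_eq_one, Fin.cons_succ]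
    simp
  rw [Matrix.det_succ_column_zero] at hdet
  rw [sum_Icc_eq_sum_fin, ← hdet]
  refine Finset.sum_congr rfl fun i _ => ?_
  rw [pairProd_sub_eq_det (n + 1) (fun j => f (skip (i + 1) j))]
  simp only [Matrix.of_apply, Fin.cons_zero, mul_one]
  congr 1
  · ring
  · congr 1
    ext a b
    simp only [Matrix.submatrix_apply, Matrix.vandermonde_apply, Matrix.of_apply,
      skip_succAbove, Fin.cons_succ]

end Products

end STTree

namespace STTree

/-! ### Interlacing rows -/

/-- `a j` lies between `b j` and `b (j + 1)` for `lo < j ≤ hi`. -/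
def Interlaces (b : ℕ → ℤ) (lo hi : ℕ) (a : ℕ → ℤ) : Prop :=
  ∀ j, lo < j → j ≤ hi → b j ≤ a j ∧ a j ≤ b (j + 1)

open Classical in
/-- The rows `a (p + 1), …, a (p + c)` that interlace with `b` and have no two adjacent equal
entries, extended by zero. -/
noncomputable def rows (b : ℕ → ℤ) (p : ℕ) : ℕ → Finset (ℕ → ℤ)
  | 0 => {0}
  | c + 1 => ((rows b p c ×ˢ Finset.Icc (b (p + c + 1)) (b (p + c + 2))).filter
      (fun az => ¬ (c ≠ 0 ∧ az.1 (p + c) = az.2))).image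
        (fun az => Function.update az.1 (p + c + 1) az.2)

theorem mem_rows (b : ℕ → ℤ) (p c : ℕ) (a : ℕ → ℤ) : a ∈ rows b p c ↔
    (∀ j, ¬ (p < j ∧ j ≤ p + c) → a j = 0) ∧ Interlaces b p (p + c) a ∧
      ∀ j, p < j → j + 1 ≤ p + c → a j ≠ a (j + 1) := by
  induction c generalizing a with
  | zero =>
    simp only [rows, Finset.mem_singleton]
    constructor
    · rintro rfl
      exact ⟨fun _ _ => rfl, fun j h1 h2 => by omega, fun j h1 h2 => by omega⟩
    · rintro ⟨h, -, -⟩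
      funext j
      exact h j (by omega)
  | succ c ih =>
    simp only [rows, Finset.mem_image, Finset.mem_filter, Finset.mem_product, Finset.mem_Icc,
      Prod.exists, ih]
    constructor
    · rintro ⟨a, z, ⟨⟨⟨h0, h1, h2⟩, hz⟩, hne⟩, rfl⟩
      refine ⟨fun j hj => ?_, fun j hj hj' => ?_, fun j hj hj' => ?_⟩
      · rw [Function.update_of_ne (by omega)]
        exact h0 j (by omega)
      · by_cases h : j = p + c + 1
        · subst h; simpa using hz
        · rw [Function.update_of_ne h]
          exact h1 j hj (by omega)
      · rw [Function.update_of_ne (by omega)]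
        by_cases h : j = p + c
        · subst h
          rw [Function.update_self]
          exact fun h => hne ⟨by omega, h⟩
        · rw [Function.update_of_ne (by omega)]
          exact h2 j hj (by omega)
    · rintro ⟨h0, h1, h2⟩
      refine ⟨Function.update a (p + c + 1) 0, a (p + c + 1),
        ⟨⟨⟨fun j hj => ?_, fun j hj hj' => ?_, fun j hj hj' => ?_⟩, ?_⟩, ?_⟩, ?_⟩
      · by_cases h : j = p + c + 1
        · subst h; simp
        · rw [Function.update_of_ne h]
          exact h0 j (by omega)
      · rw [Function.update_of_ne (by omega)]
        exact h1 j hj (by omega)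
      · rw [Function.update_of_ne (by omega), Function.update_of_ne (by omega)]
        exact h2 j hj (by omega)
      · exact h1 (p + c + 1) (by omega) (by omega)
      · rw [Function.update_of_ne (by omega)]
        exact fun h => h2 (p + c) (by omega) (by omega) h.2
      · simp

section RowSums

variable {A : Type*} [CommRing A]

open Classical in
theorem sum_rows_succ (b : ℕ → ℤ) (p c : ℕ) (F : (ℕ → ℤ) → A) :
    ∑ a ∈ rows b p (c + 1), F a = ∑ a ∈ rows b p c,
      ∑ z ∈ Finset.Icc (b (p + c + 1)) (b (p + c + 2)),
        if c ≠ 0 ∧ a (p + c) = z then 0 else F (Function.update a (p + c + 1) z) := by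
  rw [rows, Finset.sum_image, Finset.sum_filter, Finset.sum_product]
  · refine Finset.sum_congr rfl fun a _ => Finset.sum_congr rfl fun z _ => ?_
    simp only [ite_not]
  · rintro ⟨a, z⟩ h ⟨a', z'⟩ h' heq
    simp only [Finset.coe_filter, Finset.mem_product, Set.mem_ofPred_eq, mem_rows] at h h' heq
    have hz : z = z' := by simpa using congrFun heq (p + c + 1)
    refine Prod.ext ?_ hz
    funext j
    by_cases hj : j = p + c + 1
    · change a j = a' j
      rw [h.1.1.1 j (by omega), h'.1.1.1 j (by omega)]
    · simpa [Function.update_of_ne hj] using congrFun heq j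

/-- The sum of `∏ g j (a j)` over the rows `a (p + 1), …, a (p + c)`. -/
noncomputable def rowSum (b : ℕ → ℤ) (p : ℕ) (g : ℕ → ℤ → A) (c : ℕ) : A :=
  ∑ a ∈ rows b p c, ∏ j ∈ Finset.Ioc p (p + c), g j (a j)

theorem prod_Ioc_update (p c : ℕ) (g : ℕ → ℤ → A) (a : ℕ → ℤ) (z : ℤ) :
    ∏ j ∈ Finset.Ioc p (p + (c + 1)), g j (Function.update a (p + c + 1) z j) =
      (∏ j ∈ Finset.Ioc p (p + c), g j (a j)) * g (p + c + 1) z := by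
  rw [← add_assoc, Finset.prod_Ioc_succ_top (by omega : p ≤ p + c),
    Function.update_self]
  congr 1
  refine Finset.prod_congr rfl fun j hj => ?_
  rw [Finset.mem_Ioc] at hj
  rw [Function.update_of_ne (by omega)]

theorem rowSum_zero (b : ℕ → ℤ) (p : ℕ) (g : ℕ → ℤ → A) : rowSum b p g 0 = 1 := by
  simp [rowSum, rows]

theorem rowSum_one (b : ℕ → ℤ) (p : ℕ) (g : ℕ → ℤ → A) :
    rowSum b p g 1 = ∑ z ∈ Finset.Icc (b (p + 1)) (b (p + 2)), g (p + 1) z := by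
  rw [rowSum, sum_rows_succ]
  simp only [prod_Ioc_update]
  simp [rows]

open Classical in
-- Append a last entry freely and subtract the coincidences with its left neighbour; interlacing
-- forces the common value `b (p + c + 2)`. In a subtracted row the entry at `p + c + 1` must still
-- differ from the one at `p + c`. Ignoring this gives the second term, and the third restores the
-- excess. The condition `c ≠ 0` is there because for `c = 0` no entry precedes.
theorem rowSum_add_two (b : ℕ → ℤ) (p : ℕ) (g : ℕ → ℤ → A) (c : ℕ)
    (h1 : b (p + c + 1) ≤ b (p + c + 2)) (h2 : b (p + c + 2) ≤ b (p + c + 3)) :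
    rowSum b p g (c + 2) =
      rowSum b p g (c + 1) * (∑ z ∈ Finset.Icc (b (p + c + 2)) (b (p + c + 3)), g (p + c + 2) z)
      - rowSum b p g c * (g (p + c + 1) (b (p + c + 2)) * g (p + c + 2) (b (p + c + 2)))
      + (∑ a ∈ rows b p c with c ≠ 0 ∧ a (p + c) = b (p + c + 2),
          ∏ j ∈ Finset.Ioc p (p + c), g j (a j)) *
        (g (p + c + 1) (b (p + c + 2)) * g (p + c + 2) (b (p + c + 2))) := by
  -- Rows of length c + 1 whose last entry is the only value it can share with a right neighbour.
  have hU : ∑ a ∈ rows b p (c + 1), (if a (p + c + 1) = b (p + c + 2) then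
      ∏ j ∈ Finset.Ioc p (p + (c + 1)), g j (a j) else 0) =
      (rowSum b p g c - ∑ a ∈ rows b p c with c ≠ 0 ∧ a (p + c) = b (p + c + 2),
          ∏ j ∈ Finset.Ioc p (p + c), g j (a j)) * g (p + c + 1) (b (p + c + 2)) := by
    rw [sum_rows_succ, rowSum, Finset.sum_filter, ← Finset.sum_sub_distrib, Finset.sum_mul]
    refine Finset.sum_congr rfl fun a _ => ?_
    simp only [Function.update_self, prod_Ioc_update]
    rw [Finset.sum_eq_single (b (p + c + 2))]
    · split_ifs <;> simp_all
    · intro z _ hz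
      simp [hz]
    · intro h
      exact absurd (Finset.mem_Icc.2 ⟨h1, le_rfl⟩) h
  have hT : rowSum b p g (c + 2) = rowSum b p g (c + 1) *
      (∑ z ∈ Finset.Icc (b (p + c + 2)) (b (p + c + 3)), g (p + c + 2) z) -
      (∑ a ∈ rows b p (c + 1), (if a (p + c + 1) = b (p + c + 2) then
        ∏ j ∈ Finset.Ioc p (p + (c + 1)), g j (a j) else 0)) *
        g (p + c + 2) (b (p + c + 2)) := by
    rw [rowSum, show c + 2 = c + 1 + 1 from rfl, sum_rows_succ, rowSum, Finset.sum_mul,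
      Finset.sum_mul, ← Finset.sum_sub_distrib]
    refine Finset.sum_congr rfl fun a ha => ?_
    have hle := (((mem_rows _ _ _ _).1 ha).2.1 (p + c + 1) (by omega) (by omega)).2
    simp only [prod_Ioc_update, ne_eq, Nat.add_eq_zero_iff, one_ne_zero, and_false,
      not_false_eq_true, true_and]
    simp only [← add_assoc]
    change (∑ z ∈ Finset.Icc (b (p + c + 2)) (b (p + c + 3)), if a (p + c + 1) = z then 0 else
      (∏ j ∈ Finset.Ioc p (p + c + 1), g j (a j)) * g (p + c + 2) z) = _
    rw [Finset.mul_sum]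
    have : ∀ z ∈ Finset.Icc (b (p + c + 2)) (b (p + c + 3)),
        (if a (p + c + 1) = z then 0 else
          (∏ j ∈ Finset.Ioc p (p + c + 1), g j (a j)) * g (p + c + 2) z) =
        (∏ j ∈ Finset.Ioc p (p + c + 1), g j (a j)) * g (p + c + 2) z -
        (if z = b (p + c + 2) then (if a (p + c + 1) = b (p + c + 2) then
          (∏ j ∈ Finset.Ioc p (p + c + 1), g j (a j)) else 0) * g (p + c + 2) z else 0) := by
      intro z hz
      rw [Finset.mem_Icc] at hz
      by_cases hza : a (p + c + 1) = z
      · have hzb : z = b (p + c + 2) := by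
          have : b (p + c + 1 + 1) = b (p + c + 2) := rfl
          omega
        rw [if_pos hza, if_pos hzb, if_pos (by omega)]; ring
      · rw [if_neg hza]
        by_cases hzb : z = b (p + c + 2)
        · rw [if_pos hzb, if_neg (by omega)]; ring
        · rw [if_neg hzb]; ring
    rw [Finset.sum_congr rfl this, Finset.sum_sub_distrib, Finset.sum_ite_eq',
      if_pos (Finset.mem_Icc.2 ⟨le_rfl, h2⟩)]
  rw [hT, hU]
  ring

end RowSums

/-! ### The sum over one entry -/

section Entry

variable {R : Type*} [CommRing R]

/-- The inverse of the variable `x_i`. -/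
noncomputable def y (R : Type*) [CommRing R] (i : ℕ) : Laurent R :=
  (((x i)⁻¹ : (Laurent R)ˣ) : Laurent R)

theorem X_mul_y (i : ℕ) : X R i * y R i = 1 := (x i).mul_inv

/-- The power `(1 + x_i)^z`. -/
noncomputable def e (R : Type*) [CommRing R] (i : ℕ) (z : ℤ) : Laurent R :=
  ((onePlus 1 i ^ z : (Laurent R)ˣ) : Laurent R)

theorem e_add (i : ℕ) (a b : ℤ) : e R i (a + b) = e R i a * e R i b := by
  rw [e, zpow_add]; rfl

theorem e_one (i : ℕ) : e R i 1 = 1 + X R i := by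
  simp [e, onePlus]

/-- `-(1 + (1 - v) x_i) / x_i`. -/
noncomputable def lFac (v : R) (i : ℕ) : Laurent R :=
  -(1 + HahnSeries.C (1 - v) * X R i) * y R i

/-- `(1 + u x_i) / x_i`. -/
noncomputable def rFac (u : R) (i : ℕ) : Laurent R :=
  (1 + HahnSeries.C u * X R i) * y R i

theorem sum_Icc_e (i : ℕ) (a c : ℤ) (h : a ≤ c) :
    ∑ z ∈ Finset.Icc a c, e R i z = ((1 + X R i) * e R i c - e R i a) * y R i := by
  obtain ⟨k, rfl⟩ := Int.le.dest h
  induction k with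
  | zero =>
    simp only [Nat.cast_zero, add_zero, Finset.Icc_self, Finset.sum_singleton]
    linear_combination (-e R i a) * X_mul_y (R := R) i
  | succ k ih =>
    have hI : Finset.Icc a (a + (k + 1 : ℕ)) =
        insert (a + k + 1) (Finset.Icc a (a + k)) := by
      ext z; simp only [Finset.mem_Icc, Finset.mem_insert]; push_cast; omega
    rw [hI, Finset.sum_insert (by simp), ih (by omega)]
    have : a + ((k + 1 : ℕ) : ℤ) = a + k + 1 := by push_cast; ring
    rw [this, e_add i (a + k) 1, e_one]
    linear_combination (-(1 + X R i) * e R i (a + k)) * X_mul_y (R := R) i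

/-- The weight of an entry `z` between `b` and `b'`. -/
noncomputable def entryWeight (u v : R) (b b' z : ℤ) : R :=
  (if z = b then v else 1) * (if z = b' then u else 1)

/-- A geometric sum with corrections at both ends: (1 + x)/x + (u - 1) = (1 + u x)/x and -1/x + (v -
1) = -(1 + (1-v) x)/x. For b = b' the right side equals u + v - 1 times the power while the weight
is uv; these agree for u = v = 1. -/
theorem sum_entryWeight (u v : R) (i : ℕ) (b b' : ℤ) (h : b < b' ∨ (u = 1 ∧ v = 1 ∧ b ≤ b')) :
    ∑ z ∈ Finset.Icc b b', HahnSeries.C (entryWeight u v b b' z) * e R i z =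
      rFac u i * e R i b' + lFac v i * e R i b := by
  rcases h with h | ⟨rfl, rfl, h⟩
  · have : ∀ z ∈ Finset.Icc b b', HahnSeries.C (entryWeight u v b b' z) * e R i z =
        e R i z + (if z = b then HahnSeries.C (v - 1) * e R i z else 0) +
          (if z = b' then HahnSeries.C (u - 1) * e R i z else 0) := by
      intro z _
      by_cases h1 : z = b
      · have h2 : z ≠ b' := by omega
        simp only [entryWeight, if_pos h1, if_neg h2, mul_one, add_zero, map_sub, map_one]; ring
      · by_cases h2 : z = b'
        · simp only [entryWeight, if_pos h2, if_neg h1, one_mul, add_zero, map_sub, map_one]; ring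
        · simp [entryWeight, h1, h2]
    rw [Finset.sum_congr rfl this, Finset.sum_add_distrib, Finset.sum_add_distrib,
      Finset.sum_ite_eq', Finset.sum_ite_eq', if_pos (Finset.mem_Icc.2 ⟨le_rfl, h.le⟩),
      if_pos (Finset.mem_Icc.2 ⟨h.le, le_rfl⟩), sum_Icc_e i b b' h.le, rFac, lFac]
    simp only [map_sub, map_one]
    linear_combination ((1 - HahnSeries.C v) * e R i b + (1 - HahnSeries.C u) * e R i b') *
      X_mul_y (R := R) i
  · simp only [entryWeight, ite_self, mul_one, map_one, one_mul]
    rw [sum_Icc_e i b b' h, rFac, lFac]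
    simp only [map_one, sub_self, map_zero]
    ring

end Entry

end STTree

/-! ### Summing over one row modulo terms with vanishing constant term. -/

namespace STTree

section Summation

variable {R : Type*} [CommRing R]

/-- `1 + (1 - v) x_i + u (x_j + x_i x_j)`. -/
noncomputable def pairFac (u v : R) (i j : ℕ) : Laurent R :=
  1 + HahnSeries.C (1 - v) * X R i + HahnSeries.C u * (X R j + X R i * X R j)

/-- The weight `v` of the `j`-th NE-diagonal, replaced by `1` for exceptional diagonals. -/
noncomputable def exV (I : Finset ℕ) (v : R) (j : ℕ) : R := if j ∈ I then 1 else v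

/-- The weight `u` of an entry whose right neighbour in the next row has number `j + 1`, replaced
by `1` for exceptional diagonals. -/
noncomputable def exU (J : Finset ℕ) (u : R) (j : ℕ) : R := if j + 1 ∈ J then 1 else u

/-- The sum of all `∏_{j ≤ m} l j ∏_{j > m} r j`, where `p < j ≤ p + c`. -/
noncomputable def splitSum {A : Type*} [CommRing A] (p : ℕ) (l r : ℕ → A) : ℕ → A
  | 0 => 1
  | c + 1 => splitSum p l r c * r (p + c + 1) + ∏ j ∈ Finset.Ioc p (p + c + 1), l j

/-- Here m is the first position with the choice r. It will match the index of degree zero in the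
Vandermonde expansion. -/
theorem splitSum_eq {A : Type*} [CommRing A] (p : ℕ) (l r : ℕ → A) (c : ℕ) :
    splitSum p l r c = ∑ m ∈ Finset.Icc (p + 1) (p + c + 1), ∏ j ∈ Finset.Ioc p (p + c),
      if j < m then l j else r j := by
  induction c with
  | zero => simp [splitSum]
  | succ c ih =>
    rw [splitSum, ih, ← add_assoc, Finset.sum_Icc_succ_top (b := p + c + 1) (by omega),
      Finset.sum_mul]
    congr 1
    · refine Finset.sum_congr rfl fun m hm => ?_
      rw [Finset.mem_Icc] at hm
      rw [Finset.prod_Ioc_succ_top (by omega), if_neg (by omega)]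
    · refine Finset.prod_congr rfl fun j hj => ?_
      rw [Finset.mem_Ioc] at hj
      rw [if_pos (by omega)]

theorem rename_e (f : ℕ → ℕ) (hf : Function.Injective f) (i : ℕ) (z : ℤ) :
    rename f hf (e R i z) = e R (f i) z := by
  have h := congrArg Units.val (congrArg (· ^ z) (map_rename_onePlus (R := R) f hf 1 i))
  simp only [← map_zpow] at h
  exact h

theorem rename_y (f : ℕ → ℕ) (hf : Function.Injective f) (i : ℕ) :
    rename f hf (y R i) = y R (f i) := by
  have h := congrArg Units.val (congrArg (·⁻¹) (map_rename_x (R := R) f hf i))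
  simp only [← map_inv] at h
  exact h

theorem rename_lFac (f : ℕ → ℕ) (hf : Function.Injective f) (v : R) (i : ℕ) :
    rename f hf (lFac v i) = lFac v (f i) := by
  simp only [lFac, map_mul, map_neg, map_add, map_one, rename_C, rename_X, rename_y]

theorem rename_rFac (f : ℕ → ℕ) (hf : Function.Injective f) (u : R) (i : ℕ) :
    rename f hf (rFac u i) = rFac u (f i) := by
  simp only [rFac, map_mul, map_add, map_one, rename_C, rename_X, rename_y]

theorem rename_pairFac (f : ℕ → ℕ) (hf : Function.Injective f) (u v : R) (i j : ℕ) :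
    rename f hf (pairFac u v i j) = pairFac u v (f i) (f j) := by
  simp only [pairFac, map_mul, map_add, map_one, rename_C, rename_X]

/-- The identity that explains the pair factors: the weight uv of two equal neighbours completes the
mixed term to the pair factor with its variables interchanged. -/
theorem rFac_mul_lFac_sub (u v : R) (i j : ℕ) :
    rFac u i * lFac v j - HahnSeries.C (u * v) = -(pairFac u v j i * (y R i * y R j)) := by
  simp only [rFac, lFac, pairFac, map_sub, map_one, map_mul]
  linear_combination (HahnSeries.C u * HahnSeries.C v) * X_mul_y (R := R) i +
    (HahnSeries.C u * HahnSeries.C v) * (X R i * y R i) * X_mul_y (R := R) j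

variable (u v : R) (I J : Finset ℕ) (b : ℕ → ℤ) (p K : ℕ)

/-- The contribution of an entry `z` in position `j` of a row above the row `b`. -/
noncomputable def entryTerm (j : ℕ) (z : ℤ) : Laurent R :=
  HahnSeries.C (entryWeight (exU J u j) (exV I v j) (b j) (b (j + 1)) z) * e R j z

/-- The sum over all rows without the condition that adjacent entries are distinct, after
cancellation. -/
noncomputable def reducedSum (c : ℕ) : Laurent R :=
  splitSum p (fun j => lFac (exV I v j) j * e R j (b j))
    (fun j => rFac (exU J u j) j * e R j (b (j + 1))) c

theorem reducedSum_succ (c : ℕ) : reducedSum u v I J b p (c + 1) =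
    reducedSum u v I J b p c *
        (rFac (exU J u (p + c + 1)) (p + c + 1) * e R (p + c + 1) (b (p + c + 2))) +
      ∏ j ∈ Finset.Ioc p (p + c + 1), lFac (exV I v j) j * e R j (b j) := by
  rw [reducedSum, splitSum]
  rfl

variable (Φ : Laurent R)

/-- `h` times all completions by interlacing entries has constant term zero against `Φ`. -/
def NullAt (c : ℕ) (h : Laurent R) : Prop :=
  ∀ a, Interlaces b (p + c) (p + K) a →
    constTerm (Φ * (h * ∏ j ∈ Finset.Ioc (p + c) (p + K), e R j (a j))) = 0

variable {u v I J b p K Φ}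

theorem NullAt.add {c : ℕ} {h k : Laurent R} (hh : NullAt b p K Φ c h) (hk : NullAt b p K Φ c k) :
    NullAt b p K Φ c (h + k) := by
  intro a ha
  rw [add_mul, mul_add, constTerm_add, hh a ha, hk a ha, add_zero]

theorem NullAt.C_mul {c : ℕ} {h : Laurent R} (hh : NullAt b p K Φ c h) (r : R) :
    NullAt b p K Φ c (HahnSeries.C r * h) := by
  intro a ha
  rw [mul_assoc, mul_left_comm, constTerm_C_mul, hh a ha, mul_zero]

theorem nullAt_zero (c : ℕ) : NullAt b p K Φ c 0 := by
  intro a _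
  rw [zero_mul, mul_zero, constTerm_zero]

theorem NullAt.sum {ι : Type*} {c : ℕ} (s : Finset ι) {f : ι → Laurent R}
    (h : ∀ i ∈ s, NullAt b p K Φ c (f i)) : NullAt b p K Φ c (∑ i ∈ s, f i) := by
  classical
  induction s using Finset.induction_on with
  | empty => simpa using nullAt_zero c
  | insert i s hi ih =>
    rw [Finset.sum_insert hi]
    exact (h i (by simp)).add (ih fun j hj => h j (by simp [hj]))

/-- Fixing one more entry specialises the completion. Quantifying over all completions in `NullAt`
makes a recursion from left to right possible. -/
theorem NullAt.mul_e {c : ℕ} {h : Laurent R} (hh : NullAt b p K Φ c h) (hc : c + 1 ≤ K) {z : ℤ}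
    (h1 : b (p + c + 1) ≤ z) (h2 : z ≤ b (p + c + 2)) :
    NullAt b p K Φ (c + 1) (h * e R (p + c + 1) z) := by
  intro a ha
  have := hh (Function.update a (p + c + 1) z) (by
    intro j hj hj'
    by_cases h : j = p + c + 1
    · subst h; rw [Function.update_self]; exact ⟨h1, h2⟩
    · rw [Function.update_of_ne h]; exact ha j (by omega) hj')
  rw [← Finset.prod_Ioc_consecutive _ (by omega : p + c ≤ p + c + 1) (by omega : p + c + 1 ≤ p + K),
    Finset.prod_Ioc_succ_top le_rfl, Finset.Ioc_self, Finset.prod_empty, one_mul,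
    Function.update_self] at this
  rw [← this, mul_assoc]
  congr 4
  refine Finset.prod_congr rfl fun j hj => ?_
  rw [Finset.mem_Ioc] at hj
  rw [Function.update_of_ne (by omega)]

theorem swap_apply_of_lt_or {k j : ℕ} (h : j < k ∨ k + 1 < j) :
    Equiv.swap k (k + 1) j = j :=
  Equiv.swap_apply_of_ne_of_ne (by omega) (by omega)

theorem rename_swap_reducedSum {c k : ℕ} (hk : p + c < k) :
    rename (Equiv.swap k (k + 1)) (Equiv.injective _) (reducedSum u v I J b p c) =
      reducedSum u v I J b p c := by
  simp only [reducedSum, splitSum_eq, map_sum, map_prod]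
  refine Finset.sum_congr rfl fun m _ => Finset.prod_congr rfl fun j hj => ?_
  rw [Finset.mem_Ioc] at hj
  split_ifs <;> rw [map_mul, rename_e, swap_apply_of_lt_or (by omega)]
  · rw [rename_lFac, swap_apply_of_lt_or (by omega)]
  · rw [rename_rFac, swap_apply_of_lt_or (by omega)]

/-- The constant term of a series that is antisymmetric up to a factor with two swapped
variables vanishes. -/
theorem constTerm_sub_mul_eq_zero (k : ℕ) (h : Laurent R)
    (hh : rename (Equiv.swap k (k + 1)) (Equiv.injective _) h = h) :
    constTerm ((X R k - X R (k + 1)) * h) = 0 := by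
  -- Only one of the two summands is renamed. Antisymmetry of the whole would give just that twice
  -- the constant term is 0, which is too weak in a ring with 2-torsion.
  rw [sub_mul, constTerm_sub, ← constTerm_rename (Equiv.swap k (k + 1)) (Equiv.injective _)
    (X R k * h), map_mul, hh, rename_X, Equiv.swap_apply_left, sub_self]

variable (hb : ∀ j, p < j → j ≤ p + K → b j < b (j + 1) ∨ (u = 1 ∧ v = 1 ∧ b j ≤ b (j + 1)))
  (hI : ∀ j ∈ I, j ≤ p + 1) (hJ : ∀ j ∈ J, p + K + 1 ≤ j)
  (hsym : ∀ k, p < k → k + 1 ≤ p + K → ∃ Ψ : Laurent R,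
    rename (Equiv.swap k (k + 1)) (Equiv.injective _) Ψ = Ψ ∧
      Φ = (X R k - X R (k + 1)) * pairFac u v k (k + 1) * Ψ)
  (h3 : ∀ a, Interlaces b p (p + K) a →
    (∃ j, p < j ∧ j + 2 ≤ p + K ∧ a j = a (j + 1) ∧ a (j + 1) = a (j + 2)) →
      constTerm (Φ * ∏ j ∈ Finset.Ioc p (p + K), e R j (a j)) = 0)

include hb in
theorem sum_entryTerm {j : ℕ} (h1 : p < j) (h2 : j ≤ p + K) :
    ∑ z ∈ Finset.Icc (b j) (b (j + 1)), entryTerm u v I J b j z =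
      rFac (exU J u j) j * e R j (b (j + 1)) + lFac (exV I v j) j * e R j (b j) := by
  apply sum_entryWeight
  rcases hb j h1 h2 with h | ⟨hu, hv, h⟩
  · exact Or.inl h
  · exact Or.inr ⟨by simp [exU, hu], by simp [exV, hv], h⟩

include hb hI hJ in
-- The left entry equals its right lower neighbour (weight u) and the right entry its left lower
-- neighbour (weight v). No exceptional diagonal is involved because these lie at the two ends of
-- the row.
theorem entryTerm_mul_entryTerm {j : ℕ} (h1 : p < j) (h2 : j + 1 ≤ p + K) :
    entryTerm u v I J b j (b (j + 1)) * entryTerm u v I J b (j + 1) (b (j + 1)) =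
      HahnSeries.C (u * v) * (e R j (b (j + 1)) * e R (j + 1) (b (j + 1))) := by
  have hv : exV I v (j + 1) = v := if_neg fun h => by have := hI _ h; omega
  have hu : exU J u j = u := if_neg fun h => by have := hJ _ h; omega
  have key : entryWeight (exU J u j) (exV I v j) (b j) (b (j + 1)) (b (j + 1)) *
      entryWeight (exU J u (j + 1)) (exV I v (j + 1)) (b (j + 1)) (b (j + 1 + 1)) (b (j + 1)) =
        u * v := by
    rw [hv, hu]
    rcases hb j h1 (by omega) with h | ⟨rfl, rfl, -⟩
    · rcases hb (j + 1) (by omega) h2 with h' | ⟨rfl, rfl, -⟩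
      · simp [entryWeight, h.ne', h'.ne]
      · simp [entryWeight, exU, exV]
    · simp [entryWeight, exU, exV]
  rw [← key, map_mul, entryTerm, entryTerm]
  ring

include hsym in
-- By `rFac_mul_lFac_sub` the product contains both pair factors of k and k + 1, hence is symmetric
-- in these variables apart from the factor x_k - x_{k+1} of `Φ`.
theorem nullAt_mul_pair {c : ℕ} (hc : c + 2 ≤ K) (h : Laurent R)
    (hh : rename (Equiv.swap (p + c + 1) (p + c + 1 + 1)) (Equiv.injective _) h = h) (z : ℤ) :
    NullAt b p K Φ (c + 2) (h * ((rFac u (p + c + 1) * lFac v (p + c + 2) - HahnSeries.C (u * v)) *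
      (e R (p + c + 1) z * e R (p + c + 2) z))) := by
  intro a _
  obtain ⟨Ψ, hΨ, rfl⟩ := hsym (p + c + 1) (by omega) (by omega)
  set k := p + c + 1
  have hk : p + c + 2 = k + 1 := rfl
  rw [rFac_mul_lFac_sub, hk]
  have h0 := constTerm_sub_mul_eq_zero k (-(pairFac u v k (k + 1) * pairFac u v (k + 1) k) *
    (Ψ * h * (y R k * y R (k + 1)) * (e R k z * e R (k + 1) z) *
      ∏ j ∈ Finset.Ioc (p + (c + 2)) (p + K), e R j (a j))) (by
    simp only [map_mul, map_neg, rename_pairFac, hΨ, hh, rename_y, rename_e, map_prod,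
      Equiv.swap_apply_left, Equiv.swap_apply_right]
    rw [Finset.prod_congr (g := fun j => e R j (a j)) rfl]
    · ring
    · intro j hj
      rw [Finset.mem_Ioc] at hj
      rw [swap_apply_of_lt_or (by omega)])
  rw [← h0]
  congr 1
  ring

include hb h3 in
theorem nullAt_triple {c : ℕ} (hc : c + 2 ≤ K) (hc0 : c ≠ 0) {a : ℕ → ℤ} (ha : a ∈ rows b p c)
    (hac : a (p + c) = b (p + c + 2)) :
    NullAt b p K Φ (c + 2) ((∏ j ∈ Finset.Ioc p (p + c), e R j (a j)) *
      (e R (p + c + 1) (b (p + c + 2)) * e R (p + c + 2) (b (p + c + 2)))) := by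
  intro a' ha'
  have hle : ∀ j, p < j → j ≤ p + K → b j ≤ b (j + 1) := by
    intro j h1 h2
    rcases hb j h1 h2 with h | h
    · exact h.le
    · exact h.2.2
  -- The full row: `a`, then the repeated value twice, then the given completion. With `hac` it has
  -- three equal neighbours starting at `p + c`, so `h3` applies.
  let d : ℕ → ℤ := fun j => if j ≤ p + c then a j else if j ≤ p + c + 2 then b (p + c + 2) else a' j
  have hd1 : ∀ j, j ≤ p + c → d j = a j := fun j hj => if_pos hj
  have hd2 : ∀ j, p + c < j → j ≤ p + c + 2 → d j = b (p + c + 2) := fun j hj hj' => by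
    simp only [d]; rw [if_neg (by omega), if_pos hj']
  have hd3 : ∀ j, p + c + 2 < j → d j = a' j := fun j hj => by
    simp only [d]; rw [if_neg (by omega), if_neg (by omega)]
  have hdi : Interlaces b p (p + K) d := by
    intro j h1 h2
    by_cases hj : j ≤ p + c
    · rw [hd1 j hj]
      exact ((mem_rows _ _ _ _).1 ha).2.1 j h1 hj
    · by_cases hj' : j ≤ p + c + 2
      · rw [hd2 j (by omega) hj']
        have e1 := hle j h1 h2
        obtain rfl | rfl : j = p + c + 1 ∨ j = p + c + 2 := by omega
        · exact ⟨e1, le_rfl⟩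
        · exact ⟨le_rfl, e1⟩
      · rw [hd3 j (by omega)]
        exact ha' j (by omega) h2
  have := h3 d hdi ⟨p + c, by omega, by omega, by
    rw [hd1 _ le_rfl, hd2 _ (by omega) (by omega), hac], by
    rw [hd2 _ (by omega) (by omega), hd2 _ (by omega) (by omega)]⟩
  rw [← this, ← Finset.prod_Ioc_consecutive (fun j => e R j (d j)) (by omega : p ≤ p + c + 2)
    (by omega : p + c + 2 ≤ p + K), Finset.prod_Ioc_succ_top (by omega),
    Finset.prod_Ioc_succ_top (by omega), hd2 _ (by omega) (by omega), hd2 _ (by omega) (by omega)]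
  congr 2
  rw [mul_assoc (∏ j ∈ Finset.Ioc p (p + c), e R j (d j))]
  congr 1
  · congr 1
    refine Finset.prod_congr rfl fun j hj => ?_
    rw [hd1 j (Finset.mem_Ioc.1 hj).2]
  · refine Finset.prod_congr rfl fun j hj => ?_
    rw [hd3 j (Finset.mem_Ioc.1 hj).1]

include hb hI hJ hsym h3 in
-- Write S for the one-entry sum, W for `rowSum` and D for `reducedSum`. From `rowSum_add_two` and
-- `reducedSum_succ`, the difference W - D at c + 2 is (W - D) at c + 1 times S, minus uv times (W -
-- D) at c with two equal powers, plus terms with three equal neighbours, plus D at c times (r l -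
-- uv) with these powers. Each of the four is null.
theorem nullAt_rowSum_sub (c : ℕ) (hc : c ≤ K) :
    NullAt b p K Φ c (rowSum b p (entryTerm u v I J b) c - reducedSum u v I J b p c) := by
  induction c using Nat.strong_induction_on with
  | _ c ih =>
  rcases c with _ | _ | c
  · rw [rowSum_zero, reducedSum, splitSum, sub_self]
    exact nullAt_zero 0
  · rw [rowSum_one, sum_entryTerm hb (by omega) (by omega)]
    simp only [reducedSum, splitSum, add_zero, zero_add]
    rw [Finset.prod_Ioc_succ_top le_rfl, Finset.Ioc_self, Finset.prod_empty, one_mul, one_mul,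
      sub_self]
    exact nullAt_zero 1
  · have hle : ∀ j, p < j → j ≤ p + K → b j ≤ b (j + 1) := by
      intro j h1 h2
      rcases hb j h1 h2 with h | h
      · exact h.le
      · exact h.2.2
    have e1 := hle (p + c + 1) (by omega) (by omega)
    have e2 := hle (p + c + 2) (by omega) (by omega)
    rw [rowSum_add_two b p _ c e1 e2]
    have hg := entryTerm_mul_entryTerm (u := u) (v := v) (I := I) (J := J) hb hI hJ
      (j := p + c + 1) (by omega) (by omega)
    have hS := sum_entryTerm (I := I) (J := J) hb (j := p + c + 2) (by omega) (by omega)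
    have hv : exV I v (p + c + 2) = v := if_neg fun h => by have := hI _ h; omega
    have hu : exU J u (p + c + 1) = u := if_neg fun h => by have := hJ _ h; omega
    have hD1 : reducedSum u v I J b p (c + 1) = reducedSum u v I J b p c *
        (rFac u (p + c + 1) * e R (p + c + 1) (b (p + c + 2))) +
        ∏ j ∈ Finset.Ioc p (p + c + 1), lFac (exV I v j) j * e R j (b j) := by
      rw [reducedSum_succ, hu]
    have hD2 : reducedSum u v I J b p (c + 2) = reducedSum u v I J b p (c + 1) *
        (rFac (exU J u (p + c + 2)) (p + c + 2) * e R (p + c + 2) (b (p + c + 3))) +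
        (∏ j ∈ Finset.Ioc p (p + c + 1), lFac (exV I v j) j * e R j (b j)) *
          (lFac v (p + c + 2) * e R (p + c + 2) (b (p + c + 2))) := by
      have h := reducedSum_succ u v I J b p (c + 1)
      simp only [← add_assoc] at h
      rw [Finset.prod_Ioc_succ_top (by omega : p ≤ p + c + 1)] at h
      have hv' : exV I v (p + c + 1 + 1) = v := hv
      rw [hv'] at h
      exact h
    have n1 : NullAt b p K Φ (c + 2) ((rowSum b p (entryTerm u v I J b) (c + 1) -
        reducedSum u v I J b p (c + 1)) *
          ∑ z ∈ Finset.Icc (b (p + c + 2)) (b (p + c + 3)),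
            entryTerm u v I J b (p + c + 2) z) := by
      rw [Finset.mul_sum]
      refine NullAt.sum _ fun z hz => ?_
      rw [Finset.mem_Icc] at hz
      rw [entryTerm, mul_left_comm]
      exact ((ih (c + 1) (by omega) (by omega)).mul_e (by omega) hz.1 hz.2).C_mul _
    have n2 : NullAt b p K Φ (c + 2) (HahnSeries.C (-(u * v)) *
        ((rowSum b p (entryTerm u v I J b) c - reducedSum u v I J b p c) *
          e R (p + c + 1) (b (p + c + 2)) * e R (p + c + 2) (b (p + c + 2)))) :=
      (((ih c (by omega) (by omega)).mul_e (by omega) e1 le_rfl).mul_e (by omega) le_rfl e2).C_mul _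
    have n3 : NullAt b p K Φ (c + 2) ((∑ a ∈ rows b p c with c ≠ 0 ∧ a (p + c) = b (p + c + 2),
          ∏ j ∈ Finset.Ioc p (p + c), entryTerm u v I J b j (a j)) *
        (entryTerm u v I J b (p + c + 1) (b (p + c + 2)) *
          entryTerm u v I J b (p + c + 2) (b (p + c + 2)))) := by
      rw [Finset.sum_mul]
      refine NullAt.sum _ fun a ha => ?_
      rw [Finset.mem_filter] at ha
      have := ((nullAt_triple (Φ := Φ) hb h3 hc ha.2.1 ha.1 ha.2.2).C_mul (u * v)).C_mul
        (∏ j ∈ Finset.Ioc p (p + c),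
          entryWeight (exU J u j) (exV I v j) (b j) (b (j + 1)) (a j))
      rw [hg]
      simp only [entryTerm, Finset.prod_mul_distrib, ← map_prod]
      rw [mul_assoc, mul_left_comm (∏ j ∈ Finset.Ioc p (p + c), e R j (a j))]
      exact this
    -- The reduced sum of length c uses only variables with index at most p + c, so the swap of the
    -- next two fixes it.
    have n4 := nullAt_mul_pair (b := b) hsym hc (reducedSum u v I J b p c)
      (rename_swap_reducedSum (by omega)) (b (p + c + 2))
    have hsum := ((n1.add n2).add n3).add n4
    convert hsum using 1
    rw [hg, hS, hv, hD2, hD1, map_neg]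
    ring

include hb hI hJ hsym h3 in
theorem constTerm_mul_rowSum :
    constTerm (Φ * rowSum b p (entryTerm u v I J b) K) =
      constTerm (Φ * reducedSum u v I J b p K) := by
  -- At length K nothing is left to complete, so any sequence serves as completion.
  have := nullAt_rowSum_sub hb hI hJ hsym h3 K le_rfl b (fun j h1 h2 => by omega)
  rwa [Finset.Ioc_self, Finset.prod_empty, mul_one, mul_sub, constTerm_sub, sub_eq_zero] at this

end Summation

end STTree

/-! ### Removing one variable from the constant term expression. -/

namespace STTree

section Recursion

variable {R : Type*} [CommRing R]

open Classical in
/-- The factor of a constant term expression that belongs to one diagonal with deletion lengths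
`σ` and `τ`, bottom entry `z`, and in the variable `x_j`; `P` and `Q` say whether the diagonal is
exceptional. -/
noncomputable def diagFac (u v : R) (σ τ : ℕ) (z : ℤ) (P Q : Prop) (j : ℕ) : (Laurent R)ˣ :=
  (x j / vFactor v j) ^ σ * (x j / onePlus u j) ^ τ * onePlus 1 j ^ z *
    (if P then (onePlus (1 - v) j)⁻¹ else 1) * (if Q then onePlus 1 j / onePlus u j else 1)

theorem rename_diagFac (f : ℕ → ℕ) (hf : Function.Injective f) (u v : R) (σ τ : ℕ) (z : ℤ)
    (P Q : Prop) (j : ℕ) :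
    rename f hf (diagFac u v σ τ z P Q j : Laurent R) = diagFac u v σ τ z P Q (f j) := by
  have h : Units.map (rename (R := R) f hf : Laurent R →* Laurent R)
      (diagFac u v σ τ z P Q j) = diagFac u v σ τ z P Q (f j) := by
    simp only [diagFac]
    split_ifs <;> simp only [map_mul, map_pow, map_div, map_zpow, map_inv, map_one,
      map_rename_x, map_rename_onePlus, map_rename_vFactor]
  exact congrArg Units.val h

theorem val_vFactor_eq (v : R) (j : ℕ) :
    (vFactor v j : Laurent R) = -(1 + HahnSeries.C (1 - v) * X R j) := rfl

theorem val_onePlus (c : R) (j : ℕ) : (onePlus c j : Laurent R) = 1 + HahnSeries.C c * X R j := rfl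

theorem lFac_eq (v : R) (j : ℕ) : lFac v j = ((vFactor v j / x j : (Laurent R)ˣ) : Laurent R) := by
  rw [div_eq_mul_inv, Units.val_mul, val_vFactor_eq]; rfl

theorem rFac_eq (u : R) (j : ℕ) : rFac u j = ((onePlus u j / x j : (Laurent R)ˣ) : Laurent R) := by
  rw [div_eq_mul_inv, Units.val_mul, val_onePlus]; rfl

/-- `lFac` is the inverse of the factor belonging to one deleted cell, so deleting a row shortens
the deletion by one. `rFac_mul_diagFac` is the mirror image. -/
theorem lFac_mul_diagFac (u v : R) {σ : ℕ} (hσ : 0 < σ) (τ : ℕ) (z : ℤ) (P Q : Prop) (j : ℕ) :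
    lFac v j * diagFac u v σ τ z P Q j = diagFac u v (σ - 1) τ z P Q j := by
  obtain ⟨σ, rfl⟩ := Nat.exists_eq_add_of_le' hσ
  rw [lFac_eq, ← Units.val_mul, diagFac, diagFac, Nat.add_sub_cancel, pow_succ]
  congr 1
  have h : vFactor v j / x j * (x j / vFactor v j) = 1 := by simp
  simp only [mul_assoc]
  rw [mul_left_comm, ← mul_assoc (vFactor v j / x j), h, one_mul]

theorem rFac_mul_diagFac (u v : R) (σ : ℕ) {τ : ℕ} (hτ : 0 < τ) (z : ℤ) (P Q : Prop) (j : ℕ) :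
    rFac u j * diagFac u v σ τ z P Q j = diagFac u v σ (τ - 1) z P Q j := by
  obtain ⟨τ, rfl⟩ := Nat.exists_eq_add_of_le' hτ
  rw [rFac_eq, ← Units.val_mul, diagFac, diagFac, Nat.add_sub_cancel, pow_succ]
  congr 1
  have h : onePlus u j / x j * (x j / onePlus u j) = 1 := by simp
  have key : ∀ a p q c d f g : (Laurent R)ˣ,
      a * (p * (q * c) * d * f * g) = a * c * (p * q * d * f * g) := by
    intros; ac_rfl
  rw [key, h, one_mul]

theorem diagFac_zero (u v : R) (z : ℤ) (j : ℕ) {P Q : Prop} (hP : ¬ P) (hQ : ¬ Q) :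
    (diagFac u v 0 0 z P Q j : Laurent R) = e R j z := by
  simp [diagFac, hP, hQ, e]

/-- The exceptional factor cancels 1 + (1-v) x_j and leaves -1/x_j, which is `lFac` with v = 1: the
weight of this equality is switched off. -/
theorem lFac_mul_diagFac_zero (u v : R) (I : Finset ℕ) (z : ℤ) (j : ℕ) {Q : Prop} (hQ : ¬ Q) :
    lFac v j * diagFac u v 0 0 z (j ∈ I) Q j = lFac (exV I v j) j * e R j z := by
  by_cases h : j ∈ I
  · have h1 : (1 + HahnSeries.C (1 - v) * X R j) *
        (((onePlus (1 - v) j)⁻¹ : (Laurent R)ˣ) : Laurent R) = 1 := (onePlus (1 - v) j).mul_inv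
    simp only [diagFac, h, hQ, exV, e, lFac, if_true, if_false, pow_zero, one_mul, mul_one,
      Units.val_mul, sub_self, map_zero, zero_mul, add_zero]
    linear_combination (-y R j * ((onePlus 1 j ^ z : (Laurent R)ˣ) : Laurent R)) * h1
  · rw [diagFac_zero u v z j h hQ, exV, if_neg h]

/-- Here (1 + u x)/x becomes (1 + x)/x, the value for u = 1. The numerator 1 + x of the exceptional
factor is chosen for this. -/
theorem rFac_mul_diagFac_zero (u v : R) (J : Finset ℕ) (z : ℤ) (j : ℕ) {P : Prop} (hP : ¬ P) :
    rFac u j * diagFac u v 0 0 z P (j + 1 ∈ J) j = rFac (exU J u j) j * e R j z := by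
  by_cases h : j + 1 ∈ J
  · have h2 : (onePlus (1 : R) j : Laurent R) = 1 + X R j := by simp [val_onePlus]
    have h1 : (1 + HahnSeries.C u * X R j) *
        (((onePlus u j)⁻¹ : (Laurent R)ˣ) : Laurent R) = 1 := (onePlus u j).mul_inv
    simp only [diagFac, h, hP, exU, e, rFac, if_true, if_false, pow_zero, one_mul, mul_one,
      Units.val_mul, div_eq_mul_inv, map_one, h2]
    linear_combination (y R j * (1 + X R j) * ((onePlus 1 j ^ z : (Laurent R)ˣ) : Laurent R)) * h1
  · rw [diagFac_zero u v z j hP h, exU, if_neg h]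

open Classical in
-- Every deleted cell contributes a factor x_j; all other factors are 1 at x_j = 0. So only
-- diagonals that reach the last row survive the substitution.
theorem diagFac_agreeAtZero (u v : R) (σ τ : ℕ) (z : ℤ) (P Q : Prop) (j : ℕ) :
    ((diagFac u v σ τ z P Q j : Laurent R), if σ = 0 ∧ τ = 0 then 1 else 0) ∈
      agreeAtZero R j := by
  have hx : ∀ c : R, (((x j / onePlus c j : (Laurent R)ˣ) : Laurent R), 0) ∈ agreeAtZero R j := by
    intro c
    have := mul_mem (X_agreeAtZero (R := R) j) (onePlus_inv_agreeAtZero c j)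
    simpa [div_eq_mul_inv] using this
  have hp : ∀ (U : (Laurent R)ˣ), ((U : Laurent R), 0) ∈ agreeAtZero R j → ∀ σ : ℕ,
      (((U ^ σ : (Laurent R)ˣ) : Laurent R), if σ = 0 then 1 else 0) ∈ agreeAtZero R j := by
    intro U hU σ
    have := pow_mem hU σ
    simp only [Prod.pow_mk, zero_pow_eq] at this
    simpa using this
  have h1 := hp (x j / vFactor v j) (by
    have := neg_mem (hx (1 - v))
    rw [vFactor, div_neg]
    simpa using this) σ
  have h2 := hp _ (hx u) τ
  have h3 := onePlus_zpow_agreeAtZero (1 : R) j z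
  have h4 : (((if P then (onePlus (1 - v) j)⁻¹ else 1 : (Laurent R)ˣ) : Laurent R), 1) ∈
      agreeAtZero R j := by
    split_ifs
    · exact onePlus_inv_agreeAtZero (1 - v) j
    · exact one_mem _
  have h5 : (((if Q then onePlus 1 j / onePlus u j else 1 : (Laurent R)ˣ) : Laurent R), 1) ∈
      agreeAtZero R j := by
    split_ifs
    · have := mul_mem (onePlus_agreeAtZero (1 : R) j) (onePlus_inv_agreeAtZero u j)
      simpa [div_eq_mul_inv] using this
    · exact one_mem _
  have := mul_mem (mul_mem (mul_mem (mul_mem h1 h2) h3) h4) h5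
  simp only [Prod.mk_mul_mk, mul_one] at this
  convert this using 1
  simp only [diagFac, Units.val_mul]
  congr 1
  by_cases a : σ = 0 <;> by_cases b : τ = 0 <;> simp [a, b]

theorem pairFac_left_agreeAtZero (u v : R) {m j : ℕ} :
    (pairFac u v j m, 1 + HahnSeries.C (1 - v) * X R j) ∈ agreeAtZero R m := by
  refine ⟨onePlus_mem_nonnegIn (1 - v) m j, HahnSeries.C u * (1 + X R j), ?_, ?_⟩
  · exact mul_mem (C_mem_nonnegIn m u) (add_mem (one_mem _) (X_mem_nonnegIn m j))
  · simp only [pairFac]; ring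

theorem pairFac_right_agreeAtZero (u v : R) {m j : ℕ} :
    (pairFac u v m j, 1 + HahnSeries.C u * X R j) ∈ agreeAtZero R m := by
  refine ⟨onePlus_mem_nonnegIn u m j, HahnSeries.C (1 - v) + HahnSeries.C u * X R j, ?_, ?_⟩
  · exact add_mem (C_mem_nonnegIn m _) (mul_mem (C_mem_nonnegIn m u) (X_mem_nonnegIn m j))
  · simp only [pairFac]; ring

/-- The product of the factors that belong to pairs of variables. -/
noncomputable def pairPart (u v : R) (n : ℕ) : Laurent R :=
  pairProd n (pairFac u v) * pairProd n (fun i j => y R j - y R i)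

/-- A sequence of symmetric factors `τ n` in `x_1, …, x_n` for which the expansion of Vandermonde
products with respect to the index of degree zero remains valid. -/
structure Expandable (τ : ℕ → Laurent R) : Prop where
  symm : ∀ n k, 1 ≤ k → k + 1 ≤ n →
    rename (Equiv.swap k (k + 1)) (Equiv.injective _) (τ n) = τ n
  expand : ∀ n, 1 ≤ n → pairProd (n + 1) (fun i j => y R j - y R i) * τ (n + 1) =
    ∑ m ∈ Finset.Icc 1 (n + 1), (-1) ^ (m + 1) * ((∏ j ∈ Finset.Icc 1 n, y R (skip m j)) *
      pairProd n (fun i j => y R (skip m j) - y R (skip m i)) *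
        rename (skip m) (skip_injective m) (τ n))

theorem prod_ite_lt_neg_one {A : Type*} [CommRing A] (n m : ℕ) (hm : m ∈ Finset.Icc 1 (n + 1)) :
    ∏ j ∈ Finset.Icc 1 n, (if j < m then (-1 : A) else 1) = (-1) ^ (m + 1) := by
  rw [Finset.mem_Icc] at hm
  rw [← Finset.prod_filter, Finset.prod_const]
  have : (Finset.Icc 1 n).filter (fun j => j < m) = Finset.Ico 1 m := by
    ext j; simp only [Finset.mem_filter, Finset.mem_Icc, Finset.mem_Ico]; omega
  rw [this, Nat.card_Ico]
  obtain ⟨m, rfl⟩ := Nat.exists_eq_add_of_le' hm.1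
  rw [Nat.add_sub_cancel]; ring

variable (u v : R) (σ t : ℕ → ℕ) (z : ℕ → ℤ) (P Q : ℕ → Prop)

/-- In the summand of index m no y_m occurs, so x_m may be set to 0. The pair factors with m become
1 + (1-v) x_j or 1 + u x_j, which combine with y_j and the sign to `lFac` or `rFac`. -/
theorem constTerm_term (n m : ℕ) (hm : m ∈ Finset.Icc 1 (n + 1)) (h : Laurent R) :
    constTerm ((∏ i ∈ Finset.Icc 1 (n + 1),
        (diagFac u v (σ i) (t i) (z i) (P i) (Q i) i : Laurent R)) *
      pairProd (n + 1) (pairFac u v) *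
      ((-1) ^ (m + 1) * ((∏ j ∈ Finset.Icc 1 n, y R (skip m j)) *
        pairProd n (fun i j => y R (skip m j) - y R (skip m i)) *
          rename (skip m) (skip_injective m) h))) =
    if σ m = 0 ∧ t m = 0 then constTerm ((∏ j ∈ Finset.Icc 1 n,
      (if j < m then lFac v j else rFac u j) * diagFac u v (σ (skip m j)) (t (skip m j))
        (z (skip m j)) (P (skip m j)) (Q (skip m j)) j) * (pairPart u v n * h)) else 0 := by
  -- All factors free of x_m, written in the variables 1, …, n; renaming along `skip m` puts them
  -- back.
  set Z : Laurent R := (∏ j ∈ Finset.Icc 1 n, (diagFac u v (σ (skip m j)) (t (skip m j))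
        (z (skip m j)) (P (skip m j)) (Q (skip m j)) j : Laurent R)) *
    pairProd n (pairFac u v) * (-1) ^ (m + 1) * (∏ j ∈ Finset.Icc 1 n, y R j) *
      pairProd n (fun i j => y R j - y R i) * h with hZ
  have hZr : rename (skip m) (skip_injective m) Z = (∏ j ∈ Finset.Icc 1 n,
      (diagFac u v (σ (skip m j)) (t (skip m j))
        (z (skip m j)) (P (skip m j)) (Q (skip m j)) (skip m j) : Laurent R)) *
    pairProd n (fun i j => pairFac u v (skip m i) (skip m j)) * (-1) ^ (m + 1) *
      (∏ j ∈ Finset.Icc 1 n, y R (skip m j)) *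
      pairProd n (fun i j => y R (skip m j) - y R (skip m i)) *
        rename (skip m) (skip_injective m) h := by
    simp only [hZ, map_mul, map_prod, map_pairProd, rename_diagFac, rename_pairFac, map_pow,
      map_neg, map_one, rename_y, map_sub]
  have h1 := diagFac_agreeAtZero u v (σ m) (t m) (z m) (P m) (Q m) m
  have h2 : ((∏ j ∈ Finset.Icc 1 n,
      if j < m then pairFac u v (skip m j) m else pairFac u v m (skip m j)),
      rename (skip m) (skip_injective m) (∏ j ∈ Finset.Icc 1 n,
        if j < m then 1 + HahnSeries.C (1 - v) * X R j else 1 + HahnSeries.C u * X R j)) ∈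
      agreeAtZero R m := by
    have := prod_mem (S := agreeAtZero R m) (t := Finset.Icc 1 n)
      (f := fun j => (if j < m then pairFac u v (skip m j) m else pairFac u v m (skip m j),
        rename (skip m) (skip_injective m)
        (if j < m then 1 + HahnSeries.C (1 - v) * X R j else 1 + HahnSeries.C u * X R j))) (by
        intro j _
        split_ifs
        · simp only [map_add, map_mul, map_one, rename_C, rename_X]
          exact pairFac_left_agreeAtZero u v
        · simp only [map_add, map_mul, map_one, rename_C, rename_X]
          exact pairFac_right_agreeAtZero u v)
    rw [map_prod]
    convert this using 1
    ext1
    · rw [Prod.fst_prod]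
    · rw [Prod.snd_prod]
  have h3 := mul_mem (mul_mem h1 h2) (self_mem_agreeAtZero
    (rename_mem_nonnegIn (skip m) (skip_injective m) (notMem_range_skip m) Z))
  have h4 : constTerm ((diagFac u v (σ m) (t m) (z m) (P m) (Q m) m : Laurent R) *
      (∏ j ∈ Finset.Icc 1 n,
        if j < m then pairFac u v (skip m j) m else pairFac u v m (skip m j)) *
      rename (skip m) (skip_injective m) Z) = constTerm ((if σ m = 0 ∧ t m = 0 then 1 else 0) *
      rename (skip m) (skip_injective m) (∏ j ∈ Finset.Icc 1 n,
        if j < m then 1 + HahnSeries.C (1 - v) * X R j else 1 + HahnSeries.C u * X R j) *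
      rename (skip m) (skip_injective m) Z) := constTerm_eq_of_agreeAtZero h3
  have h5 : (∏ i ∈ Finset.Icc 1 (n + 1),
        (diagFac u v (σ i) (t i) (z i) (P i) (Q i) i : Laurent R)) *
      pairProd (n + 1) (pairFac u v) *
      ((-1) ^ (m + 1) * ((∏ j ∈ Finset.Icc 1 n, y R (skip m j)) *
        pairProd n (fun i j => y R (skip m j) - y R (skip m i)) *
          rename (skip m) (skip_injective m) h)) =
      (diagFac u v (σ m) (t m) (z m) (P m) (Q m) m : Laurent R) * (∏ j ∈ Finset.Icc 1 n,
      if j < m then pairFac u v (skip m j) m else pairFac u v m (skip m j)) *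
        rename (skip m) (skip_injective m) Z := by
    rw [hZr, prod_Icc_succ_skip n m hm, pairProd_succ_skip n m hm]
    ring
  rw [h5, h4]
  split_ifs with h0
  · rw [one_mul, ← map_mul, constTerm_rename, hZ, ← prod_ite_lt_neg_one n m hm, pairPart]
    -- The sign (-1)^(m+1) is one factor -1 for each of the m - 1 indices below m.
    have h6 : ∀ j, (if j < m then lFac v j else rFac u j) =
        (if j < m then 1 + HahnSeries.C (1 - v) * X R j else 1 + HahnSeries.C u * X R j) *
          (if j < m then (-1 : Laurent R) else 1) * y R j := by
      intro j
      split_ifs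
      · rw [lFac]; ring
      · rw [rFac]; ring
    simp only [h6, Finset.prod_mul_distrib]
    congr 1
    ring
  · rw [zero_mul, zero_mul, constTerm_zero]

variable {u v σ t z P Q}

theorem constTerm_succ {τ : ℕ → Laurent R} (hτ : Expandable τ) (n : ℕ) (hn : 1 ≤ n) :
    constTerm ((∏ i ∈ Finset.Icc 1 (n + 1),
        (diagFac u v (σ i) (t i) (z i) (P i) (Q i) i : Laurent R)) *
      (pairPart u v (n + 1) * τ (n + 1))) =
    ∑ m ∈ Finset.Icc 1 (n + 1), if σ m = 0 ∧ t m = 0 then constTerm ((∏ j ∈ Finset.Icc 1 n,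
      (if j < m then lFac v j else rFac u j) * diagFac u v (σ (skip m j)) (t (skip m j))
        (z (skip m j)) (P (skip m j)) (Q (skip m j)) j) * (pairPart u v n * τ n)) else 0 := by
  rw [pairPart, mul_assoc, hτ.expand n hn, ← mul_assoc, Finset.mul_sum, constTerm_sum]
  exact Finset.sum_congr rfl fun m hm => constTerm_term u v σ t z P Q n m hm (τ n)

end Recursion

end STTree

/-! ### The effect of deleting the bottom row on the data and on the expression. -/

namespace STTree

/-- The exceptional NE-diagonals that remain exceptional after deleting the bottom row. -/
def innerI (s : ℕ → ℕ) (I : Finset ℕ) : Finset ℕ := I.filter fun i => 0 < s i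

/-- The exceptional SE-diagonals that remain exceptional after deleting the bottom row, with their
new numbers. -/
noncomputable def innerJ (t : ℕ → ℕ) (J : Finset ℕ) : Finset ℕ :=
  (J.preimage Nat.succ Nat.succ_injective.injOn).filter fun j => 0 < t (j + 1)

/-- The bottom entries after deleting the bottom row, where `a` is the row above. -/
def innerB (s t : ℕ → ℕ) (b a : ℕ → ℤ) (j : ℕ) : ℤ :=
  if 0 < s j then b j else if 0 < t (j + 1) then b (j + 1) else a j

theorem mem_innerI {s : ℕ → ℕ} {I : Finset ℕ} {i : ℕ} : i ∈ innerI s I ↔ i ∈ I ∧ 0 < s i :=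
  Finset.mem_filter

theorem mem_innerJ {t : ℕ → ℕ} {J : Finset ℕ} {j : ℕ} :
    j ∈ innerJ t J ↔ j + 1 ∈ J ∧ 0 < t (j + 1) := by
  simp [innerJ]

section

variable {R : Type*} [CommRing R]

/-- The constant term expression for deletion lengths `s`, `t` and bottom entries `b`, shifted by
`d`. -/
noncomputable def treeExpr (u v : R) (d : ℤ) (τ : ℕ → Laurent R) (n : ℕ) (s t : ℕ → ℕ)
    (I J : Finset ℕ) (b : ℕ → ℤ) : Laurent R :=
  (∏ i ∈ Finset.Icc 1 n, (diagFac u v (s i) (t i) (d + b i) (i ∈ I) (i ∈ J) i : Laurent R)) *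
    (pairPart u v n * τ n)

variable (u v : R) (d : ℤ) (τ : ℕ → Laurent R) (n : ℕ) (s t : ℕ → ℕ) (I J : Finset ℕ) (b : ℕ → ℤ)
  (p K : ℕ)

/-- The part of the constant term expression of order `n` that does not depend on the entries of
the regular cells in row `n`. -/
noncomputable def outerExpr : Laurent R :=
  (∏ j ∈ Finset.Icc 1 n, if p < j ∧ j ≤ p + K then e R j d else
    (diagFac u v (s j - 1) (t (j + 1) - 1) (d + innerB s t b 0 j) (j ∈ innerI s I)
      (j ∈ innerJ t J) j : Laurent R)) * (pairPart u v n * τ n)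

variable {u v d τ n s t I J b p K}

theorem prod_Icc_mul_prod_Ioc {A : Type*} [CommRing A] (hK : p + K ≤ n) (f g : ℕ → A) :
    (∏ j ∈ Finset.Icc 1 n, f j) * ∏ j ∈ Finset.Ioc p (p + K), g j =
      ∏ j ∈ Finset.Icc 1 n, f j * if p < j ∧ j ≤ p + K then g j else 1 := by
  rw [Finset.prod_mul_distrib, ← Finset.prod_filter]
  congr 2
  ext j
  simp only [Finset.mem_filter, Finset.mem_Icc, Finset.mem_Ioc]
  omega

variable (hs : ∀ j, 1 ≤ j → j ≤ n + 1 → (0 < s j ↔ j ≤ p))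
  (ht : ∀ j, 1 ≤ j → j ≤ n + 1 → (0 < t j ↔ p + K + 1 < j)) (hK : p + K ≤ n)

include hs ht hK in
-- Diagonals through regular cells of the new bottom row have no deletions and are not exceptional
-- after the step, so `a` enters only through powers of 1 + x_j.
theorem treeExpr_inner (a : ℕ → ℤ) :
    treeExpr u v d τ n (fun j => s j - 1) (fun j => t (j + 1) - 1) (innerI s I) (innerJ t J)
      (innerB s t b a) =
    outerExpr u v d τ n s t I J b p K * ∏ j ∈ Finset.Ioc p (p + K), e R j (a j) := by
  rw [treeExpr, outerExpr, mul_right_comm, prod_Icc_mul_prod_Ioc hK]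
  congr 1
  refine Finset.prod_congr rfl fun j hj => ?_
  rw [Finset.mem_Icc] at hj
  have h1 := hs j hj.1 (by omega)
  have h2 := ht (j + 1) (by omega) (by omega)
  by_cases hm : p < j ∧ j ≤ p + K
  · have hs0 : ¬ 0 < s j := by omega
    have ht0 : ¬ 0 < t (j + 1) := by omega
    rw [if_pos hm, if_pos hm, show s j - 1 = 0 by omega, show t (j + 1) - 1 = 0 by omega,
      diagFac_zero, innerB, if_neg hs0, if_neg ht0, e_add]
    · rw [mem_innerI]; exact fun h => hs0 h.2
    · rw [mem_innerJ]; exact fun h => ht0 h.2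
  · rw [if_neg hm, if_neg hm, mul_one]
    have : innerB s t b a j = innerB s t b 0 j := by
      simp only [innerB]
      split_ifs <;> first | rfl | omega
    rw [this]

variable (hI : ∀ i ∈ I, i ≤ p + 1) (hJ : ∀ j ∈ J, p + K + 1 ≤ j)

include hs ht hK hI hJ in
-- Positions up to p lie before m and lose one NE-deletion; positions after p + K lie after it and
-- take over diagonal j + 1 with one SE-deletion less. Only the positions in between depend on m.
theorem prod_split_eq {m : ℕ} (hm1 : p + 1 ≤ m) (hm2 : m ≤ p + K + 1) :
    (∏ j ∈ Finset.Icc 1 n, (if j < m then lFac v j else rFac u j) *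
      (diagFac u v (s (skip m j)) (t (skip m j)) (d + b (skip m j)) (skip m j ∈ I)
        (skip m j ∈ J) j : Laurent R)) * (pairPart u v n * τ n) =
    outerExpr u v d τ n s t I J b p K * ∏ j ∈ Finset.Ioc p (p + K),
      if j < m then lFac (exV I v j) j * e R j (b j) else
        rFac (exU J u j) j * e R j (b (j + 1)) := by
  rw [outerExpr, mul_right_comm _ (pairPart u v n * τ n), prod_Icc_mul_prod_Ioc hK]
  congr 1
  refine Finset.prod_congr rfl fun j hj => ?_
  rw [Finset.mem_Icc] at hj
  have h1 := hs j hj.1 (by omega)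
  have h1' := hs (j + 1) (by omega) (by omega)
  have h2 := ht j hj.1 (by omega)
  have h2' := ht (j + 1) (by omega) (by omega)
  by_cases hm : p < j ∧ j ≤ p + K
  · rw [if_pos hm, if_pos hm]
    by_cases hjm : j < m
    · rw [if_pos hjm, if_pos hjm, show skip m j = j from if_pos hjm, show s j = 0 by omega,
        show t j = 0 by omega, lFac_mul_diagFac_zero, e_add]
      · ring
      · intro h; have := hJ _ h; omega
    · rw [if_neg hjm, if_neg hjm, show skip m j = j + 1 from if_neg hjm,
        show s (j + 1) = 0 by omega, show t (j + 1) = 0 by omega, rFac_mul_diagFac_zero, e_add]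
      · ring
      · intro h; have := hI _ h; omega
  · rw [if_neg hm, if_neg hm, mul_one]
    by_cases hjp : j ≤ p
    · have hjm : j < m := by omega
      rw [if_pos hjm, show skip m j = j from if_pos hjm, lFac_mul_diagFac u v (by omega),
        innerB, if_pos (h1.2 hjp), show t j = t (j + 1) - 1 by omega]
      have e1 : j ∈ innerI s I ↔ j ∈ I := by
        rw [mem_innerI]; exact and_iff_left (h1.2 hjp)
      have e2 : j ∈ innerJ t J ↔ j ∈ J := by
        rw [mem_innerJ]
        exact ⟨fun h => by omega, fun h => by have := hJ _ h; omega⟩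
      simp only [e1, e2]
    · have hjm : ¬ j < m := by omega
      rw [if_neg hjm, show skip m j = j + 1 from if_neg hjm, rFac_mul_diagFac u v _ (by omega),
        innerB, if_neg (by omega), if_pos (by omega), show s (j + 1) = s j - 1 by omega]
      have e1 : j ∈ innerI s I ↔ j + 1 ∈ I := by
        rw [mem_innerI]
        exact ⟨fun h => by omega, fun h => by have := hI _ h; omega⟩
      have e2 : j ∈ innerJ t J ↔ j + 1 ∈ J := by
        rw [mem_innerJ]; exact and_iff_left (by omega)
      simp only [e1, e2]

include hs ht hK hI hJ in
theorem constTerm_treeExpr_succ (hτ : Expandable τ) (hn : 1 ≤ n) :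
    constTerm (treeExpr u v d τ (n + 1) s t I J b) =
      constTerm (outerExpr u v d τ n s t I J b p K * reducedSum u v I J b p K) := by
  rw [treeExpr, constTerm_succ (σ := s) (t := t) (z := fun i => d + b i) (P := fun i => i ∈ I)
    (Q := fun i => i ∈ J) hτ n hn, ← Finset.sum_filter, reducedSum, splitSum_eq, Finset.mul_sum,
    constTerm_sum]
  refine Finset.sum_congr ?_ fun m hm => ?_
  · ext m
    simp only [Finset.mem_filter, Finset.mem_Icc]
    constructor
    · rintro ⟨h, h1, h2⟩
      have := hs m h.1 h.2
      have := ht m h.1 h.2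
      omega
    · intro h
      have := hs m (by omega) (by omega)
      have := ht m (by omega) (by omega)
      omega
  · rw [Finset.mem_Icc] at hm
    rw [prod_split_eq hs ht hK hI hJ hm.1 hm.2]

include hK in
-- Both k and k + 1 are free positions, where the diagonal factors are the same power of 1 + x. The
-- only asymmetry in these two variables is the factor of the pair (k, k + 1) itself.
theorem outerExpr_swap (hτ : Expandable τ) (k : ℕ) (hk : p < k) (hkK : k + 1 ≤ p + K) :
    ∃ Ψ : Laurent R, rename (Equiv.swap k (k + 1)) (Equiv.injective _) Ψ = Ψ ∧
      outerExpr u v d τ n s t I J b p K =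
        (X R k - X R (k + 1)) * pairFac u v k (k + 1) * Ψ := by
  obtain ⟨P, hP1, hP2⟩ := exists_pairProd_eq_mul (A := Laurent R) n k (by omega) (by omega)
  set h : ℕ → Laurent R := fun j => if p < j ∧ j ≤ p + K then e R j d else
    (diagFac u v (s j - 1) (t (j + 1) - 1) (d + innerB s t b 0 j) (j ∈ innerI s I)
      (j ∈ innerJ t J) j : Laurent R) with hh
  have hr : ∀ j, rename (Equiv.swap k (k + 1)) (Equiv.injective _) (h j) =
      h (Equiv.swap k (k + 1) j) := by
    intro j
    by_cases hj : j = k ∨ j = k + 1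
    · have h1 : p < j ∧ j ≤ p + K := by omega
      have h2 : p < Equiv.swap k (k + 1) j ∧ Equiv.swap k (k + 1) j ≤ p + K := by
        rcases hj with rfl | rfl
        · rw [Equiv.swap_apply_left]; omega
        · rw [Equiv.swap_apply_right]; omega
      simp only [hh]
      rw [if_pos h1, if_pos h2, rename_e]
    · have hs : Equiv.swap k (k + 1) j = j :=
        Equiv.swap_apply_of_ne_of_ne (by omega) (by omega)
      rw [hs]
      simp only [hh]
      split_ifs
      · rw [rename_e, hs]
      · rw [rename_diagFac, hs]
  have hprod : rename (Equiv.swap k (k + 1)) (Equiv.injective _) (∏ j ∈ Finset.Icc 1 n, h j) =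
      ∏ j ∈ Finset.Icc 1 n, h j := by
    rw [map_prod, Finset.prod_congr rfl fun j _ => hr j]
    refine Finset.prod_equiv (Equiv.swap k (k + 1)) (fun j => ?_) fun _ _ => rfl
    simp only [Finset.mem_Icc, Equiv.swap_apply_def]
    split_ifs <;> omega
  set G : ℕ → ℕ → Laurent R := fun i j => pairFac u v i j * (y R j - y R i) with hG
  have hGr : rename (Equiv.swap k (k + 1)) (Equiv.injective _) (∏ c ∈ P, G c.1 c.2) =
      ∏ c ∈ P, G c.1 c.2 := by
    conv_rhs => rw [← hP2 G]
    rw [map_prod]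
    refine Finset.prod_congr rfl fun c _ => ?_
    simp only [hG, map_mul, map_sub, rename_pairFac, rename_y]
  refine ⟨(∏ j ∈ Finset.Icc 1 n, h j) * τ n * (y R k * y R (k + 1)) * ∏ c ∈ P, G c.1 c.2, ?_, ?_⟩
  · rw [map_mul, map_mul, map_mul, map_mul, hprod, hGr, hτ.symm n k (by omega) (by omega),
      rename_y, rename_y, Equiv.swap_apply_left, Equiv.swap_apply_right]
    ring
  · have hy : y R (k + 1) - y R k = (X R k - X R (k + 1)) * (y R k * y R (k + 1)) := by
      linear_combination (-y R (k + 1)) * X_mul_y (R := R) k + y R k * X_mul_y (R := R) (k + 1)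
    rw [outerExpr, pairPart, ← pairProd_mul, hP1]
    simp only [hG, hh]
    rw [hy]
    ring

end

end STTree

namespace STTree

/-! ### Trees as total arrays -/

/-- The cells of the shape of order `n` with deletion lengths `s` and `t`. -/
def Cell (n : ℕ) (s t : ℕ → ℕ) (i j : ℕ) : Prop :=
  1 ≤ j ∧ j ≤ i ∧ i ≤ n ∧ i + s j ≤ n ∧ i + t (n + j - i) ≤ n

/-- The regular cells of the shape of order `n` with deletion lengths `s` and `t`. -/
def Regular (n : ℕ) (s t : ℕ → ℕ) (i j : ℕ) : Prop :=
  Cell n s t i j ∧ Cell n s t (i + 1) j ∧ Cell n s t (i + 1) (j + 1)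

/-- Trees, extended by zero outside of their shape. -/
structure IsTotalTree (n : ℕ) (s t : ℕ → ℕ) (b : ℕ → ℤ) (m : ℕ → ℕ → ℤ) : Prop where
  eq_zero : ∀ i j, ¬ Cell n s t i j → m i j = 0
  le : ∀ i j, Regular n s t i j → m (i + 1) j ≤ m i j ∧ m i j ≤ m (i + 1) (j + 1)
  ne : ∀ i j, Regular n s t i j → Regular n s t i (j + 1) → m i j ≠ m i (j + 1)
  bottomNE : ∀ j, 1 ≤ j → j ≤ n → t j = 0 → m (n - s j) j = b j
  bottomSE : ∀ j, 1 ≤ j → j ≤ n → s j = 0 → m (n - t j) (j - t j) = b j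

section Weights

variable {R : Type*} [CommRing R] (u v : R)

open Classical in
/-- The contribution of a cell to the weight of a tree. -/
noncomputable def cellWeight (n : ℕ) (s t : ℕ → ℕ) (I J : Finset ℕ) (m : ℕ → ℕ → ℤ) (i j : ℕ) :
    R :=
  (if Regular n s t i j ∧ m i j = m (i + 1) j ∧ ¬ (j ∈ I ∧ i + 1 + s j = n) then v else 1) *
    (if Regular n s t i j ∧ m i j = m (i + 1) (j + 1) ∧
      ¬ (n + j - i ∈ J ∧ i + 1 + t (n + j - i) = n) then u else 1)

/-- The weight of a tree. -/
noncomputable def treeWeight (n : ℕ) (s t : ℕ → ℕ) (I J : Finset ℕ) (m : ℕ → ℕ → ℤ) : R :=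
  ∏ i ∈ Finset.range n, ∏ j ∈ Finset.range (i + 1), cellWeight u v n s t I J m i j

end Weights

/-- Adding a bottom row to an array. -/
noncomputable def addRow (n : ℕ) (s t : ℕ → ℕ) (b : ℕ → ℤ) (m : ℕ → ℕ → ℤ) : ℕ → ℕ → ℤ :=
  fun i j => if i = n + 1 then
    (if 1 ≤ j ∧ j ≤ n + 1 ∧ s j = 0 ∧ t j = 0 then b j else 0) else m i j

/-- NE-diagonals keep their number when the order drops, while SE-diagonal j + 1 becomes number j;
hence the shift in `t`. -/
theorem cell_succ_iff {n : ℕ} {s t : ℕ → ℕ} {i j : ℕ} (hi : i ≤ n) :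
    Cell (n + 1) s t i j ↔ Cell n (fun j => s j - 1) (fun j => t (j + 1) - 1) i j := by
  simp only [Cell]
  rw [show n + 1 + j - i = n + j - i + 1 by omega]
  omega

theorem cell_last_iff {n : ℕ} {s t : ℕ → ℕ} {j : ℕ} :
    Cell (n + 1) s t (n + 1) j ↔ 1 ≤ j ∧ j ≤ n + 1 ∧ s j = 0 ∧ t j = 0 := by
  unfold Cell
  rw [show n + 1 + j - (n + 1) = j by omega]
  omega

theorem regular_succ_iff {n : ℕ} {s t : ℕ → ℕ} {i j : ℕ} (hi : i < n) :
    Regular (n + 1) s t i j ↔ Regular n (fun j => s j - 1) (fun j => t (j + 1) - 1) i j := by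
  unfold Regular
  rw [cell_succ_iff hi.le, cell_succ_iff hi, cell_succ_iff hi]

theorem Cell.le {n : ℕ} {s t : ℕ → ℕ} {i j : ℕ} (h : Cell n s t i j) : i ≤ n := h.2.2.1

/-! ### Splitting a tree into its bottom row and the rest. -/

section Step

variable {n p K : ℕ} {s t : ℕ → ℕ} {b : ℕ → ℤ}
  (hs : ∀ j, 1 ≤ j → j ≤ n + 1 → (0 < s j ↔ j ≤ p))
  (ht : ∀ j, 1 ≤ j → j ≤ n + 1 → (0 < t j ↔ p + K + 1 < j)) (hK : p + K ≤ n)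

include hs ht hK

theorem regular_last_iff {j : ℕ} : Regular (n + 1) s t n j ↔ p < j ∧ j ≤ p + K := by
  rw [Regular, cell_last_iff, cell_last_iff]
  constructor
  · rintro ⟨h1, ⟨h2, h3, h4, h5⟩, ⟨h6, h7, h8, h9⟩⟩
    have := hs j h2 h3
    have := ht (j + 1) h6 h7
    omega
  · rintro ⟨h1, h2⟩
    have e1 := hs j (by omega) (by omega)
    have e2 := hs (j + 1) (by omega) (by omega)
    have e3 := ht j (by omega) (by omega)
    have e4 := ht (j + 1) (by omega) (by omega)
    refine ⟨?_, by omega, by omega⟩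
    unfold Cell
    rw [show n + 1 + j - n = j + 1 by omega]
    omega

theorem isTotalTree_entry {a : ℕ → ℤ} {m : ℕ → ℕ → ℤ}
    (hm : IsTotalTree n (fun j => s j - 1) (fun j => t (j + 1) - 1) (innerB s t b a) m) {j : ℕ}
    (h1 : p < j) (h2 : j ≤ p + K) : m n j = a j := by
  have e1 := hs j (by omega) (by omega)
  have e4 := ht (j + 1) (by omega) (by omega)
  have := hm.bottomNE j (by omega) (by omega) (show t (j + 1) - 1 = 0 by omega)
  rw [innerB, if_neg (by omega), if_neg (by omega), show n - (s j - 1) = n by omega] at this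
  exact this

theorem isTotalTree_addRow {a : ℕ → ℤ} (ha : a ∈ rows b p K) {m : ℕ → ℕ → ℤ}
    (hm : IsTotalTree n (fun j => s j - 1) (fun j => t (j + 1) - 1) (innerB s t b a) m) :
    IsTotalTree (n + 1) s t b (addRow n s t b m) := by
  rw [mem_rows] at ha
  have hlast : ∀ i j, i ≤ n → addRow n s t b m i j = m i j := fun i j hi => if_neg (by omega)
  have hrow : ∀ j, 1 ≤ j → j ≤ n + 1 → s j = 0 → t j = 0 → addRow n s t b m (n + 1) j = b j := by
    intro j h1 h2 h3 h4
    rw [addRow, if_pos rfl, if_pos ⟨h1, h2, h3, h4⟩]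
  have hreg : ∀ {i j}, Regular (n + 1) s t i j → i ≤ n := fun h => by
    have := h.2.1.le; omega
  refine ⟨fun i j hc => ?_, fun i j hr => ?_, fun i j hr hr' => ?_, fun j h1 h2 h3 => ?_,
    fun j h1 h2 h3 => ?_⟩
  · by_cases hi : i = n + 1
    · subst hi
      rw [cell_last_iff] at hc
      rw [addRow, if_pos rfl, if_neg hc]
    · rw [addRow, if_neg hi]
      by_cases hi' : i ≤ n
      · exact hm.eq_zero i j (by rwa [← cell_succ_iff hi'])
      · exact hm.eq_zero i j fun h => hi' h.le
  · rcases (hreg hr).lt_or_eq with hi | rfl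
    · rw [hlast _ _ hi.le, hlast _ _ hi, hlast _ _ hi]
      exact hm.le i j ((regular_succ_iff hi).1 hr)
    · have h := (regular_last_iff hs ht hK).1 hr
      have h2 := cell_last_iff.1 hr.2.1
      have h3 := cell_last_iff.1 hr.2.2
      rw [hlast _ _ le_rfl, hrow j h2.1 h2.2.1 h2.2.2.1 h2.2.2.2,
        hrow (j + 1) h3.1 h3.2.1 h3.2.2.1 h3.2.2.2, isTotalTree_entry hs ht hK hm h.1 h.2]
      exact ha.2.1 j h.1 h.2
  · rcases (hreg hr).lt_or_eq with hi | rfl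
    · rw [hlast _ _ hi.le, hlast _ _ hi.le]
      exact hm.ne i j ((regular_succ_iff hi).1 hr) ((regular_succ_iff hi).1 hr')
    · have h := (regular_last_iff hs ht hK).1 hr
      have h' := (regular_last_iff hs ht hK).1 hr'
      rw [hlast _ _ le_rfl, hlast _ _ le_rfl, isTotalTree_entry hs ht hK hm h.1 h.2,
        isTotalTree_entry hs ht hK hm h'.1 h'.2]
      exact ha.2.2 j h.1 h'.2
  · have e1 := hs j h1 h2
    by_cases h : s j = 0
    · rw [h, Nat.sub_zero]
      exact hrow j h1 h2 h h3
    · have e2 := ht (j + 1) (by omega) (by omega)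
      have := hm.bottomNE j h1 (by omega) (show t (j + 1) - 1 = 0 by omega)
      rw [innerB, if_pos (by omega)] at this
      rw [hlast _ _ (by omega), show n + 1 - s j = n - (s j - 1) by omega, this]
  · have e1 := ht j h1 h2
    by_cases h : t j = 0
    · rw [h, Nat.sub_zero, Nat.sub_zero]
      exact hrow j h1 h2 h3 h
    · obtain ⟨j, rfl⟩ := Nat.exists_eq_add_of_le' h1
      have e2 := hs j (by omega) (by omega)
      have := hm.bottomSE j (by omega) (by omega) (show s j - 1 = 0 by omega)
      rw [innerB, if_neg (by omega), if_pos (by omega)] at this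
      rw [hlast _ _ (by omega), show n + 1 - t (j + 1) = n - (t (j + 1) - 1) by omega,
        show j + 1 - t (j + 1) = j - (t (j + 1) - 1) by omega, this]

theorem exists_eq_addRow {m : ℕ → ℕ → ℤ} (hm : IsTotalTree (n + 1) s t b m) :
    ∃ a ∈ rows b p K, ∃ m', IsTotalTree n (fun j => s j - 1) (fun j => t (j + 1) - 1)
      (innerB s t b a) m' ∧ addRow n s t b m' = m := by
  have hrow : ∀ j, 1 ≤ j → j ≤ n + 1 → s j = 0 → t j = 0 → m (n + 1) j = b j := by
    intro j h1 h2 h3 h4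
    have := hm.bottomNE j h1 h2 h4
    rwa [h3, Nat.sub_zero] at this
  -- Only the regular cells of row n are free; the other bottom entries of the smaller tree are
  -- prescribed by `b`.
  set a : ℕ → ℤ := fun j => if p < j ∧ j ≤ p + K then m n j else 0 with ha
  have hav : ∀ j, p < j → j ≤ p + K → a j = m n j := fun j h1 h2 => if_pos ⟨h1, h2⟩
  set m' : ℕ → ℕ → ℤ := fun i j => if i ≤ n then m i j else 0 with hm'
  have hmv : ∀ i j, i ≤ n → m' i j = m i j := fun i j hi => if_pos hi
  refine ⟨a, ?_, m', ⟨fun i j hc => ?_, fun i j hr => ?_, fun i j hr hr' => ?_,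
    fun j h1 h2 h3 => ?_, fun j h1 h2 h3 => ?_⟩, ?_⟩
  · rw [mem_rows]
    refine ⟨fun j hj => if_neg hj, fun j h1 h2 => ?_, fun j h1 h2 => ?_⟩
    · have hr := (regular_last_iff hs ht hK).2 ⟨h1, h2⟩
      have h3 := cell_last_iff.1 hr.2.1
      have h4 := cell_last_iff.1 hr.2.2
      have := hm.le n j hr
      rw [hrow j h3.1 h3.2.1 h3.2.2.1 h3.2.2.2,
        hrow (j + 1) h4.1 h4.2.1 h4.2.2.1 h4.2.2.2] at this
      rwa [hav j h1 h2]
    · rw [hav j h1 (by omega), hav (j + 1) (by omega) h2]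
      exact hm.ne n j ((regular_last_iff hs ht hK).2 ⟨h1, by omega⟩)
        ((regular_last_iff hs ht hK).2 ⟨by omega, h2⟩)
  · by_cases hi : i ≤ n
    · rw [hmv i j hi]
      exact hm.eq_zero i j (by rwa [cell_succ_iff hi])
    · exact if_neg hi
  · have hi : i < n := hr.2.1.le
    rw [hmv _ _ hi.le, hmv _ _ hi, hmv _ _ hi]
    exact hm.le i j ((regular_succ_iff hi).2 hr)
  · have hi : i < n := hr.2.1.le
    rw [hmv _ _ hi.le, hmv _ _ hi.le]
    exact hm.ne i j ((regular_succ_iff hi).2 hr) ((regular_succ_iff hi).2 hr')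
  · have h3 : t (j + 1) - 1 = 0 := h3
    change m' (n - (s j - 1)) j = _
    have e1 := hs j h1 (by omega)
    have e2 := hs (j + 1) (by omega) (by omega)
    have e3 := ht j h1 (by omega)
    have e4 := ht (j + 1) (by omega) (by omega)
    rw [hmv _ _ (by omega), innerB]
    by_cases h : 0 < s j
    · rw [if_pos h, ← hm.bottomNE j h1 (by omega) (by omega)]
      congr 1; omega
    · rw [if_neg h, show n - (s j - 1) = n by omega]
      by_cases h' : 0 < t (j + 1)
      · rw [if_pos h', ← hm.bottomSE (j + 1) (by omega) (by omega) (by omega),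
          show t (j + 1) = 1 by omega]
        rfl
      · rw [if_neg h', hav j (by omega) (by omega)]
  · have h3 : s j - 1 = 0 := h3
    change m' (n - (t (j + 1) - 1)) (j - (t (j + 1) - 1)) = _
    have e1 := hs j h1 (by omega)
    have e2 := hs (j + 1) (by omega) (by omega)
    have e3 := ht j h1 (by omega)
    have e4 := ht (j + 1) (by omega) (by omega)
    rw [hmv _ _ (by omega), innerB]
    by_cases h' : 0 < t (j + 1)
    · rw [if_neg (by omega), if_pos h', ← hm.bottomSE (j + 1) (by omega) (by omega) (by omega)]
      congr 1 <;> omega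
    · rw [if_neg h', show t (j + 1) - 1 = 0 by omega, Nat.sub_zero, Nat.sub_zero]
      by_cases h : 0 < s j
      · rw [if_pos h, ← hm.bottomNE j h1 (by omega) (by omega), show s j = 1 by omega]
        rfl
      · rw [if_neg h, hav j (by omega) (by omega)]
  · funext i j
    by_cases hi : i = n + 1
    · subst hi
      rw [addRow, if_pos rfl]
      split_ifs with h
      · exact (hrow j h.1 h.2.1 h.2.2.1 h.2.2.2).symm
      · exact (hm.eq_zero _ _ (by rwa [cell_last_iff])).symm
    · rw [addRow, if_neg hi]
      by_cases hi' : i ≤ n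
      · exact hmv i j hi'
      · rw [hm.eq_zero i j fun h => by have := h.le; omega]
        exact if_neg hi'

theorem setOf_isTotalTree_succ : {m | IsTotalTree (n + 1) s t b m} =
    ⋃ a ∈ (rows b p K : Set (ℕ → ℤ)), addRow n s t b ''
      {m | IsTotalTree n (fun j => s j - 1) (fun j => t (j + 1) - 1) (innerB s t b a) m} := by
  ext m
  simp only [Set.mem_ofPred_eq, Set.mem_iUnion, Set.mem_image, Finset.mem_coe, exists_prop]
  constructor
  · exact fun h => exists_eq_addRow hs ht hK h
  · rintro ⟨a, ha, m', hm', rfl⟩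
    exact isTotalTree_addRow hs ht hK ha hm'

variable {R : Type*} [CommRing R] (u v : R) (I J : Finset ℕ)

/-- An exceptional diagonal matters in just one row, the one above its bottom cell. With deletion
length 0 that is row n, treated by `exU` and `exV`; with positive length the diagonal is passed on
to the smaller tree. -/
theorem treeWeight_addRow {a : ℕ → ℤ} {m : ℕ → ℕ → ℤ}
    (hm : IsTotalTree n (fun j => s j - 1) (fun j => t (j + 1) - 1) (innerB s t b a) m) :
    treeWeight u v (n + 1) s t I J (addRow n s t b m) =
      (∏ j ∈ Finset.Ioc p (p + K),
        entryWeight (exU J u j) (exV I v j) (b j) (b (j + 1)) (a j)) *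
      treeWeight u v n (fun j => s j - 1) (fun j => t (j + 1) - 1) (innerI s I) (innerJ t J) m := by
  have hlast : ∀ i j, i ≤ n → addRow n s t b m i j = m i j := fun i j hi => if_neg (by omega)
  have hrow : ∀ j, 1 ≤ j → j ≤ n + 1 → s j = 0 → t j = 0 → addRow n s t b m (n + 1) j = b j := by
    intro j h1 h2 h3 h4
    rw [addRow, if_pos rfl, if_pos ⟨h1, h2, h3, h4⟩]
  rw [treeWeight, Finset.prod_range_succ, mul_comm]
  congr 1
  · have : Finset.Ioc p (p + K) = (Finset.range (n + 1)).filter (fun j => p < j ∧ j ≤ p + K) := by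
      ext j; simp only [Finset.mem_Ioc, Finset.mem_filter, Finset.mem_range]; omega
    rw [this, Finset.prod_filter]
    refine Finset.prod_congr rfl fun j _ => ?_
    unfold cellWeight
    rw [regular_last_iff hs ht hK]
    by_cases h : p < j ∧ j ≤ p + K
    · have hr := (regular_last_iff hs ht hK).2 h
      have h2 := cell_last_iff.1 hr.2.1
      have h3 := cell_last_iff.1 hr.2.2
      rw [hlast _ _ le_rfl, hrow j h2.1 h2.2.1 h2.2.2.1 h2.2.2.2,
        hrow (j + 1) h3.1 h3.2.1 h3.2.2.1 h3.2.2.2, isTotalTree_entry hs ht hK hm h.1 h.2,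
        show n + 1 + j - n = j + 1 by omega, h2.2.2.1, h3.2.2.2]
      simp only [h, true_and, entryWeight, exU, exV, and_true, if_true, add_zero]
      congr 1
      · by_cases h1 : a j = b j <;> by_cases h2 : j ∈ I <;> simp [h1, h2]
      · by_cases h1 : a j = b (j + 1) <;> by_cases h2 : j + 1 ∈ J <;> simp [h1, h2]
    · simp [h]
  · refine Finset.prod_congr rfl fun i hi => Finset.prod_congr rfl fun j hj => ?_
    rw [Finset.mem_range] at hi hj
    unfold cellWeight
    rw [regular_succ_iff hi, hlast _ _ hi.le, hlast _ _ hi, hlast _ _ hi]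
    have e1 : (j ∈ I ∧ i + 1 + s j = n + 1) ↔ (j ∈ innerI s I ∧ i + 1 + (s j - 1) = n) := by
      rw [mem_innerI]
      constructor
      · rintro ⟨h1, h2⟩; exact ⟨⟨h1, by omega⟩, by omega⟩
      · rintro ⟨⟨h1, h2⟩, h3⟩; exact ⟨h1, by omega⟩
    have e2 : (n + 1 + j - i ∈ J ∧ i + 1 + t (n + 1 + j - i) = n + 1) ↔
        (n + j - i ∈ innerJ t J ∧ i + 1 + (t (n + j - i + 1) - 1) = n) := by
      rw [mem_innerJ, show n + 1 + j - i = n + j - i + 1 by omega]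
      constructor
      · rintro ⟨h1, h2⟩; exact ⟨⟨h1, by omega⟩, by omega⟩
      · rintro ⟨⟨h1, h2⟩, h3⟩; exact ⟨h1, by omega⟩
    have key : ∀ {P Q : Prop} {dP : Decidable P} {dQ : Decidable Q} (x : R), (P ↔ Q) →
        @ite R P dP x 1 = @ite R Q dQ x 1 := by
      intro P Q dP dQ x h
      simp only [h]
    exact congrArg₂ _ (key v (and_congr Iff.rfl (and_congr Iff.rfl (not_congr e1))))
      (key u (and_congr Iff.rfl (and_congr Iff.rfl (not_congr e2))))

end Step

end STTree

/-! ### Stability of the hypotheses under deleting the bottom row. -/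

namespace STTree

/-- Deletion lengths, exceptional diagonals and bottom entries for which the enumeration of trees
is valid. -/
structure Admissible {R : Type*} [CommRing R] (u v : R) (n : ℕ) (s t : ℕ → ℕ) (I J : Finset ℕ)
    (b : ℕ → ℤ) : Prop where
  anti : AntitoneOn s (Set.Icc 1 n)
  mono : MonotoneOn t (Set.Icc 1 n)
  row : ∀ i, 1 ≤ i → i ≤ n → ∃ j, Cell n s t i j
  exNE : ∀ i ∈ I, 1 ≤ i ∧ i ≤ n ∧ (i = 1 ∨ s i < s (i - 1))
  exSE : ∀ j ∈ J, 1 ≤ j ∧ j ≤ n ∧ (j = n ∨ t j < t (j + 1))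
  bottom : StrictMonoOn b (Set.Icc 1 n) ∨ (u = 1 ∧ v = 1 ∧ MonotoneOn b (Set.Icc 1 n))

section

variable {R : Type*} [CommRing R] {u v : R} {n : ℕ} {s t : ℕ → ℕ} {I J : Finset ℕ} {b : ℕ → ℤ}

theorem Admissible.monotoneOn (h : Admissible u v n s t I J b) : MonotoneOn b (Set.Icc 1 n) := by
  rcases h.bottom with h | h
  · exact h.monotoneOn
  · exact h.2.2

/-- The bottom row consists of the cells between two bounds. -/
theorem Admissible.exists_bounds (h : Admissible u v (n + 1) s t I J b) :
    ∃ p K, p + K ≤ n ∧ (∀ j, 1 ≤ j → j ≤ n + 1 → (0 < s j ↔ j ≤ p)) ∧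
      ∀ j, 1 ≤ j → j ≤ n + 1 → (0 < t j ↔ p + K + 1 < j) := by
  obtain ⟨j0, hj0⟩ := h.row (n + 1) (by omega) le_rfl
  rw [cell_last_iff] at hj0
  -- The last shortened NE-diagonal and the last unshortened SE-diagonal. If no NE-diagonal is
  -- shortened, the default value 0 is the required bound.
  set p := Nat.findGreatest (fun j => 0 < s j) (n + 1) with hp
  set Q := Nat.findGreatest (fun j => t j = 0) (n + 1) with hQ
  have hpn : p ≤ n + 1 := Nat.findGreatest_le _
  have hQn : Q ≤ n + 1 := Nat.findGreatest_le _
  have h1 : ∀ j, 1 ≤ j → j ≤ n + 1 → (0 < s j ↔ j ≤ p) := by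
    intro j hj hj'
    constructor
    · intro hs
      exact Nat.le_findGreatest hj' hs
    · intro hjp
      have : 0 < s p := Nat.findGreatest_of_ne_zero (P := fun j => 0 < s j) hp.symm (by omega)
      exact this.trans_le (h.anti ⟨hj, hj'⟩ ⟨by omega, hpn⟩ hjp)
  have hQ0 : j0 ≤ Q := Nat.le_findGreatest hj0.2.1 hj0.2.2.2
  have h2 : ∀ j, 1 ≤ j → j ≤ n + 1 → (0 < t j ↔ Q < j) := by
    intro j hj hj'
    constructor
    · intro ht
      by_contra hjQ
      have : t Q = 0 := Nat.findGreatest_of_ne_zero (P := fun j => t j = 0) hQ.symm (by omega)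
      have hm := h.mono
      have := hm (a := j) ⟨hj, hj'⟩ (b := Q) ⟨by omega, hQn⟩ (by omega)
      omega
    · intro hjQ
      have : ¬ t j = 0 := Nat.findGreatest_is_greatest (P := fun j => t j = 0) hjQ hj'
      omega
  -- The bottom row keeps the cell j0, which lies strictly after p and not after Q.
  have hpQ : p < Q := by
    have := h1 j0 hj0.1 hj0.2.1
    omega
  refine ⟨p, Q - p - 1, by omega, h1, ?_⟩
  rwa [show p + (Q - p - 1) + 1 = Q by omega]

variable {p K : ℕ} (h : Admissible u v (n + 1) s t I J b) (hK : p + K ≤ n)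
  (hs : ∀ j, 1 ≤ j → j ≤ n + 1 → (0 < s j ↔ j ≤ p))
  (ht : ∀ j, 1 ≤ j → j ≤ n + 1 → (0 < t j ↔ p + K + 1 < j))

include h hs ht in
theorem innerB_bounds {a : ℕ → ℤ} (ha : Interlaces b p (p + K) a) {j : ℕ} (h1 : 1 ≤ j)
    (h2 : j ≤ n) : b j ≤ innerB s t b a j ∧ innerB s t b a j ≤ b (j + 1) := by
  have e1 := hs j h1 (by omega)
  have e2 := ht (j + 1) (by omega) (by omega)
  have hm := h.monotoneOn
  replace hm := hm (a := j) ⟨h1, by omega⟩ (b := j + 1) ⟨by omega, by omega⟩ (by omega)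
  simp only [innerB]
  split_ifs
  · exact ⟨le_rfl, hm⟩
  · exact ⟨hm, le_rfl⟩
  · exact ha j (by omega) (by omega)

include h hs ht in
theorem innerB_monotoneOn {a : ℕ → ℤ} (ha : Interlaces b p (p + K) a) :
    MonotoneOn (innerB s t b a) (Set.Icc 1 n) := by
  rintro i ⟨hi1, hi2⟩ j ⟨hj1, hj2⟩ hij
  rcases hij.lt_or_eq with hij | rfl
  · refine (innerB_bounds h hs ht ha hi1 hi2).2.trans (le_trans ?_
      (innerB_bounds h hs ht ha hj1 hj2).1)
    exact h.monotoneOn ⟨by omega, by omega⟩ ⟨by omega, by omega⟩ hij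
  · exact le_rfl

include h hs ht in
-- Neighbours i, i + 1 are separated by b_{i+1}. If one of them is prescribed it differs from
-- b_{i+1}; if both are free, the distinctness of adjacent row entries gives strictness.
theorem innerB_strictMonoOn (hb : StrictMonoOn b (Set.Icc 1 (n + 1))) {a : ℕ → ℤ}
    (ha : a ∈ rows b p K) : StrictMonoOn (innerB s t b a) (Set.Icc 1 n) := by
  rw [mem_rows] at ha
  rintro i ⟨hi1, hi2⟩ j ⟨hj1, hj2⟩ hij
  have hi := innerB_bounds h hs ht ha.2.1 hi1 hi2
  have hj := innerB_bounds h hs ht ha.2.1 hj1 hj2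
  by_cases hij' : i + 1 < j
  · have := hb (a := i + 1) ⟨by omega, by omega⟩ (b := j) ⟨by omega, by omega⟩ hij'
    omega
  · obtain rfl : j = i + 1 := by omega
    have e1 := hs i hi1 (by omega)
    have e1' := hs (i + 1) hj1 (by omega)
    have e2 := ht (i + 1) (by omega) (by omega)
    have e2' := ht (i + 1 + 1) (by omega) (by omega)
    have hb1 := hb (a := i) ⟨by omega, by omega⟩ (b := i + 1) ⟨by omega, by omega⟩ (by omega)
    have hb2 := hb (a := i + 1) ⟨by omega, by omega⟩ (b := i + 1 + 1) ⟨by omega, by omega⟩ (by omega)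
    by_cases c1 : 0 < s i
    · have : innerB s t b a i = b i := if_pos c1
      omega
    · by_cases c2 : 0 < t (i + 1 + 1)
      · have : innerB s t b a (i + 1) = b (i + 1 + 1) := by
          rw [innerB, if_neg (by omega), if_pos c2]
        omega
      · have i1 : innerB s t b a i = a i := by rw [innerB, if_neg c1, if_neg (by omega)]
        have i2 : innerB s t b a (i + 1) = a (i + 1) := by
          rw [innerB, if_neg (by omega), if_neg c2]
        have := ha.2.2 i (by omega) (by omega)
        omega

include h hK hs ht in
-- For u = v = 1 rows with equal neighbours are admitted as well: the induction hypothesis is also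
-- needed for rows that occur in no tree.
theorem Admissible.inner {a : ℕ → ℤ} (ha : Interlaces b p (p + K) a)
    (hab : a ∈ rows b p K ∨ (u = 1 ∧ v = 1)) :
    Admissible u v n (fun j => s j - 1) (fun j => t (j + 1) - 1) (innerI s I) (innerJ t J)
      (innerB s t b a) where
  anti := by
    rintro i ⟨hi1, hi2⟩ j ⟨hj1, hj2⟩ hij
    exact Nat.sub_le_sub_right (h.anti ⟨hi1, by omega⟩ ⟨hj1, by omega⟩ hij) 1
  mono := by
    rintro i ⟨hi1, hi2⟩ j ⟨hj1, hj2⟩ hij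
    have hm := h.mono
    exact Nat.sub_le_sub_right (hm (a := i + 1) ⟨by omega, by omega⟩ (b := j + 1)
      ⟨by omega, by omega⟩ (by omega)) 1
  row := by
    intro i hi1 hi2
    obtain ⟨j, hj⟩ := h.row i hi1 (by omega)
    exact ⟨j, (cell_succ_iff hi2).1 hj⟩
  exNE := by
    intro i hi
    rw [mem_innerI] at hi
    obtain ⟨h1, h2, h3⟩ := h.exNE i hi.1
    have := hs i h1 h2
    exact ⟨h1, by omega, by omega⟩
  exSE := by
    intro j hj
    rw [mem_innerJ] at hj
    obtain ⟨h1, h2, h3⟩ := h.exSE (j + 1) hj.1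
    have := ht (j + 1) h1 h2
    exact ⟨by omega, by omega, by omega⟩
  bottom := by
    rcases h.bottom with hb | ⟨hu, hv, -⟩
    · rcases hab with hab | ⟨hu, hv⟩
      · exact Or.inl (innerB_strictMonoOn h hs ht hb hab)
      · exact Or.inr ⟨hu, hv, innerB_monotoneOn h hs ht ha⟩
    · exact Or.inr ⟨hu, hv, innerB_monotoneOn h hs ht ha⟩

include h hs in
-- If s_i < s_{i-1} then diagonal i - 1 is shortened. Thus exceptional NE-diagonals touch at most
-- the first free position, and the mixed pairs r l that are cancelled always carry the true
-- weights.
theorem exNE_le : ∀ i ∈ I, i ≤ p + 1 := by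
  intro i hi
  obtain ⟨h1, h2, h3⟩ := h.exNE i hi
  rcases h3 with rfl | h3
  · omega
  · by_cases hi1 : i = 1
    · omega
    · have := hs (i - 1) (by omega) (by omega)
      omega

include h hK ht in
theorem le_exSE : ∀ j ∈ J, p + K + 1 ≤ j := by
  intro j hj
  obtain ⟨h1, h2, h3⟩ := h.exSE j hj
  rcases h3 with rfl | h3
  · omega
  · by_cases hj1 : j = n + 1
    · omega
    · have := ht (j + 1) (by omega) (by omega)
      omega

include hK hs ht in
/-- There are no trees with three equal adjacent entries in the bottom row. -/
theorem not_isTotalTree_of_triple {a : ℕ → ℤ} {j : ℕ} (h1 : p < j) (h2 : j + 2 ≤ p + K)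
    (h3 : a j = a (j + 1)) (h4 : a (j + 1) = a (j + 2)) (m : ℕ → ℕ → ℤ) :
    ¬ IsTotalTree n (fun j => s j - 1) (fun j => t (j + 1) - 1) (innerB s t b a) m := by
  intro hm
  obtain ⟨n, rfl⟩ : ∃ k, n = k + 1 := ⟨n - 1, by omega⟩
  have hreg : ∀ i, p < i → i + 1 ≤ p + K →
      Regular (n + 1) (fun j => s j - 1) (fun j => t (j + 1) - 1) n i := by
    intro i hi1 hi2
    have e1 := hs i (by omega) (by omega)
    have e2 := hs (i + 1) (by omega) (by omega)
    have e3 := ht (i + 1) (by omega) (by omega)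
    have e4 := ht (i + 1 + 1) (by omega) (by omega)
    refine ⟨?_, cell_last_iff.2 ?_, cell_last_iff.2 ?_⟩
    · simp only [Cell]
      rw [show n + 1 + i - n = i + 1 by omega]
      omega
    · omega
    · omega
  have hv := fun i (hi1 : p < i) (hi2 : i ≤ p + K) => isTotalTree_entry hs ht hK hm hi1 hi2
  -- The two regular entries above the triple are squeezed to its common value, but they must be
  -- distinct.
  have r1 := hm.le n j (hreg j h1 (by omega))
  have r2 := hm.le n (j + 1) (hreg (j + 1) (by omega) (by omega))
  have r3 := hm.ne n j (hreg j h1 (by omega)) (hreg (j + 1) (by omega) (by omega))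
  have v1 := hv j h1 (by omega)
  have v2 := hv (j + 1) (by omega) (by omega)
  have v3 := hv (j + 1 + 1) (by omega) (by omega)
  have h4' : a (j + 1) = a (j + 1 + 1) := h4
  omega

end

/-! ### The induction on the order. -/

section Main

variable {R : Type*} [CommRing R] {u v : R}

theorem isTotalTree_one_iff {s t : ℕ → ℕ} {b : ℕ → ℤ} (hs : s 1 = 0) (ht : t 1 = 0)
    (m : ℕ → ℕ → ℤ) :
    IsTotalTree 1 s t b m ↔ m = fun i j => if i = 1 ∧ j = 1 then b 1 else 0 := by
  have hc : ∀ i j, Cell 1 s t i j ↔ i = 1 ∧ j = 1 := by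
    intro i j
    constructor
    · rintro ⟨h1, h2, h3, -⟩; omega
    · rintro ⟨rfl, rfl⟩
      exact ⟨le_rfl, le_rfl, le_rfl, by omega, by simp [ht]⟩
  have hr : ∀ i j, ¬ Regular 1 s t i j := by
    rintro i j ⟨h1, h2, h3⟩
    rw [hc] at h1 h2
    omega
  constructor
  · intro hm
    funext i j
    split_ifs with h
    · obtain ⟨rfl, rfl⟩ := h
      have := hm.bottomNE 1 le_rfl le_rfl ht
      rwa [hs] at this
    · exact hm.eq_zero i j (by rwa [hc])
  · rintro rfl
    refine ⟨fun i j h => if_neg (by rwa [hc] at h), fun i j h => absurd h (hr i j),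
      fun i j h => absurd h (hr i j), fun j h1 h2 _ => ?_, fun j h1 h2 _ => ?_⟩
    · obtain rfl : j = 1 := by omega
      simp [hs]
    · obtain rfl : j = 1 := by omega
      simp [ht]

theorem pairPart_one : pairPart u v 1 = 1 := by
  simp [pairPart, pairProd]

/-- The weighted enumeration of trees as a constant term, where the entry of the top cell is
weighted by `ω`. -/
theorem finsum_isTotalTree {τ : ℕ → Laurent R} (hτ : Expandable τ) (ω : ℤ → R) (d mn mx : ℤ)
    (C : Prop) (hbase : ∀ β, mn ≤ β → β ≤ mx → ∀ P Q : Prop, (C ∨ ¬ P ∧ ¬ Q) →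
      constTerm ((diagFac u v 0 0 (d + β) P Q 1 : Laurent R) * τ 1) = ω β)
    (n : ℕ) (hn : 1 ≤ n) (s t : ℕ → ℕ) (I J : Finset ℕ) (b : ℕ → ℤ)
    (h : Admissible u v n s t I J b) (hmn : mn ≤ b 1) (hmx : b n ≤ mx)
    (hC : C ∨ ¬ (1 ∈ I ∧ 1 + s 1 = n) ∧ ¬ (n ∈ J ∧ 1 + t n = n)) :
    {m | IsTotalTree n s t b m}.Finite ∧
      ∑ᶠ m ∈ {m | IsTotalTree n s t b m}, treeWeight u v n s t I J m * ω (m 1 1) =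
        constTerm (treeExpr u v d τ n s t I J b) := by
  induction n, hn using Nat.le_induction generalizing s t I J b with
  | base =>
    obtain ⟨j, hj⟩ := h.row 1 le_rfl le_rfl
    have hj' := cell_last_iff.1 hj
    obtain rfl : j = 1 := by omega
    have hset : {m | IsTotalTree 1 s t b m} =
        {fun i j => if i = 1 ∧ j = 1 then b 1 else 0} := by
      ext m
      exact isTotalTree_one_iff hj'.2.2.1 hj'.2.2.2 m
    rw [hset]
    refine ⟨Set.finite_singleton _, ?_⟩
    rw [finsum_mem_singleton, treeExpr, Finset.Icc_self, Finset.prod_singleton, pairPart_one,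
      one_mul, hj'.2.2.1, hj'.2.2.2, hbase (b 1) hmn hmx]
    · have hr : ∀ j, ¬ Regular 1 s t 0 j := by
        rintro j ⟨⟨h1, h2, -⟩, -⟩; omega
      simp [treeWeight, cellWeight, hr]
    · simpa [hj'.2.2.1, hj'.2.2.2] using hC
  | succ n hn ih =>
    obtain ⟨p, K, hK, hs, ht⟩ := h.exists_bounds
    have hI := exNE_le h hs
    have hJ := le_exSE h hK ht
    -- The second alternative covers rows outside `rows`; it is used for `h3`.
    have IH : ∀ a, Interlaces b p (p + K) a → (a ∈ rows b p K ∨ (u = 1 ∧ v = 1)) →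
        {m | IsTotalTree n (fun j => s j - 1) (fun j => t (j + 1) - 1)
          (innerB s t b a) m}.Finite ∧
        ∑ᶠ m ∈ {m | IsTotalTree n (fun j => s j - 1) (fun j => t (j + 1) - 1)
          (innerB s t b a) m}, treeWeight u v n (fun j => s j - 1) (fun j => t (j + 1) - 1)
            (innerI s I) (innerJ t J) m * ω (m 1 1) =
        constTerm (outerExpr u v d τ n s t I J b p K *
          ∏ j ∈ Finset.Ioc p (p + K), e R j (a j)) := by
      intro a ha hab
      rw [← treeExpr_inner hs ht hK]
      refine ih _ _ _ _ _ (h.inner hK hs ht ha hab)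
        (hmn.trans (innerB_bounds h hs ht ha le_rfl hn).1)
        ((innerB_bounds h hs ht ha hn le_rfl).2.trans hmx) ?_
      -- Without `C`, the top cell must not be the bottom of an exceptional diagonal. This passes to
      -- the smaller tree because deletion lengths and order drop together.
      refine hC.imp_right fun hC => ⟨fun hI' => hC.1 ?_, fun hJ' => hC.2 ?_⟩
      · rw [mem_innerI] at hI'
        exact ⟨hI'.1.1, by omega⟩
      · rw [mem_innerJ] at hJ'
        exact ⟨hJ'.1.1, by omega⟩
    have IHr := fun a (ha : a ∈ rows b p K) => IH a ((mem_rows _ _ _ _).1 ha).2.1 (Or.inl ha)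
    have hle : ∀ j, p < j → j ≤ p + K →
        b j < b (j + 1) ∨ (u = 1 ∧ v = 1 ∧ b j ≤ b (j + 1)) := by
      intro j h1 h2
      rcases h.bottom with hb | ⟨hu, hv, hb⟩
      · exact Or.inl (hb ⟨by omega, by omega⟩ ⟨by omega, by omega⟩ (by omega))
      · exact Or.inr ⟨hu, hv, hb ⟨by omega, by omega⟩ ⟨by omega, by omega⟩ (by omega)⟩
    have h3 : ∀ a, Interlaces b p (p + K) a →
        (∃ j, p < j ∧ j + 2 ≤ p + K ∧ a j = a (j + 1) ∧ a (j + 1) = a (j + 2)) →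
        constTerm (outerExpr u v d τ n s t I J b p K *
          ∏ j ∈ Finset.Ioc p (p + K), e R j (a j)) = 0 := by
      rintro a ha ⟨j, h1, h2, h3, h4⟩
      rcases hle (j + 1) (by omega) (by omega) with hlt | ⟨hu, hv, -⟩
      · have a1 := ha j h1 (by omega)
        have a2 := ha (j + 1) (by omega) (by omega)
        have a3 := ha (j + 2) (by omega) (by omega)
        have : b (j + 1 + 1) = b (j + 2) := rfl
        omega
      -- The constant term counts trees whose bottom row contains a triple, and there are none.
      · rw [← (IH a ha (Or.inr ⟨hu, hv⟩)).2]
        have : {m | IsTotalTree n (fun j => s j - 1) (fun j => t (j + 1) - 1)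
            (innerB s t b a) m} = ∅ :=
          Set.eq_empty_iff_forall_notMem.2
            (not_isTotalTree_of_triple hK hs ht h1 h2 h3 h4)
        rw [this, finsum_mem_empty]
    have hinj : ∀ a, Set.InjOn (addRow n s t b)
        {m | IsTotalTree n (fun j => s j - 1) (fun j => t (j + 1) - 1) (innerB s t b a) m} := by
      intro a m hm m' hm' heq
      funext i j
      by_cases hi : i = n + 1
      · rw [IsTotalTree.eq_zero hm i j fun hc => by have := hc.le; omega,
          IsTotalTree.eq_zero hm' i j fun hc => by have := hc.le; omega]
      · have := congrFun (congrFun heq i) j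
        rwa [addRow, addRow, if_neg hi, if_neg hi] at this
    -- The row `a` can be read off from row n of the tree.
    have hdisj : (rows b p K : Set (ℕ → ℤ)).PairwiseDisjoint fun a => addRow n s t b ''
        {m | IsTotalTree n (fun j => s j - 1) (fun j => t (j + 1) - 1) (innerB s t b a) m} := by
      intro a ha a' ha' hne
      rw [Function.onFun, Set.disjoint_left]
      rintro _ ⟨m, hm, rfl⟩ ⟨m', hm', heq⟩
      apply hne
      rw [Finset.mem_coe, mem_rows] at ha ha'
      funext j
      by_cases hj : p < j ∧ j ≤ p + K
      · rw [← isTotalTree_entry hs ht hK hm hj.1 hj.2, ← isTotalTree_entry hs ht hK hm' hj.1 hj.2]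
        have := congrFun (congrFun heq n) j
        rw [addRow, addRow, if_neg (by omega), if_neg (by omega)] at this
        exact this.symm
      · rw [ha.1 j hj, ha'.1 j hj]
    have hfin : ∀ a ∈ (rows b p K : Set (ℕ → ℤ)), (addRow n s t b ''
        {m | IsTotalTree n (fun j => s j - 1) (fun j => t (j + 1) - 1)
          (innerB s t b a) m}).Finite := fun a ha => (IHr a ha).1.image _
    rw [setOf_isTotalTree_succ hs ht hK]
    refine ⟨(Finset.finite_toSet _).biUnion hfin, ?_⟩
    rw [finsum_mem_biUnion hdisj (Finset.finite_toSet _) hfin, finsum_mem_coe_finset,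
      constTerm_treeExpr_succ hs ht hK hI hJ hτ hn,
      ← constTerm_mul_rowSum hle hI hJ (outerExpr_swap hK hτ) h3, rowSum, Finset.mul_sum,
      constTerm_sum]
    refine Finset.sum_congr rfl fun a ha => ?_
    rw [finsum_mem_image (hinj a)]
    simp only [entryTerm, Finset.prod_mul_distrib, ← map_prod]
    rw [mul_left_comm, constTerm_C_mul, ← (IHr a ha).2, mul_finsum_mem' _ _ (IHr a ha).1]
    refine finsum_mem_congr rfl fun m hm => ?_
    rw [treeWeight_addRow hs ht hK u v I J hm, mul_assoc]
    congr 3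
    exact if_neg (by omega)

end Main

end STTree

namespace STTree

/-! ### Complete homogeneous symmetric factors -/

section Homogeneous

variable {A : Type*} [CommRing A]

/-- The complete homogeneous symmetric polynomial of degree `k` in `g 1, …, g n`. -/
noncomputable def homog (g : ℕ → A) (k n : ℕ) : A :=
  PowerSeries.coeff k (∏ i ∈ Finset.Icc 1 n, PowerSeries.mk fun m => g i ^ m)

theorem map_homog {B : Type*} [CommRing B] (φ : A →+* B) (g : ℕ → A) (k n : ℕ) :
    φ (homog g k n) = homog (fun i => φ (g i)) k n := by
  rw [homog, ← PowerSeries.coeff_map, map_prod, homog]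
  congr 1
  refine Finset.prod_congr rfl fun i _ => ?_
  ext m
  simp

theorem homog_swap (g : ℕ → A) (k n j : ℕ) (h1 : 1 ≤ j) (h2 : j + 1 ≤ n) :
    homog (fun i => g (Equiv.swap j (j + 1) i)) k n = homog g k n := by
  unfold homog
  congr 1
  refine Finset.prod_equiv (Equiv.swap j (j + 1)) (fun i => ?_) fun _ _ => rfl
  simp only [Finset.mem_Icc, Equiv.swap_apply_def]
  split_ifs <;> omega

theorem homog_one (g : ℕ → A) (k : ℕ) : homog g k 1 = g 1 ^ k := by
  simp [homog]

/-- Omitting g_m multiplies the generating function by 1 - g_m z. The factor `PowerSeries.X` encodes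
degree k - 1 and gives 0 for k = 0. -/
theorem homog_skip (g : ℕ → A) (k n m : ℕ) (hm : m ∈ Finset.Icc 1 (n + 1)) :
    homog (fun i => g (skip m i)) k n = homog g k (n + 1) - g m * PowerSeries.coeff k
      (PowerSeries.X * ∏ i ∈ Finset.Icc 1 (n + 1), PowerSeries.mk fun m => g i ^ m) := by
  have hG : (PowerSeries.mk fun k => g m ^ k) * (1 - PowerSeries.C (g m) * PowerSeries.X) = 1 := by
    ext k
    rw [mul_sub, mul_one, map_sub, mul_left_comm, PowerSeries.coeff_C_mul, PowerSeries.coeff_one]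
    cases k with
    | zero => simp
    | succ k =>
      rw [PowerSeries.coeff_succ_mul_X, PowerSeries.coeff_mk, PowerSeries.coeff_mk, if_neg (by omega)]
      ring
  have hP : ∏ i ∈ Finset.Icc 1 n, PowerSeries.mk (fun k => g (skip m i) ^ k) =
      (∏ i ∈ Finset.Icc 1 (n + 1), PowerSeries.mk fun m => g i ^ m) - PowerSeries.C (g m) *
        (PowerSeries.X * ∏ i ∈ Finset.Icc 1 (n + 1), PowerSeries.mk fun m => g i ^ m) := by
    rw [prod_Icc_succ_skip n m hm]
    linear_combination (-∏ i ∈ Finset.Icc 1 n, PowerSeries.mk (fun k => g (skip m i) ^ k)) * hG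
  rw [homog, hP, map_sub, PowerSeries.coeff_C_mul, homog]

/-- In the correction from `homog_skip`, g_m completes the product of the other g_j to the product
of all. It no longer depends on m, so `sum_pairProd_sub_skip` annihilates it. -/
theorem pairProd_mul_homog (g : ℕ → A) (k n : ℕ) (hn : 1 ≤ n) :
    pairProd (n + 1) (fun i j => g j - g i) * homog g k (n + 1) =
      ∑ m ∈ Finset.Icc 1 (n + 1), (-1) ^ (m + 1) * ((∏ j ∈ Finset.Icc 1 n, g (skip m j)) *
        pairProd n (fun i j => g (skip m j) - g (skip m i)) *
          homog (fun i => g (skip m i)) k n) := by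
  have h0 := sum_pairProd_sub_skip n hn g
  set c := PowerSeries.coeff k
    (PowerSeries.X * ∏ i ∈ Finset.Icc 1 (n + 1), PowerSeries.mk fun m => g i ^ m) with hc
  have : ∀ m ∈ Finset.Icc 1 (n + 1), (-1) ^ (m + 1) * ((∏ j ∈ Finset.Icc 1 n, g (skip m j)) *
        pairProd n (fun i j => g (skip m j) - g (skip m i)) *
          homog (fun i => g (skip m i)) k n) =
      (-1) ^ (m + 1) * ((∏ j ∈ Finset.Icc 1 n, g (skip m j)) *
        pairProd n (fun i j => g (skip m j) - g (skip m i))) * homog g k (n + 1) -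
      (-1) ^ (m + 1) * pairProd n (fun i j => g (skip m j) - g (skip m i)) *
        (c * ∏ i ∈ Finset.Icc 1 (n + 1), g i) := by
    intro m hm
    rw [homog_skip g k n m hm, ← hc, prod_Icc_succ_skip n m hm g]
    ring
  rw [Finset.sum_congr rfl this, Finset.sum_sub_distrib, ← Finset.sum_mul, ← Finset.sum_mul, h0,
    zero_mul, sub_zero, pairProd_sub_succ]

end Homogeneous

section Top

variable {R : Type*} [CommRing R]

theorem expandable_one : Expandable (fun _ => (1 : Laurent R)) where
  symm := fun n k _ _ => map_one _
  expand := by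
    intro n _
    simp only [map_one, mul_one]
    exact pairProd_sub_succ n (y R)

theorem expandable_homog (k : ℕ) : Expandable (fun n => homog (y R) k n) where
  symm := by
    intro n j h1 h2
    rw [map_homog]
    simp only [rename_y]
    exact homog_swap (y R) k n j h1 h2
  expand := by
    intro n hn
    rw [pairProd_mul_homog (y R) k n hn]
    refine Finset.sum_congr rfl fun m _ => ?_
    rw [map_homog]
    simp only [rename_y]

theorem Expandable.sum {ι : Type*} (S : Finset ι) (c : ι → R) {τ : ι → ℕ → Laurent R}
    (h : ∀ i ∈ S, Expandable (τ i)) :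
    Expandable (fun n => ∑ i ∈ S, HahnSeries.C (c i) * τ i n) where
  symm := by
    intro n k h1 h2
    rw [map_sum]
    refine Finset.sum_congr rfl fun i hi => ?_
    rw [map_mul, rename_C, (h i hi).symm n k h1 h2]
  expand := by
    intro n hn
    simp only [map_sum, map_mul, rename_C, Finset.mul_sum]
    rw [Finset.sum_comm]
    refine Finset.sum_congr rfl fun i hi => ?_
    rw [mul_left_comm, (h i hi).expand n hn, Finset.mul_sum]
    refine Finset.sum_congr rfl fun m _ => ?_
    ring

/-- The factor of `topFactor` that is a symmetric polynomial in the inverses of the variables. -/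
noncomputable def topSymm (R : Type*) [CommRing R] (a mn mx : ℤ) (n : ℕ) : Laurent R :=
  ∑ k ∈ Finset.range ((mx - mn).toNat + 1),
    HahnSeries.C ((-1) ^ ((a - mn).toNat + k) * (k.choose (a - mn).toNat : R)) * homog (y R) k n

theorem expandable_topSymm (a mn mx : ℤ) : Expandable (topSymm R a mn mx) :=
  Expandable.sum _ _ fun k _ => expandable_homog k

theorem neg_one_zpow_eq {a mn : ℤ} (h : mn ≤ a) (k : ℕ) :
    (((-1) ^ (a + mn + (k : ℤ)) : (Laurent R)ˣ) : Laurent R) = (-1) ^ ((a - mn).toNat + k) := by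
  have h1 : a + mn + (k : ℤ) = (((a - mn).toNat + k : ℕ) : ℤ) + 2 * mn := by
    push_cast
    rw [Int.toNat_of_nonneg (by omega)]
    ring
  rw [h1, zpow_add, zpow_natCast, zpow_mul]
  simp

theorem topFactor_eq (n : ℕ) {a mn : ℤ} (mx : ℤ) (h : mn ≤ a) : topFactor R n a mn mx =
    (∏ i ∈ Finset.Icc 1 n, e R i (-mn)) * topSymm R a mn mx n := by
  rw [topFactor, topSymm, Finset.mul_sum]
  refine Finset.sum_congr rfl fun k _ => ?_
  rw [Units.val_mul, neg_one_zpow_eq h, Units.coe_prod, homog]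
  simp only [map_mul, map_pow, map_neg, map_one, map_natCast, Units.val_pow_eq_pow_val]
  simp only [e, y]
  ring

theorem constTerm_e_mul_y_pow (N k i : ℕ) : constTerm (e R i N * y R i ^ k) = N.choose k := by
  have h1 : e R i N = (1 + X R i) ^ N := by
    rw [e, zpow_natCast, Units.val_pow_eq_pow_val, val_onePlus, map_one, one_mul]
  have h2 : ∀ j, constTerm (X R i ^ j * y R i ^ k) = if j = k then 1 else 0 := by
    intro j
    have e1 : X R i ^ j = HahnSeries.single (j • Finsupp.single i 1) 1 := by
      rw [X, x, HahnSeries.single_pow, one_pow]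
    have e2 : y R i ^ k = HahnSeries.single (k • Finsupp.single i (-1)) 1 := by
      change (HahnSeries.single (Finsupp.single i (-1)) (1 : R)) ^ k = _
      rw [HahnSeries.single_pow, one_pow]
    rw [e1, e2, HahnSeries.single_mul_single, constTerm]
    split_ifs with hjk
    · subst hjk
      rw [Finsupp.smul_single, Finsupp.smul_single, ← Finsupp.single_add]
      simp
    · apply HahnSeries.coeff_single_of_ne
      intro h0
      have := DFunLike.congr_fun h0 i
      simp at this
      omega
  rw [h1, add_comm, add_pow, Finset.sum_mul, constTerm_sum]
  have h3 : ∀ j ∈ Finset.range (N + 1), constTerm (X R i ^ j * 1 ^ (N - j) *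
      (N.choose j : Laurent R) * y R i ^ k) = if j = k then (N.choose j : R) else 0 := by
    intro j _
    have : X R i ^ j * 1 ^ (N - j) * (N.choose j : Laurent R) * y R i ^ k =
        HahnSeries.C (N.choose j : R) * (X R i ^ j * y R i ^ k) := by
      rw [map_natCast, one_pow]; ring
    rw [this, constTerm_C_mul, h2]
    split_ifs <;> simp
  rw [Finset.sum_congr rfl h3, Finset.sum_ite_eq']
  split_ifs with h
  · rfl
  · rw [Nat.choose_eq_zero_of_lt (by rw [Finset.mem_range] at h; omega), Nat.cast_zero]

/-- Binomial inversion: binom(N,k) binom(k,α) = binom(N,α) binom(N-α,k-α) reduces it to the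
alternating sum of a row of Pascal's triangle. -/
theorem sum_neg_one_pow_choose_mul_choose (N α M : ℕ) (h : N ≤ M) :
    ∑ k ∈ Finset.range (M + 1), (-1 : ℤ) ^ (α + k) * (k.choose α) * (N.choose k) =
      if N = α then 1 else 0 := by
  have h1 : ∑ k ∈ Finset.range (M + 1), (-1 : ℤ) ^ (α + k) * (k.choose α) * (N.choose k) =
      ∑ k ∈ Finset.range (N + 1), (-1 : ℤ) ^ (α + k) * (k.choose α) * (N.choose k) := by
    symm
    apply Finset.sum_subset
    · intro k; simp only [Finset.mem_range]; omega
    · intro k _ hk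
      rw [Nat.choose_eq_zero_of_lt (by rw [Finset.mem_range] at hk; omega : N < k)]
      simp
  rw [h1]
  by_cases hα : α ≤ N
  · rw [Finset.range_eq_Ico, ← Finset.sum_Ico_consecutive _ (Nat.zero_le α) (by omega : α ≤ N + 1),
      Finset.sum_eq_zero, zero_add, Finset.sum_Ico_eq_sum_range]
    · have h2 : ∀ j ∈ Finset.range (N + 1 - α), (-1 : ℤ) ^ (α + (α + j)) *
          ((α + j).choose α) * (N.choose (α + j)) =
          N.choose α * ((-1) ^ j * ((N - α).choose j)) := by
        intro j hj
        rw [Finset.mem_range] at hj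
        have h3 := Nat.choose_mul (n := N) (k := α + j) (s := α) (by omega)
        rw [Nat.add_sub_cancel_left] at h3
        have h4 : (N.choose (α + j) : ℤ) * ((α + j).choose α) =
            N.choose α * ((N - α).choose j) := by exact_mod_cast h3
        have h5 : (-1 : ℤ) ^ (α + (α + j)) = (-1) ^ j := by
          rw [← add_assoc, pow_add, ← two_mul, pow_mul]; simp
        rw [h5]
        linear_combination (-1) ^ j * h4
      rw [Finset.sum_congr rfl h2, ← Finset.mul_sum, show N + 1 - α = N - α + 1 by omega,
        Int.alternating_sum_range_choose]
      by_cases hN : N = α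
      · subst hN; simp
      · rw [if_neg (by omega), if_neg hN, mul_zero]
    · intro k hk
      rw [Finset.mem_Ico] at hk
      rw [Nat.choose_eq_zero_of_lt hk.2]
      simp
  · rw [if_neg (by omega)]
    apply Finset.sum_eq_zero
    intro k hk
    rw [Finset.mem_range] at hk
    rw [Nat.choose_eq_zero_of_lt (by omega : k < α)]
    simp

/-- The shift by `mn` makes the exponent N = β - mn non-negative, so the constant terms are
binomials binom(N,k); β ≤ mx ensures that k runs at least up to N. -/
theorem constTerm_e_mul_topSymm {a mn mx β : ℤ} (ha : mn ≤ a) (h1 : mn ≤ β) (h2 : β ≤ mx) :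
    constTerm (e R 1 (-mn + β) * topSymm R a mn mx 1) = if β = a then 1 else 0 := by
  obtain ⟨N, hN⟩ : ∃ N : ℕ, -mn + β = N := ⟨(-mn + β).toNat, by omega⟩
  rw [hN, topSymm, Finset.mul_sum, constTerm_sum]
  have h3 : ∀ k ∈ Finset.range ((mx - mn).toNat + 1), constTerm (e R 1 N *
      (HahnSeries.C ((-1) ^ ((a - mn).toNat + k) * (k.choose (a - mn).toNat : R)) *
        homog (y R) k 1)) =
      ((((-1 : ℤ) ^ ((a - mn).toNat + k) * (k.choose (a - mn).toNat) * (N.choose k) : ℤ)) : R) := by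
    intro k _
    rw [mul_left_comm, constTerm_C_mul, homog_one, constTerm_e_mul_y_pow]
    push_cast
    ring
  rw [Finset.sum_congr rfl h3, ← Int.cast_sum,
    sum_neg_one_pow_choose_mul_choose N _ _ (by omega)]
  by_cases h : β = a
  · rw [if_pos (by omega), if_pos h]; simp
  · rw [if_neg (by omega), if_neg h]; simp

theorem constTerm_diagFac_zero (u v : R) (z : ℤ) (P Q : Prop) (j : ℕ) :
    constTerm (diagFac u v 0 0 z P Q j : Laurent R) = 1 := by
  have := constTerm_eq_of_agreeAtZero (diagFac_agreeAtZero u v 0 0 z P Q j)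
  rwa [if_pos ⟨rfl, rfl⟩, constTerm_one] at this

end Top

/-! ### The constant term expression -/

section Expression

variable {R : Type*} [CommRing R]

theorem pairProd_mul_self {A : Type*} [CommRing A] (n : ℕ) (f : ℕ → A) :
    pairProd n (fun i j => f i * f j) = ∏ i ∈ Finset.Icc 1 n, f i ^ (n - 1) := by
  induction n with
  | zero => simp [pairProd]
  | succ n ih =>
    rw [pairProd_succ_skip n (n + 1) (by simp), prod_Icc_succ_skip n (n + 1) (by simp)]
    have hsk : ∀ j ∈ Finset.Icc 1 n, skip (n + 1) j = j := by
      intro j hj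
      rw [Finset.mem_Icc] at hj
      exact if_pos (by omega)
    have h1 : ∏ j ∈ Finset.Icc 1 n, (if j < n + 1 then f (skip (n + 1) j) * f (n + 1)
        else f (n + 1) * f (skip (n + 1) j)) = (∏ j ∈ Finset.Icc 1 n, f j) * f (n + 1) ^ n := by
      have : ∀ j ∈ Finset.Icc 1 n, (if j < n + 1 then f (skip (n + 1) j) * f (n + 1)
        else f (n + 1) * f (skip (n + 1) j)) = f j * f (n + 1) := by
        intro j hj
        rw [hsk j hj, if_pos (by rw [Finset.mem_Icc] at hj; omega)]
      rw [Finset.prod_congr rfl this, Finset.prod_mul_distrib, Finset.prod_const, Nat.card_Icc,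
        Nat.add_sub_cancel]
    have h2 : pairProd n (fun i j => f (skip (n + 1) i) * f (skip (n + 1) j)) =
        pairProd n (fun i j => f i * f j) := by
      apply pairProd_congr
      intro i j h1 h2 h3
      rw [hsk i (Finset.mem_Icc.2 ⟨h1, by omega⟩), hsk j (Finset.mem_Icc.2 ⟨by omega, h3⟩)]
    rw [h1, h2, ih, Nat.add_sub_cancel, mul_comm _ (f (n + 1) ^ n), mul_assoc,
      ← Finset.prod_mul_distrib]
    congr 1
    refine Finset.prod_congr rfl fun j hj => ?_
    rw [hsk j hj]
    obtain ⟨k, rfl⟩ : ∃ k, n = k + 1 := ⟨n - 1, by rw [Finset.mem_Icc] at hj; omega⟩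
    rw [Nat.add_sub_cancel, pow_succ, mul_comm]

/-- Uses x_i - x_j = (y_j - y_i) x_i x_j; each variable occurs in n - 1 pairs. -/
theorem prod_x_mul_pairProd (n : ℕ) (G : ℕ → ℕ → Laurent R) :
    ((∏ i ∈ Finset.Icc 1 n, x i ^ (-(n : ℤ) + 1) : (Laurent R)ˣ) : Laurent R) *
      pairProd n (fun i j => (X R i - X R j) * G i j) =
    pairProd n G * pairProd n (fun i j => y R j - y R i) := by
  have h1 : pairProd n (fun i j => X R i - X R j) =
      pairProd n (fun i j => y R j - y R i) * ∏ i ∈ Finset.Icc 1 n, X R i ^ (n - 1) := by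
    rw [← pairProd_mul_self, ← pairProd_mul]
    congr 1
    funext i j
    linear_combination (-X R i) * X_mul_y (R := R) j + X R j * X_mul_y (R := R) i
  have h2 : ((∏ i ∈ Finset.Icc 1 n, x i ^ (-(n : ℤ) + 1) : (Laurent R)ˣ) : Laurent R) *
      ∏ i ∈ Finset.Icc 1 n, X R i ^ (n - 1) = 1 := by
    rw [Units.coe_prod, ← Finset.prod_mul_distrib]
    apply Finset.prod_eq_one
    intro i hi
    rw [Finset.mem_Icc] at hi
    rw [show -(n : ℤ) + 1 = -((n - 1 : ℕ) : ℤ) by omega, zpow_neg, zpow_natCast,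
      ← Units.val_pow_eq_pow_val, Units.inv_mul]
  rw [pairProd_mul, h1]
  linear_combination (pairProd n (fun i j => y R j - y R i) * pairProd n G) * h2

theorem prod_eq_prod_Icc_ite {M : Type*} [CommMonoid M] {n : ℕ} (S : Finset ℕ)
    (hS : ∀ i ∈ S, i ∈ Finset.Icc 1 n) (f : ℕ → M) :
    ∏ i ∈ S, f i = ∏ i ∈ Finset.Icc 1 n, if i ∈ S then f i else 1 := by
  rw [← Finset.prod_filter]
  refine Finset.prod_congr ?_ fun _ _ => rfl
  ext i
  rw [Finset.mem_filter]
  exact ⟨fun h => ⟨hS i h, h⟩, fun h => h.2⟩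

/-- The deletion lengths of all NE-diagonals. -/
def fullS (l : ℕ) (s : ℕ → ℕ) (j : ℕ) : ℕ := if 1 ≤ j ∧ j ≤ l then s j else 0

/-- The deletion lengths of all SE-diagonals. -/
def fullT (n r : ℕ) (t : ℕ → ℕ) (j : ℕ) : ℕ := if n - r + 1 ≤ j ∧ j ≤ n then t j else 0

theorem integrand_mul_exFactor {u v : R} {n l r : ℕ} {s t : ℕ → ℕ} {b : ℕ → ℤ} (hlr : l + r ≤ n)
    {I J : Finset ℕ} (hI : ∀ i ∈ I, i ∈ Finset.Icc 1 n) (hJ : ∀ j ∈ J, j ∈ Finset.Icc 1 n) :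
    integrand n l r s t b u v * exFactor I J u v =
      treeExpr u v 0 (fun _ => 1) n (fullS l s) (fullT n r t) I J b := by
  classical
  rw [integrand, exFactor, treeExpr, prod_Ioc_eq_pairProd, Finset.prod_mul_distrib]
  have h1 : ∏ i ∈ Finset.Icc 1 l, (x i / vFactor v i : (Laurent R)ˣ) ^ s i =
      ∏ i ∈ Finset.Icc 1 n, (x i / vFactor v i : (Laurent R)ˣ) ^ fullS l s i := by
    rw [prod_eq_prod_Icc_ite (n := n) _ (fun i hi => by rw [Finset.mem_Icc] at hi ⊢; omega)]
    refine Finset.prod_congr rfl fun i _ => ?_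
    simp only [Finset.mem_Icc, fullS]
    split_ifs <;> simp
  have h2 : ∏ i ∈ Finset.Icc (n - r + 1) n, (x i / onePlus u i : (Laurent R)ˣ) ^ t i =
      ∏ i ∈ Finset.Icc 1 n, (x i / onePlus u i : (Laurent R)ˣ) ^ fullT n r t i := by
    rw [prod_eq_prod_Icc_ite (n := n) _ (fun i hi => by rw [Finset.mem_Icc] at hi ⊢; omega)]
    refine Finset.prod_congr rfl fun i _ => ?_
    simp only [Finset.mem_Icc, fullT]
    split_ifs <;> simp
  rw [h1, h2, prod_eq_prod_Icc_ite I hI, prod_eq_prod_Icc_ite J hJ]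
  have h3 : ∏ i ∈ Finset.Icc 1 n, (diagFac u v (fullS l s i) (fullT n r t i) (0 + b i)
      (i ∈ I) (i ∈ J) i : Laurent R) = (((∏ i ∈ Finset.Icc 1 n, (x i / vFactor v i) ^ fullS l s i) *
      (∏ i ∈ Finset.Icc 1 n, (x i / onePlus u i) ^ fullT n r t i) *
      (∏ i ∈ Finset.Icc 1 n, onePlus 1 i ^ b i) *
      (∏ i ∈ Finset.Icc 1 n, if i ∈ I then (onePlus (1 - v) i)⁻¹ else 1) *
      ∏ i ∈ Finset.Icc 1 n, if i ∈ J then onePlus 1 i / onePlus u i else 1 : (Laurent R)ˣ) :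
        Laurent R) := by
    rw [← Finset.prod_mul_distrib, ← Finset.prod_mul_distrib, ← Finset.prod_mul_distrib,
      ← Finset.prod_mul_distrib, Units.coe_prod]
    refine Finset.prod_congr rfl fun i _ => ?_
    rw [diagFac, zero_add]
    congr!
  rw [h3, pairPart, mul_one]
  have h4 := prod_x_mul_pairProd n (pairFac u v)
  simp only [Units.val_mul]
  simp only [pairFac] at h4 ⊢
  rw [← h4]
  ring

/-- The powers (1 + x_i)^{-mn} of the top factor are absorbed as a shift of all bottom entries; the
rest is symmetric. -/
theorem integrand_mul_exFactor_mul_topFactor {u v : R} {n l r : ℕ} {s t : ℕ → ℕ} {b : ℕ → ℤ}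
    (hlr : l + r ≤ n) {I J : Finset ℕ} (hI : ∀ i ∈ I, i ∈ Finset.Icc 1 n)
    (hJ : ∀ j ∈ J, j ∈ Finset.Icc 1 n) {a mn : ℤ} (mx : ℤ) (ha : mn ≤ a) :
    integrand n l r s t b u v * exFactor I J u v * topFactor R n a mn mx =
      treeExpr u v (-mn) (topSymm R a mn mx) n (fullS l s) (fullT n r t) I J b := by
  rw [integrand_mul_exFactor hlr hI hJ, topFactor_eq n mx ha, treeExpr, treeExpr]
  have : ∏ i ∈ Finset.Icc 1 n, (diagFac u v (fullS l s i) (fullT n r t i) (-mn + b i)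
      (i ∈ I) (i ∈ J) i : Laurent R) = (∏ i ∈ Finset.Icc 1 n, e R i (-mn)) *
      ∏ i ∈ Finset.Icc 1 n, (diagFac u v (fullS l s i) (fullT n r t i) (0 + b i)
      (i ∈ I) (i ∈ J) i : Laurent R) := by
    rw [← Finset.prod_mul_distrib]
    refine Finset.prod_congr rfl fun i _ => ?_
    simp only [diagFac, e, zero_add, zpow_add, Units.val_mul]
    ring
  rw [this]
  ring

theorem exFactor_empty (u v : R) : exFactor ∅ ∅ u v = 1 := by
  simp [exFactor]

end Expression

end STTree

namespace STTree

/-! ### Trees of the given shape and total arrays -/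

section Bottom

variable {n : ℕ} {s t : ℕ → ℕ} (hs : AntitoneOn s (Set.Icc 1 n))
  (ht : MonotoneOn t (Set.Icc 1 n)) (hrow : ∀ i, 1 ≤ i → i ≤ n → ∃ j, Cell n s t i j)

include hrow in
theorem cell_one_one (hn : 1 ≤ n) : Cell n s t 1 1 := by
  obtain ⟨j, hj⟩ := hrow 1 le_rfl hn
  obtain rfl : j = 1 := by have := hj.1; have := hj.2.1; omega
  exact hj

include hs ht hrow

/-- The row below the claimed bottom cell keeps some cell k. It lies to the right of position j,
since there `s` has deleted everything up to j. Its SE-diagonal is therefore not before the one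
through the claimed cell, and monotonicity of `t` shows that the latter is not cut. -/
theorem cell_bottomNE {j : ℕ} (h1 : 1 ≤ j) (h2 : j ≤ n) (h3 : t j = 0) : Cell n s t (n - s j) j := by
  by_cases h0 : s j = 0
  · rw [h0, Nat.sub_zero]
    refine ⟨h1, h2, le_rfl, by omega, ?_⟩
    rw [Nat.add_sub_cancel_left, h3]
    omega
  · have hc := (cell_one_one hrow (h1.trans h2)).2.2.2.1
    have hsj := hs (Set.mem_Icc.2 ⟨le_rfl, h1.trans h2⟩) (Set.mem_Icc.2 ⟨h1, h2⟩) h1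
    obtain ⟨k, k1, k2, k3, k4, k5⟩ := hrow (n - s j + 1) (by omega) (by omega)
    have hjk : j < k := by
      by_contra hkj
      have := hs (Set.mem_Icc.2 ⟨k1, by omega⟩) (Set.mem_Icc.2 ⟨h1, h2⟩) (not_lt.1 hkj)
      omega
    refine ⟨h1, by omega, by omega, by omega, ?_⟩
    have := ht (Set.mem_Icc.2 ⟨by omega, by omega⟩ : n + j - (n - s j) ∈ Set.Icc 1 n)
      (Set.mem_Icc.2 ⟨by omega, by omega⟩ : n + k - (n - s j + 1) ∈ Set.Icc 1 n) (by omega)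
    omega

theorem cell_bottomSE {j : ℕ} (h1 : 1 ≤ j) (h2 : j ≤ n) (h3 : s j = 0) :
    Cell n s t (n - t j) (j - t j) := by
  by_cases h0 : t j = 0
  · rw [h0, Nat.sub_zero, Nat.sub_zero]
    refine ⟨h1, h2, le_rfl, by omega, ?_⟩
    rw [Nat.add_sub_cancel_left, h0]
    omega
  · have hc := (cell_one_one hrow (h1.trans h2)).2.2.2.2
    rw [Nat.add_sub_cancel] at hc
    have htj := ht (Set.mem_Icc.2 ⟨h1, h2⟩) (Set.mem_Icc.2 ⟨h1.trans h2, le_rfl⟩) h2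
    obtain ⟨k, k1, k2, k3, k4, k5⟩ := hrow (n - t j + 1) (by omega) (by omega)
    have hjk : n + k - (n - t j + 1) < j := by
      by_contra hkj
      have := ht (Set.mem_Icc.2 ⟨h1, h2⟩)
        (Set.mem_Icc.2 ⟨by omega, by omega⟩ : n + k - (n - t j + 1) ∈ Set.Icc 1 n) (not_lt.1 hkj)
      omega
    have := hs (Set.mem_Icc.2 ⟨k1, by omega⟩)
      (Set.mem_Icc.2 ⟨by omega, by omega⟩ : j - t j ∈ Set.Icc 1 n) (by omega)
    refine ⟨by omega, by omega, by omega, by omega, ?_⟩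
    rw [show n + (j - t j) - (n - t j) = j by omega]
    omega

variable {S : Finset (ℕ × ℕ)} (hS : ∀ i j, (i, j) ∈ S ↔ Cell n s t i j)

include hS

theorem isBottomNE_iff {j : ℕ} (h1 : 1 ≤ j) (h2 : j ≤ n) (h3 : t j = 0) (c : ℕ × ℕ) :
    IsBottomNE S j c ↔ c = (n - s j, j) := by
  have hc := cell_bottomNE hs ht hrow h1 h2 h3
  constructor
  · rintro ⟨k1, k2, k3⟩
    obtain ⟨i, k⟩ := c
    have k2 : k = j := k2
    subst k2
    have k4 := ((hS _ _).1 k1).2.2.2.1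
    have k5 : n - s k ≤ i := k3 (n - s k, k) ((hS _ _).2 hc) rfl
    rw [show i = n - s k by omega]
  · rintro rfl
    refine ⟨(hS _ _).2 hc, rfl, ?_⟩
    rintro ⟨i, k⟩ hd hk
    have hk : k = j := hk
    subst hk
    have := ((hS _ _).1 hd).2.2.2.1
    change i ≤ n - s k
    omega

theorem isBottomSE_iff {j : ℕ} (h1 : 1 ≤ j) (h2 : j ≤ n) (h3 : s j = 0) (c : ℕ × ℕ) :
    IsBottomSE n S j c ↔ c = (n - t j, j - t j) := by
  have hc := cell_bottomSE hs ht hrow h1 h2 h3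
  have hc1 := hc.1
  have hcell : ∀ i k, (i, k) ∈ S → k + n = i + j → i + t j ≤ n := by
    intro i k hik hk
    have := ((hS _ _).1 hik).2.2.2.2
    rwa [show n + k - i = j by omega] at this
  constructor
  · rintro ⟨k1, k2, k3⟩
    obtain ⟨i, k⟩ := c
    have k2 : k + n = i + j := k2
    have k4 := hcell i k k1 k2
    have k5 : n - t j ≤ i := k3 (n - t j, j - t j) ((hS _ _).2 hc) (by
      change j - t j + n = n - t j + j
      omega)
    rw [show i = n - t j by omega, show k = j - t j by omega]
  · rintro rfl
    refine ⟨(hS _ _).2 hc, ?_, ?_⟩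
    · change j - t j + n = n - t j + j
      omega
    · rintro ⟨i, k⟩ hd hk
      have := hcell i k hd hk
      change i ≤ n - t j
      omega

end Bottom

section Total

variable {S : Finset (ℕ × ℕ)}

open Classical in
/-- Extension of a filling by zero. -/
noncomputable def toTotal (M : Filling S) (i j : ℕ) : ℤ :=
  if h : (i, j) ∈ S then M ⟨(i, j), h⟩ else 0

theorem toTotal_of_mem (M : Filling S) {i j : ℕ} (h : (i, j) ∈ S) :
    toTotal M i j = M ⟨(i, j), h⟩ := dif_pos h

theorem toTotal_injective : Function.Injective (toTotal (S := S)) := by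
  intro M M' h
  funext ⟨⟨i, j⟩, hc⟩
  rw [← toTotal_of_mem M hc, ← toTotal_of_mem M' hc, h]

theorem exists_toTotal_eq {m : ℕ → ℕ → ℤ} (h : ∀ i j, (i, j) ∉ S → m i j = 0) :
    ∃ M : Filling S, toTotal M = m := by
  refine ⟨fun c => m c.1.1 c.1.2, ?_⟩
  funext i j
  by_cases hc : (i, j) ∈ S
  · rw [toTotal_of_mem _ hc]
  · rw [h i j hc]
    exact dif_neg hc

variable {n : ℕ} {s t : ℕ → ℕ} (hS : ∀ i j, (i, j) ∈ S ↔ Cell n s t i j)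

include hS in
theorem regularCell_iff (i j : ℕ) : RegularCell S i j ↔ Regular n s t i j := by
  rw [RegularCell, Regular, hS, hS, hS]

include hS in
theorem isTree_iff (M : Filling S) : IsTree M ↔
    (∀ i j, Regular n s t i j → toTotal M (i + 1) j ≤ toTotal M i j ∧
      toTotal M i j ≤ toTotal M (i + 1) (j + 1)) ∧
    ∀ i j, Regular n s t i j → Regular n s t i (j + 1) → toTotal M i j ≠ toTotal M i (j + 1) := by
  constructor
  · rintro ⟨h1, h2⟩
    refine ⟨fun i j hr => ?_, fun i j hr hr' => ?_⟩
    · have hr := (regularCell_iff hS i j).2 hr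
      rw [toTotal_of_mem M hr.1, toTotal_of_mem M hr.2.1, toTotal_of_mem M hr.2.2]
      exact h1 i j _ _ _
    · have hr := (regularCell_iff hS i j).2 hr
      have hr' := (regularCell_iff hS i (j + 1)).2 hr'
      rw [toTotal_of_mem M hr.1, toTotal_of_mem M hr'.1]
      exact h2 i j hr hr'
  · rintro ⟨h1, h2⟩
    refine ⟨fun i j a b c => ?_, fun i j a b => ?_⟩
    · have := h1 i j ((regularCell_iff hS i j).1 ⟨a, b, c⟩)
      rwa [toTotal_of_mem M a, toTotal_of_mem M b, toTotal_of_mem M c] at this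
    · have := h2 i j ((regularCell_iff hS i j).1 a) ((regularCell_iff hS _ _).1 b)
      rwa [toTotal_of_mem M a.1, toTotal_of_mem M b.1] at this

theorem pow_ncard_eq_prod {R : Type*} [CommRing R] (u : R) (n : ℕ) (P : ℕ → ℕ → Prop)
    (hP : ∀ i j, P i j → j ≤ i ∧ i < n) (d : ∀ i j, Decidable (P i j)) :
    u ^ Set.ncard {c : ℕ × ℕ | P c.1 c.2} =
      ∏ i ∈ Finset.range n, ∏ j ∈ Finset.range (i + 1), if P i j then u else 1 := by
  classical
  have h1 : {c : ℕ × ℕ | P c.1 c.2} =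
      ((Finset.range n ×ˢ Finset.range n).filter fun c => P c.1 c.2 : Finset (ℕ × ℕ)) := by
    ext ⟨i, j⟩
    simp only [Set.mem_ofPred_eq, Finset.coe_filter, Finset.mem_product, Finset.mem_range]
    exact ⟨fun h => ⟨by have := hP i j h; omega, h⟩, fun h => h.2⟩
  rw [h1, Set.ncard_coe_finset, ← Finset.prod_const, Finset.prod_filter, Finset.prod_product]
  refine Finset.prod_congr rfl fun i hi => ?_
  rw [Finset.mem_range] at hi
  symm
  refine (Finset.prod_subset (s₂ := Finset.range n)
    (f := fun j => if P i j then u else 1) (fun j => ?_) fun j _ hj => ?_).trans ?_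
  · simp only [Finset.mem_range]; omega
  · rw [if_neg]
    intro h
    have := hP i j h
    rw [Finset.mem_range] at hj
    omega
  · refine Finset.prod_congr rfl fun j _ => ?_
    congr!

variable (hs : AntitoneOn s (Set.Icc 1 n)) (ht : MonotoneOn t (Set.Icc 1 n))
  (hrow : ∀ i, 1 ≤ i → i ≤ n → ∃ j, Cell n s t i j)

include hS hs ht hrow in
-- An exceptional diagonal has no deletion from the other side, so its bottom cell has explicit
-- coordinates and being above it becomes an equation.
theorem pow_invEx_mul_pow_invEx' {R : Type*} [CommRing R] (u v : R) {I J : Finset ℕ}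
    (hI : ∀ i ∈ I, 1 ≤ i ∧ i ≤ n ∧ t i = 0) (hJ : ∀ j ∈ J, 1 ≤ j ∧ j ≤ n ∧ s j = 0)
    (M : Filling S) :
    u ^ invEx n J M * v ^ invEx' I M = treeWeight u v n s t I J (toTotal M) := by
  classical
  have h1 : {c : ℕ × ℕ | (∃ h : RegularCell S c.1 c.2,
      M ⟨(c.1, c.2), h.1⟩ = M ⟨(c.1 + 1, c.2 + 1), h.2.2⟩) ∧
      ¬ ∃ e ∈ J, IsBottomSE n S e (c.1 + 1, c.2 + 1)} =
      {c : ℕ × ℕ | Regular n s t c.1 c.2 ∧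
        toTotal M c.1 c.2 = toTotal M (c.1 + 1) (c.2 + 1) ∧
        ¬ (n + c.2 - c.1 ∈ J ∧ c.1 + 1 + t (n + c.2 - c.1) = n)} := by
    ext ⟨i, j⟩
    simp only [Set.mem_ofPred_eq]
    rw [← regularCell_iff hS, ← and_assoc]
    refine and_congr ?_ (not_congr ?_)
    · constructor
      · rintro ⟨h, h'⟩
        exact ⟨h, by rwa [toTotal_of_mem M h.1, toTotal_of_mem M h.2.2]⟩
      · rintro ⟨h, h'⟩
        exact ⟨h, by rwa [toTotal_of_mem M h.1, toTotal_of_mem M h.2.2] at h'⟩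
    · constructor
      · rintro ⟨k, hk, hb⟩
        obtain ⟨k1, k2, k3⟩ := hJ k hk
        have hc := (cell_bottomSE hs ht hrow k1 k2 k3).1
        rw [isBottomSE_iff hs ht hrow hS k1 k2 k3, Prod.mk.injEq] at hb
        have hkk : n + j - i = k := by omega
        rw [hkk]
        exact ⟨hk, by omega⟩
      · rintro ⟨hk, hb⟩
        obtain ⟨k1, k2, k3⟩ := hJ _ hk
        refine ⟨_, hk, ?_⟩
        rw [isBottomSE_iff hs ht hrow hS k1 k2 k3, Prod.mk.injEq]
        omega
  have h2 : {c : ℕ × ℕ | (∃ h : RegularCell S c.1 c.2,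
      M ⟨(c.1, c.2), h.1⟩ = M ⟨(c.1 + 1, c.2), h.2.1⟩) ∧
      ¬ ∃ e ∈ I, IsBottomNE S e (c.1 + 1, c.2)} =
      {c : ℕ × ℕ | Regular n s t c.1 c.2 ∧ toTotal M c.1 c.2 = toTotal M (c.1 + 1) c.2 ∧
        ¬ (c.2 ∈ I ∧ c.1 + 1 + s c.2 = n)} := by
    ext ⟨i, j⟩
    simp only [Set.mem_ofPred_eq]
    rw [← regularCell_iff hS, ← and_assoc]
    refine and_congr ?_ (not_congr ?_)
    · constructor
      · rintro ⟨h, h'⟩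
        exact ⟨h, by rwa [toTotal_of_mem M h.1, toTotal_of_mem M h.2.1]⟩
      · rintro ⟨h, h'⟩
        exact ⟨h, by rwa [toTotal_of_mem M h.1, toTotal_of_mem M h.2.1] at h'⟩
    · constructor
      · rintro ⟨k, hk, hb⟩
        obtain ⟨k1, k2, k3⟩ := hI k hk
        have hc := (cell_bottomNE hs ht hrow k1 k2 k3).2.1
        rw [isBottomNE_iff hs ht hrow hS k1 k2 k3, Prod.mk.injEq] at hb
        rw [hb.2]
        exact ⟨hk, by omega⟩
      · rintro ⟨hk, hb⟩
        obtain ⟨k1, k2, k3⟩ := hI _ hk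
        refine ⟨_, hk, ?_⟩
        rw [isBottomNE_iff hs ht hrow hS k1 k2 k3, Prod.mk.injEq]
        omega
  have hreg : ∀ i j, Regular n s t i j → j ≤ i ∧ i < n := fun i j h =>
    ⟨h.1.2.1, h.2.1.2.2.1⟩
  rw [invEx, invEx', h1, h2, pow_ncard_eq_prod u n (fun i j => Regular n s t i j ∧
      toTotal M i j = toTotal M (i + 1) (j + 1) ∧
        ¬ (n + j - i ∈ J ∧ i + 1 + t (n + j - i) = n)) (fun i j h => hreg i j h.1)
      (fun _ _ => Classical.propDecidable _),
    pow_ncard_eq_prod v n (fun i j => Regular n s t i j ∧ toTotal M i j = toTotal M (i + 1) j ∧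
        ¬ (j ∈ I ∧ i + 1 + s j = n)) (fun i j h => hreg i j h.1)
      (fun _ _ => Classical.propDecidable _), treeWeight, ← Finset.prod_mul_distrib]
  refine Finset.prod_congr rfl fun i _ => ?_
  rw [← Finset.prod_mul_distrib]
  refine Finset.prod_congr rfl fun j _ => ?_
  rw [mul_comm, cellWeight]
  congr!

end Total

theorem mem_shape {n l r : ℕ} {s t : ℕ → ℕ} (i j : ℕ) :
    (i, j) ∈ shape n l r s t ↔ Cell n (fullS l s) (fullT n r t) i j := by
  simp only [shape, Finset.mem_filter, Finset.mem_product, Finset.mem_Icc, Cell]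
  have h1 : 1 ≤ j → i ≤ n → (¬ DeletedNE n l s (i, j) ↔ i + fullS l s j ≤ n) := by
    intro hj hi
    simp only [DeletedNE, fullS]
    split_ifs <;> omega
  have h2 : i ≤ n → (¬ DeletedSE n r t (i, j) ↔ i + fullT n r t (n + j - i) ≤ n) := by
    intro hi
    simp only [DeletedSE, fullT]
    split_ifs with h
    · constructor
      · intro h'
        by_contra hc
        exact h' ⟨n + j - i, Finset.mem_Icc.2 h, by omega, by omega⟩
      · rintro h' ⟨e, he, h3, h4⟩
        rw [show n + j - i = e by omega] at h'
        omega
    · refine iff_of_true ?_ (by omega)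
      rintro ⟨e, he, h3, h4⟩
      rw [Finset.mem_Icc] at he
      omega
  constructor
  · rintro ⟨⟨⟨a1, a2⟩, a3, a4⟩, a5, a6, a7⟩
    exact ⟨a3, a5, a2, (h1 a3 a2).1 a6, (h2 a2).1 a7⟩
  · rintro ⟨a3, a5, a2, a6, a7⟩
    exact ⟨⟨⟨by omega, a2⟩, a3, by omega⟩, a5, (h1 a3 a2).2 a6, (h2 a2).2 a7⟩

/-! ### From the given data to total arrays. -/

section Frozen

variable {n l r : ℕ} (hlr : l + r ≤ n) {s t : ℕ → ℕ} (hs : AntitoneOn s (Set.Icc 1 l))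
  (ht : MonotoneOn t (Set.Icc (n - r + 1) n)) (hst : NoInterference n l r s t)

include hs in
theorem antitoneOn_fullS : AntitoneOn (fullS l s) (Set.Icc 1 n) := by
  rintro i ⟨i1, i2⟩ j ⟨j1, j2⟩ hij
  simp only [fullS]
  split_ifs
  · exact hs ⟨by omega, by omega⟩ ⟨by omega, by omega⟩ hij
  · omega
  · omega
  · omega

include ht in
theorem monotoneOn_fullT : MonotoneOn (fullT n r t) (Set.Icc 1 n) := by
  rintro i ⟨i1, i2⟩ j ⟨j1, j2⟩ hij
  simp only [fullT]
  split_ifs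
  · exact ht ⟨by omega, by omega⟩ ⟨by omega, by omega⟩ hij
  · omega
  · omega
  · omega

include hst in
theorem exists_cell (i : ℕ) (h1 : 1 ≤ i) (h2 : i ≤ n) :
    ∃ j, Cell n (fullS l s) (fullT n r t) i j := by
  obtain ⟨j, hj⟩ := hst i (Finset.mem_Icc.2 ⟨h1, h2⟩)
  exact ⟨j, (mem_shape i j).1 hj⟩

include hst in
theorem exists_last_cell (hn : 1 ≤ n) :
    ∃ j, 1 ≤ j ∧ j ≤ n ∧ fullS l s j = 0 ∧ fullT n r t j = 0 := by
  obtain ⟨k, rfl⟩ := Nat.exists_eq_add_of_le' hn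
  obtain ⟨j, hj⟩ := exists_cell hst (k + 1) hn le_rfl
  exact ⟨j, cell_last_iff.1 hj⟩

include hlr ht hst in
-- For i = 1, the bottom row keeps a cell j ≥ 1 with t_j = 0, and t increases. For the others, i ≤ l
-- ≤ n - r.
theorem ExceptionalNE.full {I : Finset ℕ} (hI : ExceptionalNE n l s I) :
    ∀ i ∈ I, 1 ≤ i ∧ i ≤ n ∧ fullT n r t i = 0 := by
  intro i hi
  obtain ⟨h1, h2⟩ := hI i hi
  rw [Finset.mem_Icc] at h1
  refine ⟨h1.1, h1.2, ?_⟩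
  rcases h2 with rfl | ⟨h2, -⟩
  · obtain ⟨j, j1, j2, -, j4⟩ := exists_last_cell hst h1.2
    have := monotoneOn_fullT ht (Set.mem_Icc.2 h1) (Set.mem_Icc.2 ⟨j1, j2⟩) j1
    omega
  · rw [Finset.mem_Icc] at h2
    exact if_neg (by omega)

include hlr hs hst in
theorem ExceptionalSE.full {J : Finset ℕ} (hJ : ExceptionalSE n r t J) :
    ∀ j ∈ J, 1 ≤ j ∧ j ≤ n ∧ fullS l s j = 0 := by
  intro i hi
  obtain ⟨h1, h2⟩ := hJ i hi
  rw [Finset.mem_Icc] at h1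
  refine ⟨h1.1, h1.2, ?_⟩
  rcases h2 with rfl | ⟨h2, -⟩
  · obtain ⟨j, j1, j2, j3, -⟩ := exists_last_cell hst h1.1
    have := antitoneOn_fullS hs (Set.mem_Icc.2 ⟨j1, j2⟩) (Set.mem_Icc.2 h1) j2
    omega
  · exact if_neg (by omega)

include hs ht hst in
theorem admissible_full {R : Type*} [CommRing R] {u v : R} {b : ℕ → ℤ}
    (hb : StrictMonoOn b (Set.Icc 1 n) ∨ (u = 1 ∧ v = 1 ∧ MonotoneOn b (Set.Icc 1 n)))
    {I J : Finset ℕ} (hI : ExceptionalNE n l s I) (hJ : ExceptionalSE n r t J) :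
    Admissible u v n (fullS l s) (fullT n r t) I J b where
  anti := antitoneOn_fullS hs
  mono := monotoneOn_fullT ht
  row := exists_cell hst
  exNE := by
    intro i hi
    obtain ⟨h1, h2⟩ := hI i hi
    rw [Finset.mem_Icc] at h1
    refine ⟨h1.1, h1.2, h2.imp_right ?_⟩
    rintro ⟨h3, h4⟩
    rw [Finset.mem_Icc] at h3
    rw [fullS, fullS, if_pos (by omega), if_pos (by omega)]
    exact h4
  exSE := by
    intro j hj
    obtain ⟨h1, h2⟩ := hJ j hj
    rw [Finset.mem_Icc] at h1
    refine ⟨h1.1, h1.2, h2.imp_right ?_⟩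
    rintro ⟨h3, h4, h5⟩
    rw [fullT, fullT, if_pos (by omega), if_pos (by omega)]
    exact h5
  bottom := hb

include hlr hs ht hst in
-- Splitting the diagonals at n - r or by the vanishing of deletion lengths gives the same
-- conditions: a diagonal number with both lengths 0 has the same bottom cell (n, j) in either
-- sense.
theorem mem_trees_iff (b : ℕ → ℤ) (M : Filling (shape n l r s t)) :
    M ∈ trees n l r s t b ↔ IsTotalTree n (fullS l s) (fullT n r t) b (toTotal M) := by
  have hS := mem_shape (n := n) (l := l) (r := r) (s := s) (t := t)
  have hA := antitoneOn_fullS (n := n) hs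
  have hM := monotoneOn_fullT ht
  have hR := exists_cell hst
  have hNE := fun j h1 h2 h3 c => isBottomNE_iff hA hM hR hS (j := j) h1 h2 h3 c
  have hSE := fun j h1 h2 h3 c => isBottomSE_iff hA hM hR hS (j := j) h1 h2 h3 c
  have hcNE := fun j h1 h2 h3 => (hS _ _).2 (cell_bottomNE hA hM hR (j := j) h1 h2 h3)
  have hcSE := fun j h1 h2 h3 => (hS _ _).2 (cell_bottomSE hA hM hR (j := j) h1 h2 h3)
  rw [trees, Set.mem_ofPred_eq, isTree_iff hS]
  constructor
  · rintro ⟨⟨h1, h2⟩, h3, h4⟩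
    have k3 : ∀ j, 1 ≤ j → j ≤ n - r → toTotal M (n - fullS l s j) j = b j := by
      intro j j1 j2
      have j3 : fullT n r t j = 0 := if_neg (by omega)
      rw [toTotal_of_mem M (hcNE j j1 (by omega) j3)]
      exact h3 j (Finset.mem_Icc.2 ⟨j1, j2⟩) _ ((hNE j j1 (by omega) j3 _).2 rfl)
    have k4 : ∀ j, n - r + 1 ≤ j → j ≤ n →
        toTotal M (n - fullT n r t j) (j - fullT n r t j) = b j := by
      intro j j1 j2
      have j3 : fullS l s j = 0 := if_neg (by omega)
      rw [toTotal_of_mem M (hcSE j (by omega) j2 j3)]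
      exact h4 j (Finset.mem_Icc.2 ⟨j1, j2⟩) _ ((hSE j (by omega) j2 j3 _).2 rfl)
    refine ⟨fun i j hc => dif_neg (by rwa [hS]), h1, h2, fun j j1 j2 j3 => ?_,
      fun j j1 j2 j3 => ?_⟩
    · by_cases hj : j ≤ n - r
      · exact k3 j j1 hj
      · have h0 : fullS l s j = 0 := if_neg (by omega)
        have := k4 j (by omega) j2
        rw [j3, Nat.sub_zero, Nat.sub_zero] at this
        rwa [h0, Nat.sub_zero]
    · by_cases hj : j ≤ n - r
      · have h0 : fullT n r t j = 0 := if_neg (by omega)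
        have := k3 j j1 hj
        rw [j3, Nat.sub_zero] at this
        rwa [h0, Nat.sub_zero, Nat.sub_zero]
      · exact k4 j (by omega) j2
  · rintro ⟨-, h1, h2, h3, h4⟩
    refine ⟨⟨h1, h2⟩, fun j hj c hc => ?_, fun j hj c hc => ?_⟩
    · rw [Finset.mem_Icc] at hj
      have j3 : fullT n r t j = 0 := if_neg (by omega)
      have hc' := (hNE j hj.1 (by omega) j3 c).1 hc
      subst hc'
      rw [← toTotal_of_mem M hc.1]
      exact h3 j hj.1 (by omega) j3
    · rw [Finset.mem_Icc] at hj
      have j3 : fullS l s j = 0 := if_neg (by omega)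
      have hc' := (hSE j (by omega) hj.2 j3 c).1 hc
      subst hc'
      rw [← toTotal_of_mem M hc.1]
      exact h4 j (by omega) hj.2 j3

include hlr hs ht hst in
theorem image_toTotal_trees (b : ℕ → ℤ) : toTotal '' trees n l r s t b =
    {m | IsTotalTree n (fullS l s) (fullT n r t) b m} := by
  ext m
  constructor
  · rintro ⟨M, hM, rfl⟩
    exact (mem_trees_iff hlr hs ht hst b M).1 hM
  · intro hm
    obtain ⟨M, rfl⟩ := exists_toTotal_eq (S := shape n l r s t) (m := m) fun i j h =>
      IsTotalTree.eq_zero hm i j (by rwa [← mem_shape])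
    exact ⟨M, (mem_trees_iff hlr hs ht hst b M).2 hm, rfl⟩

variable {R : Type*} [CommRing R] {u v : R} {b : ℕ → ℤ}
  (hb : StrictMonoOn b (Set.Icc 1 n) ∨ (u = 1 ∧ v = 1 ∧ MonotoneOn b (Set.Icc 1 n)))
  {I J : Finset ℕ} (hI : ExceptionalNE n l s I) (hJ : ExceptionalSE n r t J)

include hlr hs ht hst hI hJ in
theorem finsum_trees_eq (ω : ℤ → R) :
    ∑ᶠ M ∈ trees n l r s t b, u ^ invEx n J M * v ^ invEx' I M * ω (toTotal M 1 1) =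
      ∑ᶠ m ∈ {m | IsTotalTree n (fullS l s) (fullT n r t) b m},
        treeWeight u v n (fullS l s) (fullT n r t) I J m * ω (m 1 1) := by
  rw [← image_toTotal_trees hlr hs ht hst b, finsum_mem_image toTotal_injective.injOn]
  refine finsum_mem_congr rfl fun M _ => ?_
  rw [pow_invEx_mul_pow_invEx' mem_shape (antitoneOn_fullS hs) (monotoneOn_fullT ht)
    (exists_cell hst) u v (hI.full hlr ht hst) (hJ.full hlr hs hst)]

theorem ExceptionalNE.mem_Icc {I : Finset ℕ} (hI : ExceptionalNE n l s I) :
    ∀ i ∈ I, i ∈ Finset.Icc 1 n := fun i hi => (hI i hi).1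

theorem ExceptionalSE.mem_Icc {J : Finset ℕ} (hJ : ExceptionalSE n r t J) :
    ∀ j ∈ J, j ∈ Finset.Icc 1 n := fun j hj => (hJ j hj).1

include hlr hs ht hst hb hI hJ in
theorem finite_trees_and_genFunEx_eq :
    (trees n l r s t b).Finite ∧ genFunEx u v n I J (trees n l r s t b) =
      constTerm (integrand n l r s t b u v * exFactor I J u v) := by
  have hadm := admissible_full hs ht hst hb hI hJ
  have hsum := finsum_trees_eq (u := u) (v := v) (b := b) hlr hs ht hst hI hJ fun _ => 1
  simp only [mul_one] at hsum
  rw [integrand_mul_exFactor hlr hI.mem_Icc hJ.mem_Icc, genFunEx, hsum]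
  -- The induction starts at order 1. In order 0 there is one empty filling and the expression is 1.
  rcases Nat.eq_zero_or_pos n with rfl | hn
  · have hset : {m | IsTotalTree 0 (fullS l s) (fullT 0 r t) b m} = {fun _ _ => 0} := by
      have hc : ∀ i j, ¬ Cell 0 (fullS l s) (fullT 0 r t) i j := by
        rintro i j ⟨h1, h2, h3, -⟩; omega
      ext m
      constructor
      · intro hm
        funext i j
        exact IsTotalTree.eq_zero hm i j (hc i j)
      · rintro rfl
        exact ⟨fun _ _ _ => rfl, fun i j h => absurd h.1 (hc i j),
          fun i j h => absurd h.1 (hc i j), fun j h1 h2 => by omega, fun j h1 h2 => by omega⟩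
    refine ⟨Set.Finite.of_finite_image ?_ toTotal_injective.injOn, ?_⟩
    · rw [image_toTotal_trees hlr hs ht hst b, hset]
      exact Set.finite_singleton _
    · rw [hset, finsum_mem_singleton]
      simp [treeWeight, treeExpr, pairPart, pairProd, constTerm_one]
  -- With the trivial top weight, an exceptional factor in order 1 still has constant term 1, so `C`
  -- can be `True`.
  · have := finsum_isTotalTree (u := u) (v := v) expandable_one (fun _ => 1) 0 (b 1) (b n) True
      (fun β _ _ P Q _ => by rw [mul_one, constTerm_diagFac_zero]) n hn _ _ I J b hadm le_rfl le_rfl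
      (Or.inl trivial)
    simp only [mul_one] at this
    refine ⟨Set.Finite.of_finite_image ?_ toTotal_injective.injOn, this.2⟩
    rw [image_toTotal_trees hlr hs ht hst b]
    exact this.1

include hlr hs ht hst hb hI hJ in
theorem genFunEx_treesTop_eq {mn a mx : ℤ} (hn : 1 ≤ n) (h1 : mn ≤ a) (h3 : mn ≤ b 1)
    (h4 : b n ≤ mx) (hI1 : ∀ i ∈ I, ¬ IsBottomNE (shape n l r s t) i (1, 1))
    (hJ1 : ∀ j ∈ J, ¬ IsBottomSE n (shape n l r s t) j (1, 1)) :
    genFunEx u v n I J (treesTop n l r s t b a) =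
      constTerm (integrand n l r s t b u v * exFactor I J u v * topFactor R n a mn mx) := by
  classical
  have hadm := admissible_full hs ht hst hb hI hJ
  have hcell : (1, 1) ∈ shape n l r s t := (mem_shape 1 1).2 (cell_one_one (exists_cell hst) hn)
  have hsum := finsum_trees_eq (u := u) (v := v) (b := b) hlr hs ht hst hI hJ
    fun β => if β = a then 1 else 0
  have htop : genFunEx u v n I J (treesTop n l r s t b a) =
      ∑ᶠ M ∈ trees n l r s t b, u ^ invEx n J M * v ^ invEx' I M *
        (if toTotal M 1 1 = a then 1 else 0) := by
    rw [genFunEx, finsum_mem_def, finsum_mem_def]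
    refine finsum_congr fun M => ?_
    by_cases hM : M ∈ trees n l r s t b
    · rw [Set.indicator_of_mem hM]
      by_cases ha : toTotal M 1 1 = a
      · have : M ∈ treesTop n l r s t b a := ⟨hM, hcell, by rwa [← toTotal_of_mem M hcell]⟩
        rw [Set.indicator_of_mem this, if_pos ha, mul_one]
      · have : M ∉ treesTop n l r s t b a := by
          rintro ⟨-, h, h'⟩
          exact ha (by rwa [toTotal_of_mem])
        rw [Set.indicator_of_notMem this, if_neg ha, mul_zero]
    · rw [Set.indicator_of_notMem hM, Set.indicator_of_notMem fun h => hM h.1]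
  rw [integrand_mul_exFactor_mul_topFactor hlr hI.mem_Icc hJ.mem_Icc mx h1, htop, hsum]
  refine (finsum_isTotalTree (u := u) (v := v) (expandable_topSymm a mn mx)
    (fun β => if β = a then 1 else 0) (-mn) mn mx False ?_ n hn _ _ I J b hadm h3 h4 ?_).2
  -- An exceptional factor at the top cell would multiply the series (1 + x)^N and spoil the
  -- binomial inversion, so here `C` is `False`.
  · rintro β hβ1 hβ2 P Q (hF | ⟨hP, hQ⟩)
    · exact hF.elim
    · rw [diagFac_zero u v _ _ hP hQ, constTerm_e_mul_topSymm h1 hβ1 hβ2]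
  · refine Or.inr ⟨fun hc => hI1 1 hc.1 ?_, fun hc => hJ1 n hc.1 ?_⟩
    · have := hI.full hlr ht hst 1 hc.1
      rw [isBottomNE_iff (antitoneOn_fullS hs) (monotoneOn_fullT ht) (exists_cell hst) mem_shape
        this.1 this.2.1 this.2.2, Prod.mk.injEq]
      omega
    · have := hJ.full hlr hs hst n hc.1
      rw [isBottomSE_iff (antitoneOn_fullS hs) (monotoneOn_fullT ht) (exists_cell hst) mem_shape
        this.1 this.2.1 this.2.2, Prod.mk.injEq]
      omega

theorem genFun_eq_genFunEx (u v : R) (n : ℕ) {S : Finset (ℕ × ℕ)} (T : Set (Filling S)) :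
    genFun u v T = genFunEx u v n ∅ ∅ T := by
  simp [genFun, genFunEx, inv, inv', invEx, invEx']

end Frozen

end STTree

open STTree in
theorem mainTheorem4 {R : Type*} [CommRing R] (u v : R) (n l r : ℕ) (hlr : l + r ≤ n)
    (s t : ℕ → ℕ) (hs : AntitoneOn s (Set.Icc 1 l)) (ht : MonotoneOn t (Set.Icc (n - r + 1) n))
    (hst : NoInterference n l r s t)
    (b : ℕ → ℤ)
    (hb : StrictMonoOn b (Set.Icc 1 n) ∨ (u = 1 ∧ v = 1 ∧ MonotoneOn b (Set.Icc 1 n))) :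
    (trees n l r s t b).Finite ∧
    genFun u v (trees n l r s t b) = constTerm (integrand n l r s t b u v) ∧
    (∀ I J : Finset ℕ, ExceptionalNE n l s I → ExceptionalSE n r t J →
      genFunEx u v n I J (trees n l r s t b) =
        constTerm (integrand n l r s t b u v * exFactor I J u v)) ∧
    (∀ mn a mx : ℤ, 1 ≤ n → mn ≤ a → a ≤ mx → mn ≤ b 1 → b n ≤ mx →
      genFun u v (treesTop n l r s t b a) =
        constTerm (integrand n l r s t b u v * topFactor R n a mn mx) ∧
      ∀ I J : Finset ℕ, ExceptionalNE n l s I → ExceptionalSE n r t J →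
        (∀ i ∈ I, ¬ IsBottomNE (shape n l r s t) i (1, 1)) →
        (∀ j ∈ J, ¬ IsBottomSE n (shape n l r s t) j (1, 1)) →
        genFunEx u v n I J (treesTop n l r s t b a) =
          constTerm (integrand n l r s t b u v * exFactor I J u v * topFactor R n a mn mx)) := by
  have hI0 : ExceptionalNE n l s ∅ := fun _ h => by simp at h
  have hJ0 : ExceptionalSE n r t ∅ := fun _ h => by simp at h
  refine ⟨(finite_trees_and_genFunEx_eq hlr hs ht hst hb hI0 hJ0).1, ?_, fun I J hI hJ =>
    (finite_trees_and_genFunEx_eq hlr hs ht hst hb hI hJ).2, fun mn a mx hn h1 _ h3 h4 => ⟨?_,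
    fun I J hI hJ hI1 hJ1 => genFunEx_treesTop_eq hlr hs ht hst hb hI hJ hn h1 h3 h4 hI1 hJ1⟩⟩
  · rw [genFun_eq_genFunEx, (finite_trees_and_genFunEx_eq hlr hs ht hst hb hI0 hJ0).2,
      exFactor_empty, mul_one]
  · rw [genFun_eq_genFunEx, genFunEx_treesTop_eq hlr hs ht hst hb hI0 hJ0 hn h1 h3 h4
      (by simp) (by simp), exFactor_empty, mul_one]
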